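/- **Setting.** Let $(\mathbb X,d)$ be a complete separable metric space, $\nu$ a nonnegative Borel measure on $\mathbb X$ that is finite on bounded sets, $1<p<\infty$ and $\frac1p+\frac1{p'}=1$. *Sobolev functions.* A Borel function $g:\mathbb X\to[0,\infty]$ is an upper gradient of a Borel function $u:\mathbb X\to\mathbb R$ if $|u(\gamma(l_\gamma))-u(\gamma(0))|\le\int_\gamma g\,ds$ for every rectifiable curve $\gamma:[0,l_\gamma]\to\mathbb X$ parametrised by arc length, and a $p$-weak upper gradient if the family of curves for which this fails has $p$-modulus zero. $D^{1,p}(\mathbb X)$ is the space of Borel functions $u:\mathbb X\to\mathbb R$ that have an upper gradient in $L^p(\mathbb X,\nu)$, $|Du|$ is the minimal $p$-weak upper gradient of $u\in D^{1,p}(\mathbb X)$, and $W^{1,p}(\mathbb X,d,\nu)=D^{1,p}(\mathbb X)\cap L^p(\mathbb X,\nu)$; a class in $L^2(\mathbb X,\nu)$ is said to lie in $W^{1,p}(\mathbb X,d,\nu)$ if it has a representative there. *Differential structure.* $L^p(T^*\mathbb X)$ is the $p$-cotangent module: the completion, with respect to the norm $\|\{(f_i,A_i)\}\|=\big(\sum_i\int_{A_i}|Df_i|^p\,d\nu\big)^{1/p}$,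 of the space of sequences $\{(f_i,A_i)\}_{i\in\mathbb N}$ in which $(A_i)$ is a Borel partition of $\mathbb X$, $f_i\in D^{1,p}(\mathbb X)$ and $\sum_i\int_{A_i}|Df_i|^p\,d\nu<\infty$, where $\{(f_i,A_i)\}$ and $\{(g_j,B_j)\}$ are identified if $|D(f_i-g_j)|=0$ $\nu$-a.e. on $A_i\cap B_j$ for all $i,j$, and the sum is $\{(f_i+g_j,A_i\cap B_j)\}$. Its pointwise norm $|\cdot|_*:L^p(T^*\mathbb X)\to L^p(\mathbb X,\nu)$ is the continuous extension of $|\{(f_i,A_i)\}|_*=|Df_i|$ on $A_i$, and it is a module over $L^\infty(\mathbb X,\nu)$. The differential of $f\in D^{1,p}(\mathbb X)$ is $df=(f,\mathbb X)\in L^p(T^*\mathbb X)$. $L^{p'}(T\mathbb X)$ is the space of bounded linear maps $X:L^p(T^*\mathbb X)\to L^1(\mathbb X,\nu)$, $\omega\mapsto\omega(X)$, that commute with multiplication by functions in $L^\infty(\mathbb X,\nu)$. $\mathcal D^{p',2}(\mathbb X)$ is the set of $X\in L^{p'}(T\mathbb X)$ for which there is $f=:\operatorname{div}(X)\in L^2(\mathbb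 X,\nu)$ with $\int_{\mathbb X} fg\,d\nu=-\int_{\mathbb X} dg(X)\,d\nu$ for all $g\in W^{1,p}(\mathbb X,d,\nu)\cap L^2(\mathbb X,\nu)$. *Functional.* Let $E:L^p(T^*\mathbb X)\to\mathbb R$ be continuous and convex, and suppose that there is $C>0$ with $E(v)\ge C\int_{\mathbb X}|v|_*^p\,d\nu$ for all $v\in L^p(T^*\mathbb X)$. Define $\mathcal F:L^2(\mathbb X,\nu)\to[0,+\infty]$ by $\mathcal F(u)=E(du)$ if $u\in W^{1,p}(\mathbb X,d,\nu)$ and $\mathcal F(u)=+\infty$ otherwise, and suppose that $\mathcal F$, which is convex, is lower semicontinuous on $L^2(\mathbb X,\nu)$. Here $\partial\mathcal F$ is the subdifferential in the Hilbert space $L^2(\mathbb X,\nu)$, and $X\in\partial E(\omega)$ means that $X\in L^{p'}(T\mathbb X)$ and $E(\omega+\eta)-E(\omega)\ge\int_{\mathbb X}\eta(X)\,d\nu$ for all $\eta\in L^p(T^*\mathbb X)$. Given $u_0\in L^2(\mathbb X,\nu)$ and $T>0$, a *weak solution* of the Cauchy problem $-u_t\in\partial\mathcal F(u)$ on $[0,T]$,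 $u(0)=u_0$, is a function $u\in C([0,T];L^2(\mathbb X,\nu))\cap W^{1,2}_{\rm loc}(0,T;L^2(\mathbb X,\nu))$ with $u(0)=u_0$ and $-u_t(t)\in\partial\mathcal F(u(t))$ for almost all $t\in(0,T)$. **Theorem.** For every $u_0\in L^2(\mathbb X,\nu)$ and every $T>0$ there exists a unique weak solution $u$ on $[0,T]$ of the Cauchy problem $-u_t\in\partial\mathcal F(u)$, $u(0)=u_0$. Moreover, a function $u\in C([0,T];L^2(\mathbb X,\nu))\cap W^{1,2}_{\rm loc}(0,T;L^2(\mathbb X,\nu))$ with $u(0)=u_0$ is a weak solution if and only if for almost all $t\in(0,T)$ we have $u(t)\in W^{1,p}(\mathbb X,d,\nu)$ and there is $X(t)\in\mathcal D^{p',2}(\mathbb X)$ with $$u_t(t)=\operatorname{div}(X(t)),\qquad X(t)\in\partial E(du(t)).$$ -/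

import Mathlib

open MeasureTheory Set Filter Topology
open scoped ENNReal NNReal

set_option linter.unusedSectionVars false

noncomputable section

namespace MetricFlow

/-! ### Upper gradients, `p`-modulus and the Sobolev-Dirichlet class -/

section Sobolev

variable {X : Type*} [MetricSpace X]

/-- A compact rectifiable curve in `X`, parametrised by arc length on `[0, len]`.  Only the values
of `toFun` on `[0, len]` matter. -/
structure Curve (X : Type*) [MetricSpace X] where
  len : ℝ
  len_nonneg : 0 ≤ len
  toFun : ℝ → X
  unitSpeed : HasUnitSpeedOn toFun (Icc 0 len)

/-- The line integral `∫_γ g ds`; the metric speed of `γ` is `1` a.e. because `γ` is parametrised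
by arc length. -/
def Curve.integral (γ : Curve X) (g : X → ℝ≥0∞) : ℝ≥0∞ :=
  ∫⁻ t in Icc 0 γ.len, g (γ.toFun t)

/-- The upper gradient inequality `|u(γ(l_γ)) - u(γ(0))| ≤ ∫_γ g ds` along one curve. -/
def UpperGradientIneq (u : X → ℝ) (g : X → ℝ≥0∞) (γ : Curve X) : Prop :=
  ENNReal.ofReal |u (γ.toFun γ.len) - u (γ.toFun 0)| ≤ γ.integral g

variable [MeasurableSpace X]

/-- `g` is an upper gradient of `u`. -/
def IsUpperGradient (u : X → ℝ) (g : X → ℝ≥0∞) : Prop :=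
  Measurable g ∧ ∀ γ : Curve X, UpperGradientIneq u g γ

/-- The `p`-modulus of a family of curves. -/
def modulus (ν : Measure X) (p : ℝ) (Γ : Set (Curve X)) : ℝ≥0∞ :=
  ⨅ (ρ : X → ℝ≥0∞) (_ : Measurable ρ) (_ : ∀ γ ∈ Γ, 1 ≤ γ.integral ρ), ∫⁻ x, ρ x ^ p ∂ν

/-- `g` is a `p`-weak upper gradient of `u`: the upper gradient inequality holds along `p`-almost
every curve. -/
def IsWeakUpperGradient (ν : Measure X) (p : ℝ) (u : X → ℝ) (g : X → ℝ≥0∞) : Prop :=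
  Measurable g ∧ modulus ν p {γ | ¬ UpperGradientIneq u g γ} = 0

theorem modulus_mono (ν : Measure X) (p : ℝ) {Γ Γ' : Set (Curve X)} (h : Γ ⊆ Γ') :
    modulus ν p Γ ≤ modulus ν p Γ' :=
  le_iInf fun ρ => le_iInf fun hρ => le_iInf fun h1 =>
    iInf_le_of_le ρ (iInf_le_of_le hρ (iInf_le_of_le (fun γ hγ => h1 γ (h hγ)) le_rfl))

theorem modulus_empty (ν : Measure X) {p : ℝ} (hp : 1 < p) :
    modulus ν p (∅ : Set (Curve X)) = 0 := by
  refine le_antisymm ?_ zero_le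
  refine iInf_le_of_le (fun _ => 0) (iInf_le_of_le measurable_const (iInf_le_of_le (by simp) ?_))
  simp [ENNReal.zero_rpow_of_pos (zero_lt_one.trans hp)]

theorem modulus_union_eq_zero {ν : Measure X} {p : ℝ} (hp : 1 < p) {Γ Γ' : Set (Curve X)}
    (h : modulus ν p Γ = 0) (h' : modulus ν p Γ' = 0) : modulus ν p (Γ ∪ Γ') = 0 := by
  have h2 : (2 : ℝ≥0∞) ^ (p - 1) ≠ ∞ := ENNReal.rpow_ne_top_of_nonneg (by linarith) (by simp)
  have key : ∀ ε : ℝ≥0∞, 0 < ε → modulus ν p (Γ ∪ Γ') ≤ 2 ^ (p - 1) * (ε + ε) := by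
    intro ε hε
    rw [← h] at hε
    have hε' := hε
    rw [h, ← h'] at hε'
    simp only [modulus, iInf_lt_iff] at hε hε'
    obtain ⟨ρ, hρ, h1, hlt⟩ := hε
    obtain ⟨ρ', hρ', h1', hlt'⟩ := hε'
    refine iInf_le_of_le (fun x => ρ x + ρ' x) (iInf_le_of_le (hρ.add hρ') (iInf_le_of_le ?_ ?_))
    · rintro γ (hγ | hγ)
      · exact (h1 γ hγ).trans (lintegral_mono fun t => le_self_add)
      · exact (h1' γ hγ).trans (lintegral_mono fun t => le_add_self)
    · calc ∫⁻ x, (ρ x + ρ' x) ^ p ∂ν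
          ≤ ∫⁻ x, 2 ^ (p - 1) * (ρ x ^ p + ρ' x ^ p) ∂ν :=
            lintegral_mono fun x => ENNReal.rpow_add_le_mul_rpow_add_rpow _ _ hp.le
        _ = 2 ^ (p - 1) * (∫⁻ x, ρ x ^ p ∂ν + ∫⁻ x, ρ' x ^ p ∂ν) := by
            rw [lintegral_const_mul' _ _ h2, lintegral_add_left (hρ.pow_const p)]
        _ ≤ _ := by gcongr
  have lim : Tendsto (fun ε : ℝ≥0∞ => 2 ^ (p - 1) * (ε + ε)) (𝓝[>] 0) (𝓝 0) := by
    have : Tendsto (fun ε : ℝ≥0∞ => 2 ^ (p - 1) * (ε + ε)) (𝓝 0) (𝓝 (2 ^ (p - 1) * (0 + 0))) :=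
      ENNReal.Tendsto.const_mul (tendsto_id.add tendsto_id) (Or.inr h2)
    simp only [add_zero, mul_zero] at this
    exact this.mono_left nhdsWithin_le_nhds
  exact le_antisymm (ge_of_tendsto lim (by
    filter_upwards [self_mem_nhdsWithin] with ε hε using key ε hε)) zero_le

theorem UpperGradientIneq.add {u u' : X → ℝ} {g g' : X → ℝ≥0∞} {γ : Curve X}
    (h : UpperGradientIneq u g γ) (h' : UpperGradientIneq u' g' γ) :
    UpperGradientIneq (u + u') (g + g') γ := by
  have h1 : γ.integral g + γ.integral g' ≤ γ.integral (g + g') :=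
    le_lintegral_add _ _
  refine le_trans ?_ ((add_le_add h h').trans h1)
  rw [← ENNReal.ofReal_add (abs_nonneg _) (abs_nonneg _)]
  refine ENNReal.ofReal_le_ofReal ?_
  have := abs_add_le (u (γ.toFun γ.len) - u (γ.toFun 0)) (u' (γ.toFun γ.len) - u' (γ.toFun 0))
  rw [Pi.add_apply, Pi.add_apply, add_sub_add_comm]
  exact this

theorem UpperGradientIneq.smul {u : X → ℝ} {g : X → ℝ≥0∞} {γ : Curve X}
    (c : ℝ) (h : UpperGradientIneq u g γ) :
    UpperGradientIneq (c • u) (fun x => ENNReal.ofReal |c| * g x) γ := by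
  have h1 : γ.integral (fun x => ENNReal.ofReal |c| * g x) = ENNReal.ofReal |c| * γ.integral g :=
    lintegral_const_mul' _ _ ENNReal.ofReal_ne_top
  unfold UpperGradientIneq
  rw [h1]
  simp only [Pi.smul_apply, smul_eq_mul]
  rw [← mul_sub, abs_mul, ENNReal.ofReal_mul (abs_nonneg _)]
  gcongr
  exact h

theorem IsUpperGradient.isWeak {ν : Measure X} {p : ℝ} (hp : 1 < p) {u : X → ℝ} {g : X → ℝ≥0∞}
    (h : IsUpperGradient u g) : IsWeakUpperGradient ν p u g := by
  refine ⟨h.1, ?_⟩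
  have : {γ : Curve X | ¬ UpperGradientIneq u g γ} = ∅ := by
    ext γ; simp [h.2 γ]
  rw [this, modulus_empty ν hp]

theorem IsWeakUpperGradient.add {ν : Measure X} {p : ℝ} (hp : 1 < p) {u u' : X → ℝ}
    {g g' : X → ℝ≥0∞} (h : IsWeakUpperGradient ν p u g) (h' : IsWeakUpperGradient ν p u' g') :
    IsWeakUpperGradient ν p (u + u') (g + g') := by
  refine ⟨h.1.add h'.1, le_antisymm ?_ zero_le⟩
  refine (modulus_mono ν p ?_).trans (modulus_union_eq_zero hp h.2 h'.2).le
  intro γ hγ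
  by_contra hc
  simp only [mem_union, mem_ofPred_eq, not_or, not_not] at hc
  exact hγ (hc.1.add hc.2)

theorem IsWeakUpperGradient.smul {ν : Measure X} {p : ℝ} {u : X → ℝ}
    {g : X → ℝ≥0∞} (c : ℝ) (h : IsWeakUpperGradient ν p u g) :
    IsWeakUpperGradient ν p (c • u) (fun x => ENNReal.ofReal |c| * g x) := by
  refine ⟨h.1.const_mul _, le_antisymm ?_ zero_le⟩
  refine (modulus_mono ν p ?_).trans h.2.le
  intro γ hγ hc
  exact hγ (hc.smul c)

theorem lintegral_const_mul_rpow_lt_top {ν : Measure X} {p : ℝ} (hp : 1 < p) (c : ℝ)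
    {g : X → ℝ≥0∞} (h : ∫⁻ x, g x ^ p ∂ν < ∞) :
    ∫⁻ x, (ENNReal.ofReal |c| * g x) ^ p ∂ν < ∞ := by
  have hp0 : 0 ≤ p := by linarith
  simp only [ENNReal.mul_rpow_of_nonneg _ _ hp0]
  have hc : ENNReal.ofReal |c| ^ p ≠ ∞ := ENNReal.rpow_ne_top_of_nonneg hp0 ENNReal.ofReal_ne_top
  rw [lintegral_const_mul' _ _ hc]
  exact ENNReal.mul_lt_top hc.lt_top h

/-- The Sobolev-Dirichlet class `D^{1,p}(X)`: Borel functions with an upper gradient in `L^p`. -/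
def dirichletClass (ν : Measure X) (p : ℝ) [hp : Fact (1 < p)] : Submodule ℝ (X → ℝ) where
  carrier := {u | Measurable u ∧ ∃ g, IsUpperGradient u g ∧ ∫⁻ x, g x ^ p ∂ν < ∞}
  add_mem' := by
    rintro u u' ⟨hu, g, hg, hgp⟩ ⟨hu', g', hg', hgp'⟩
    exact ⟨hu.add hu', g + g', ⟨hg.1.add hg'.1, fun γ => (hg.2 γ).add (hg'.2 γ)⟩,
      ENNReal.lintegral_rpow_add_lt_top_of_lintegral_rpow_lt_top hg.1.aemeasurable hgp hgp'
        hp.out.le⟩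
  zero_mem' := by
    refine ⟨measurable_const, fun _ => 0, ⟨measurable_const, fun γ => ?_⟩, ?_⟩
    · simp [UpperGradientIneq]
    · simp [ENNReal.zero_rpow_of_pos (zero_lt_one.trans hp.out)]
  smul_mem' := by
    rintro c u ⟨hu, g, hg, hgp⟩
    exact ⟨hu.const_smul c, fun x => ENNReal.ofReal |c| * g x,
      ⟨hg.1.const_mul _, fun γ => (hg.2 γ).smul c⟩,
      lintegral_const_mul_rpow_lt_top hp.out c hgp⟩

/-! ### The minimal `p`-weak upper gradient -/

variable {ν : Measure X} {p : ℝ} [hp : Fact (1 < p)]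

/-- `G` is the `ν`-essential infimum of all the `p`-weak upper gradients of `u` in `L^p`. -/
def IsMinGradient (ν : Measure X) (p : ℝ) (u : X → ℝ) (G : X → ℝ≥0∞) : Prop :=
  Measurable G ∧
  (∀ g, IsWeakUpperGradient ν p u g → ∫⁻ x, g x ^ p ∂ν < ∞ → G ≤ᵐ[ν] g) ∧
  ∀ H, Measurable H →
    (∀ g, IsWeakUpperGradient ν p u g → ∫⁻ x, g x ^ p ∂ν < ∞ → H ≤ᵐ[ν] g) → H ≤ᵐ[ν] G

theorem exists_isMinGradient (u : dirichletClass ν p) : ∃ G, IsMinGradient ν p u.1 G := by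
  have hp0 : 0 < p := zero_lt_one.trans hp.out
  let S : Set (X → ℝ≥0∞) := {g | IsWeakUpperGradient ν p u.1 g ∧ ∫⁻ x, g x ^ p ∂ν < ∞}
  obtain ⟨-, g₀, hg₀, hg₀p⟩ := u.2
  have hg₀S : g₀ ∈ S := ⟨hg₀.isWeak hp.out, hg₀p⟩
  let J : (ℕ → S) → ℝ≥0∞ := fun s => ∫⁻ x, (⨅ n, (s n).1 x) ^ p ∂ν
  have : Nonempty (ℕ → S) := ⟨fun _ => ⟨g₀, hg₀S⟩⟩
  obtain ⟨m, -, hmlim, hmem⟩ := exists_seq_tendsto_sInf (range_nonempty J) (OrderBot.bddBelow _)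
  choose s hs using hmem
  -- merge all the minimising sequences into one
  let t : ℕ → S := fun k => s k.unpair.1 k.unpair.2
  have ht_le : ∀ n, J t ≤ m n := by
    intro n
    rw [← hs n]
    refine lintegral_mono fun x => ENNReal.rpow_le_rpow ?_ hp0.le
    refine le_iInf fun k => ?_
    refine iInf_le_of_le (Nat.pair n k) ?_
    simp [t]
  have ht_min : ∀ s', J t ≤ J s' := fun s' =>
    (ge_of_tendsto' hmlim ht_le).trans (sInf_le (mem_range_self s'))
  have ht_fin : J t ≠ ∞ := by
    refine ((ht_min fun _ => ⟨g₀, hg₀S⟩).trans_lt ?_).ne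
    simpa [J] using hg₀p
  have hmeas : Measurable fun x => ⨅ n, (t n).1 x := Measurable.iInf fun n => (t n).2.1.1
  refine ⟨fun x => ⨅ n, (t n).1 x, hmeas, ?_, ?_⟩
  · intro g hg hgp
    let t' : ℕ → S := fun n => Nat.casesOn n ⟨g, hg, hgp⟩ t
    have hle1 : ∀ x, ⨅ n, (t' n).1 x ≤ ⨅ n, (t n).1 x := fun x =>
      le_iInf fun n => iInf_le_of_le (n + 1) le_rfl
    have hle2 : ∀ x, ⨅ n, (t' n).1 x ≤ g x := fun x => iInf_le_of_le 0 le_rfl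
    have hmeas' : Measurable fun x => ⨅ n, (t' n).1 x := Measurable.iInf fun n => (t' n).2.1.1
    have hae := ae_eq_of_ae_le_of_lintegral_le (μ := ν)
      (f := fun x => (⨅ n, (t' n).1 x) ^ p) (g := fun x => (⨅ n, (t n).1 x) ^ p)
      (Eventually.of_forall fun x => ENNReal.rpow_le_rpow (hle1 x) hp0.le)
      (((lintegral_mono fun x => ENNReal.rpow_le_rpow (hle1 x) hp0.le).trans_lt
        ht_fin.lt_top).ne)
      (hmeas.pow_const p).aemeasurable (ht_min t')
    filter_upwards [hae] with x hx
    have := (ENNReal.rpow_left_injective hp0.ne') hx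
    rw [← this]
    exact hle2 x
  · intro H _ hHle
    have : ∀ᵐ x ∂ν, ∀ n, H x ≤ (t n).1 x :=
      ae_all_iff.2 fun n => hHle _ (t n).2.1 (t n).2.2
    filter_upwards [this] with x hx using le_iInf hx

/-- The minimal `p`-weak upper gradient `|Du|` of `u ∈ D^{1,p}(X)`, as the essential infimum of the
`p`-weak upper gradients of `u` in `L^p`: it lies below all of them, and it is the largest such
function, `ν`-a.e.  It is determined up to `ν`-null sets. -/
def minGradient (u : dirichletClass ν p) : X → ℝ≥0∞ := (exists_isMinGradient u).choose

theorem isMinGradient (u : dirichletClass ν p) : IsMinGradient ν p u.1 (minGradient u) :=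
  (exists_isMinGradient u).choose_spec

theorem minGradient_lintegral_lt_top (u : dirichletClass ν p) :
    ∫⁻ x, minGradient u x ^ p ∂ν < ∞ := by
  have hp0 : 0 < p := zero_lt_one.trans hp.out
  obtain ⟨-, g₀, hg₀, hg₀p⟩ := u.2
  refine (lintegral_mono_ae ?_).trans_lt hg₀p
  filter_upwards [(isMinGradient u).2.1 g₀ (hg₀.isWeak hp.out) hg₀p] with x hx
  exact ENNReal.rpow_le_rpow hx hp0.le

theorem minGradient_add_le (u v : dirichletClass ν p) :
    ∀ᵐ x ∂ν, minGradient (u + v) x ≤ minGradient u x + minGradient v x := by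
  obtain ⟨hm, hle, -⟩ := isMinGradient (u + v)
  have h1 : ∀ g, IsWeakUpperGradient ν p u.1 g → ∫⁻ x, g x ^ p ∂ν < ∞ →
      (fun x => minGradient (u + v) x - g x) ≤ᵐ[ν] minGradient v := by
    intro g hg hgp
    refine (isMinGradient v).2.2 _ (hm.sub hg.1) fun g' hg' hgp' => ?_
    filter_upwards [hle _ (hg.add hp.out hg')
      (ENNReal.lintegral_rpow_add_lt_top_of_lintegral_rpow_lt_top hg.1.aemeasurable hgp hgp'
        hp.out.le)] with x hx
    exact tsub_le_iff_left.2 hx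
  have h2 : (fun x => minGradient (u + v) x - minGradient v x) ≤ᵐ[ν] minGradient u := by
    refine (isMinGradient u).2.2 _ (hm.sub (isMinGradient v).1) fun g hg hgp => ?_
    filter_upwards [h1 g hg hgp] with x hx
    exact tsub_le_iff_right.2 (tsub_le_iff_left.1 hx)
  filter_upwards [h2] with x hx using tsub_le_iff_right.1 hx

theorem minGradient_smul_le (c : ℝ) (u : dirichletClass ν p) :
    ∀ᵐ x ∂ν, minGradient (c • u) x ≤ ENNReal.ofReal |c| * minGradient u x := by
  obtain ⟨hm, hle, -⟩ := isMinGradient (c • u)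
  have h1 : ∀ g, IsWeakUpperGradient ν p u.1 g → ∫⁻ x, g x ^ p ∂ν < ∞ →
      ∀ᵐ x ∂ν, minGradient (c • u) x ≤ ENNReal.ofReal |c| * g x := fun g hg hgp =>
    hle _ (hg.smul c) (lintegral_const_mul_rpow_lt_top hp.out c hgp)
  rcases eq_or_ne c 0 with rfl | hc
  · obtain ⟨-, g₀, hg₀, hg₀p⟩ := u.2
    filter_upwards [h1 g₀ (hg₀.isWeak hp.out) hg₀p] with x hx
    simpa using hx
  · have hc0 : ENNReal.ofReal |c| ≠ 0 := by simpa using hc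
    have h2 : (fun x => (ENNReal.ofReal |c|)⁻¹ * minGradient (c • u) x) ≤ᵐ[ν] minGradient u := by
      refine (isMinGradient u).2.2 _ (hm.const_mul _) fun g hg hgp => ?_
      filter_upwards [h1 g hg hgp] with x hx
      exact (ENNReal.inv_mul_le_iff hc0 ENNReal.ofReal_ne_top).2 hx
    filter_upwards [h2] with x hx
    exact (ENNReal.inv_mul_le_iff hc0 ENNReal.ofReal_ne_top).1 hx

/-! ### The cotangent module `L^p(T^*X)` -/

/-- `s` takes the value `f_i` on `A_i`, for a sequence of functions `f_i ∈ D^{1,p}(X)` and a Borel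
partition `(A_i)` of `X`; the partition is given by its index map `a`, that is, `A_i = a⁻¹{i}`. -/
def IsPiecewise (s : X → dirichletClass ν p) : Prop :=
  ∃ (f : ℕ → dirichletClass ν p) (a : X → ℕ), Measurable a ∧ ∀ x, s x = f (a x)

theorem IsPiecewise.add {s t : X → dirichletClass ν p} (hs : IsPiecewise s) (ht : IsPiecewise t) :
    IsPiecewise (s + t) := by
  obtain ⟨f, a, ha, hfa⟩ := hs
  obtain ⟨g, b, hb, hgb⟩ := ht
  refine ⟨fun k => f k.unpair.1 + g k.unpair.2, fun x => Nat.pair (a x) (b x), ?_, fun x => ?_⟩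
  · exact (measurable_of_countable (fun q : ℕ × ℕ => Nat.pair q.1 q.2)).comp (ha.prodMk hb)
  · simp only [Pi.add_apply, hfa, hgb, Nat.unpair_pair]

theorem IsPiecewise.smul (c : ℝ) {s : X → dirichletClass ν p} (hs : IsPiecewise s) :
    IsPiecewise (c • s) := by
  obtain ⟨f, a, ha, hfa⟩ := hs
  exact ⟨fun k => c • f k, a, ha, fun x => by rw [Pi.smul_apply, hfa]⟩

theorem IsPiecewise.measurable {s : X → dirichletClass ν p} (hs : IsPiecewise s) :
    Measurable fun x => minGradient (s x) x := by
  obtain ⟨f, a, ha, hfa⟩ := hs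
  have h : Measurable fun q : ℕ × X => minGradient (f q.1) q.2 :=
    measurable_from_prod_countable_right fun i => (isMinGradient (f i)).1
  have h' := h.comp (ha.prodMk measurable_id)
  have e : (fun x => minGradient (s x) x) =
      (fun q : ℕ × X => minGradient (f q.1) q.2) ∘ fun x => (a x, id x) := by
    funext x
    rw [hfa]
    rfl
  rw [e]
  exact h'

theorem IsPiecewise.add_le {s t : X → dirichletClass ν p} (hs : IsPiecewise s)
    (ht : IsPiecewise t) :
    ∀ᵐ x ∂ν, minGradient ((s + t) x) x ≤ minGradient (s x) x + minGradient (t x) x := by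
  obtain ⟨f, a, ha, hfa⟩ := hs
  obtain ⟨g, b, hb, hgb⟩ := ht
  have : ∀ᵐ x ∂ν, ∀ i j, minGradient (f i + g j) x ≤ minGradient (f i) x + minGradient (g j) x :=
    ae_all_iff.2 fun i => ae_all_iff.2 fun j => minGradient_add_le _ _
  filter_upwards [this] with x hx
  rw [Pi.add_apply, hfa, hgb]
  exact hx (a x) (b x)

theorem IsPiecewise.smul_le (c : ℝ) {s : X → dirichletClass ν p} (hs : IsPiecewise s) :
    ∀ᵐ x ∂ν, minGradient ((c • s) x) x ≤ ENNReal.ofReal |c| * minGradient (s x) x := by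
  obtain ⟨f, a, ha, hfa⟩ := hs
  have : ∀ᵐ x ∂ν, ∀ i, minGradient (c • f i) x ≤ ENNReal.ofReal |c| * minGradient (f i) x :=
    ae_all_iff.2 fun i => minGradient_smul_le _ _
  filter_upwards [this] with x hx
  rw [Pi.smul_apply, hfa]
  exact hx (a x)

/-- The pre-cotangent module `PCM_p`.  A sequence `{(f_i, A_i)}` is recorded as the map which takes
the value `f_i` on `A_i`; the sum `{(f_i + g_j, A_i ∩ B_j)}` is then the pointwise one, and
`∑ ∫_{A_i} |D f_i|^p dν` is the single integral below. -/
def preCotangentSubmodule (ν : Measure X) (p : ℝ) [hp : Fact (1 < p)] :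
    Submodule ℝ (X → dirichletClass ν p) where
  carrier := {s | IsPiecewise s ∧ ∫⁻ x, minGradient (s x) x ^ p ∂ν < ∞}
  add_mem' := by
    rintro s t ⟨hs, hsp⟩ ⟨ht, htp⟩
    refine ⟨hs.add ht, (lintegral_mono_ae ?_).trans_lt
      (ENNReal.lintegral_rpow_add_lt_top_of_lintegral_rpow_lt_top hs.measurable.aemeasurable
        hsp htp hp.out.le)⟩
    filter_upwards [hs.add_le ht] with x hx
    exact ENNReal.rpow_le_rpow hx (zero_le_one.trans hp.out.le)
  zero_mem' := ⟨⟨fun _ => 0, fun _ => 0, measurable_const, fun _ => rfl⟩,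
    minGradient_lintegral_lt_top 0⟩
  smul_mem' := by
    rintro c s ⟨hs, hsp⟩
    refine ⟨hs.smul c, (lintegral_mono_ae ?_).trans_lt
      (lintegral_const_mul_rpow_lt_top hp.out c hsp)⟩
    filter_upwards [hs.smul_le c] with x hx
    exact ENNReal.rpow_le_rpow hx (zero_le_one.trans hp.out.le)

/-- The type of elements of the pre-cotangent module, before identification. -/
def PreCotangent (ν : Measure X) (p : ℝ) [Fact (1 < p)] : Type _ := preCotangentSubmodule ν p

instance : AddCommGroup (PreCotangent ν p) :=
  inferInstanceAs (AddCommGroup (preCotangentSubmodule ν p))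

instance : Module ℝ (PreCotangent ν p) :=
  inferInstanceAs (Module ℝ (preCotangentSubmodule ν p))

/-- The element of the pre-cotangent module given by a map `s`. -/
def PreCotangent.mk (s : X → dirichletClass ν p) (hs : s ∈ preCotangentSubmodule ν p) :
    PreCotangent ν p :=
  Subtype.mk (p := fun s => s ∈ preCotangentSubmodule ν p) s hs

/-- The map which takes the value `f_i` on `A_i`. -/
def PreCotangent.fn (s : PreCotangent ν p) : X → dirichletClass ν p :=
  Subtype.val (p := fun s => s ∈ preCotangentSubmodule ν p) s

theorem PreCotangent.fn_mem (s : PreCotangent ν p) : s.fn ∈ preCotangentSubmodule ν p :=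
  Subtype.property (p := fun s => s ∈ preCotangentSubmodule ν p) s

theorem PreCotangent.fn_mk (s : X → dirichletClass ν p) (hs : s ∈ preCotangentSubmodule ν p) :
    (PreCotangent.mk s hs).fn = s := rfl

theorem PreCotangent.fn_ext {s t : PreCotangent ν p} (h : s.fn = t.fn) : s = t :=
  Subtype.ext (p := fun s => s ∈ preCotangentSubmodule ν p) h

theorem PreCotangent.fn_add (s t : PreCotangent ν p) : (s + t).fn = s.fn + t.fn := rfl

theorem PreCotangent.fn_sub (s t : PreCotangent ν p) : (s - t).fn = s.fn - t.fn := rfl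

theorem PreCotangent.fn_smul (c : ℝ) (s : PreCotangent ν p) : (c • s).fn = c • s.fn := rfl

/-- The pointwise norm `|{(f_i, A_i)}|_* = |D f_i|` on `A_i`. -/
def PreCotangent.grad (s : PreCotangent ν p) (x : X) : ℝ≥0∞ := minGradient (s.fn x) x

theorem PreCotangent.measurable_grad (s : PreCotangent ν p) : Measurable s.grad :=
  s.fn_mem.1.measurable

theorem PreCotangent.lintegral_grad_lt_top (s : PreCotangent ν p) :
    ∫⁻ x, s.grad x ^ p ∂ν < ∞ := s.fn_mem.2

theorem PreCotangent.grad_add_le (s t : PreCotangent ν p) :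
    ∀ᵐ x ∂ν, (s + t).grad x ≤ s.grad x + t.grad x :=
  IsPiecewise.add_le s.fn_mem.1 t.fn_mem.1

theorem PreCotangent.grad_smul_le (c : ℝ) (s : PreCotangent ν p) :
    ∀ᵐ x ∂ν, (c • s).grad x ≤ ENNReal.ofReal |c| * s.grad x :=
  IsPiecewise.smul_le c s.fn_mem.1

/-- The norm `‖{(f_i, A_i)}‖ = (∑ ∫_{A_i} |D f_i|^p dν)^{1/p}`, with values in `[0, ∞]`. -/
def PreCotangent.enorm (s : PreCotangent ν p) : ℝ≥0∞ := (∫⁻ x, s.grad x ^ p ∂ν) ^ (1 / p)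

theorem PreCotangent.enorm_ne_top (s : PreCotangent ν p) : s.enorm ≠ ∞ :=
  ENNReal.rpow_ne_top_of_nonneg (one_div_nonneg.2 (zero_le_one.trans hp.out.le))
    s.lintegral_grad_lt_top.ne

theorem PreCotangent.enorm_add_le (s t : PreCotangent ν p) :
    (s + t).enorm ≤ s.enorm + t.enorm := by
  have hp0 : 0 ≤ p := zero_le_one.trans hp.out.le
  refine le_trans ?_ (ENNReal.lintegral_Lp_add_le s.measurable_grad.aemeasurable
    t.measurable_grad.aemeasurable hp.out.le)
  refine ENNReal.rpow_le_rpow (lintegral_mono_ae ?_) (one_div_nonneg.2 hp0)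
  filter_upwards [s.grad_add_le t] with x hx
  exact ENNReal.rpow_le_rpow hx hp0

/-- Comparison of norms from an almost everywhere comparison of pointwise norms. -/
theorem PreCotangent.enorm_le_of_grad_le {s t : PreCotangent ν p} {K : ℝ}
    (h : ∀ᵐ x ∂ν, t.grad x ≤ ENNReal.ofReal K * s.grad x) :
    t.enorm ≤ ENNReal.ofReal K * s.enorm := by
  have hp0 : 0 < p := zero_lt_one.trans hp.out
  have hK : ENNReal.ofReal K ^ p ≠ ∞ := ENNReal.rpow_ne_top_of_nonneg hp0.le ENNReal.ofReal_ne_top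
  have h1 : ∫⁻ x, t.grad x ^ p ∂ν ≤ ENNReal.ofReal K ^ p * ∫⁻ x, s.grad x ^ p ∂ν := by
    rw [← lintegral_const_mul' _ _ hK]
    refine lintegral_mono_ae ?_
    filter_upwards [h] with x hx
    rw [← ENNReal.mul_rpow_of_nonneg _ _ hp0.le]
    exact ENNReal.rpow_le_rpow hx hp0.le
  calc t.enorm ≤ (ENNReal.ofReal K ^ p * ∫⁻ x, s.grad x ^ p ∂ν) ^ (1 / p) :=
        ENNReal.rpow_le_rpow h1 (one_div_nonneg.2 hp0.le)
    _ = ENNReal.ofReal K * s.enorm := by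
        rw [ENNReal.mul_rpow_of_nonneg _ _ (one_div_nonneg.2 hp0.le), ← ENNReal.rpow_mul,
          mul_one_div_cancel hp0.ne', ENNReal.rpow_one]
        rfl

theorem PreCotangent.toReal_enorm_le_of_grad_le {s t : PreCotangent ν p} {K : ℝ} (hK : 0 ≤ K)
    (h : ∀ᵐ x ∂ν, t.grad x ≤ ENNReal.ofReal K * s.grad x) :
    t.enorm.toReal ≤ K * s.enorm.toReal := by
  rw [← ENNReal.toReal_ofReal hK, ← ENNReal.toReal_mul]
  exact ENNReal.toReal_mono (ENNReal.mul_ne_top ENNReal.ofReal_ne_top s.enorm_ne_top)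
    (PreCotangent.enorm_le_of_grad_le h)

/-- The pre-cotangent module with its seminorm.  Two elements are identified by `∼` exactly when
their difference has seminorm zero. -/
instance : SeminormedAddCommGroup (PreCotangent ν p) :=
  AddGroupSeminorm.toSeminormedAddCommGroup
    { toFun := fun s => s.enorm.toReal
      map_zero' := by
        have h := PreCotangent.toReal_enorm_le_of_grad_le (K := 0) le_rfl
          (s := (0 : PreCotangent ν p)) (t := (0 : ℝ) • (0 : PreCotangent ν p)) (by
            simpa using PreCotangent.grad_smul_le 0 (0 : PreCotangent ν p))
        rw [zero_smul, zero_mul] at h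
        exact le_antisymm h ENNReal.toReal_nonneg
      add_le' := fun s t => by
        rw [← ENNReal.toReal_add s.enorm_ne_top t.enorm_ne_top]
        exact ENNReal.toReal_mono (ENNReal.add_ne_top.2 ⟨s.enorm_ne_top, t.enorm_ne_top⟩)
          (s.enorm_add_le t)
      neg' := fun s => by
        have key : ∀ t : PreCotangent ν p, (-t).enorm.toReal ≤ t.enorm.toReal := fun t => by
          have h := PreCotangent.toReal_enorm_le_of_grad_le (K := |(-1 : ℝ)|) (abs_nonneg _)
            (PreCotangent.grad_smul_le (-1) t)
          simpa using h
        refine le_antisymm (key s) ?_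
        simpa using key (-s) }

theorem PreCotangent.norm_def (s : PreCotangent ν p) : ‖s‖ = s.enorm.toReal := rfl

instance : NormedSpace ℝ (PreCotangent ν p) where
  norm_smul_le c s := PreCotangent.toReal_enorm_le_of_grad_le (abs_nonneg c)
    (PreCotangent.grad_smul_le c s)

/-- The cotangent module `L^p(T^*X)`: the completion of `PCM_p / ∼`.  The completion of a
seminormed space includes the passage to the quotient by the elements of seminorm zero. -/
abbrev Cotangent (ν : Measure X) (p : ℝ) [Fact (1 < p)] : Type _ :=
  UniformSpace.Completion (PreCotangent ν p)

/-- The differential `df = (f, X)` of `f ∈ D^{1,p}(X)`. -/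
def differential (f : dirichletClass ν p) : Cotangent ν p :=
  ((PreCotangent.mk (fun _ => f) ⟨⟨fun _ => f, fun _ => 0, measurable_const, fun _ => rfl⟩,
    minGradient_lintegral_lt_top f⟩ : PreCotangent ν p) : Cotangent ν p)

/-! ### The pointwise norm and the `L^∞`-module structure of the cotangent module -/

instance : Fact (1 ≤ ENNReal.ofReal p) := ⟨by simpa using hp.out.le⟩

theorem PreCotangent.ae_grad_lt_top (s : PreCotangent ν p) : ∀ᵐ x ∂ν, s.grad x < ∞ := by
  have hp0 : 0 < p := zero_lt_one.trans hp.out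
  filter_upwards [ae_lt_top (s.measurable_grad.pow_const p) s.lintegral_grad_lt_top.ne] with x hx
  exact (ENNReal.rpow_lt_top_iff_of_pos hp0).1 hx

theorem PreCotangent.eLpNorm_grad (s : PreCotangent ν p) :
    eLpNorm (fun x => (s.grad x).toReal) (ENNReal.ofReal p) ν = s.enorm := by
  have hp0 : 0 < p := zero_lt_one.trans hp.out
  rw [eLpNorm_eq_lintegral_rpow_enorm_toReal (by simpa using hp0) ENNReal.ofReal_ne_top,
    ENNReal.toReal_ofReal hp0.le, PreCotangent.enorm]
  congr 1
  refine lintegral_congr_ae ?_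
  filter_upwards [s.ae_grad_lt_top] with x hx
  rw [Real.enorm_of_nonneg ENNReal.toReal_nonneg, ENNReal.ofReal_toReal hx.ne]

theorem PreCotangent.memLp_grad (s : PreCotangent ν p) :
    MemLp (fun x => (s.grad x).toReal) (ENNReal.ofReal p) ν :=
  ⟨s.measurable_grad.ennreal_toReal.aestronglyMeasurable, by
    rw [s.eLpNorm_grad]; exact s.enorm_ne_top.lt_top⟩

/-- The pointwise norm of an element of the pre-cotangent module, as an element of `L^p`. -/
def PreCotangent.pnorm (s : PreCotangent ν p) : Lp ℝ (ENNReal.ofReal p) ν :=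
  s.memLp_grad.toLp _

theorem PreCotangent.lipschitzWith_pnorm :
    LipschitzWith 1 (PreCotangent.pnorm (ν := ν) (p := p)) := by
  refine LipschitzWith.of_dist_le_mul fun s t => ?_
  rw [dist_eq_norm, dist_eq_norm, NNReal.coe_one, one_mul, PreCotangent.norm_def,
    ← (s - t).eLpNorm_grad, PreCotangent.pnorm, PreCotangent.pnorm, ← MemLp.toLp_sub,
    Lp.norm_toLp]
  refine ENNReal.toReal_mono (s - t).memLp_grad.2.ne (eLpNorm_mono_ae ?_)
  have h1 := (s - t).grad_add_le t
  have h2 := (t - s).grad_add_le s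
  have h3 := (s - t).grad_smul_le (-1)
  rw [sub_add_cancel] at h1 h2
  rw [neg_one_smul, neg_sub] at h3
  filter_upwards [h1, h2, h3, s.ae_grad_lt_top, t.ae_grad_lt_top, (s - t).ae_grad_lt_top,
    (t - s).ae_grad_lt_top] with x h1 h2 h3 hs ht hst hts
  rw [abs_neg, abs_one, ENNReal.ofReal_one, one_mul] at h3
  have e1 := ENNReal.toReal_mono (ENNReal.add_ne_top.2 ⟨hst.ne, ht.ne⟩) h1
  have e2 := ENNReal.toReal_mono (ENNReal.add_ne_top.2 ⟨hts.ne, hs.ne⟩) h2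
  have e3 := ENNReal.toReal_mono hst.ne h3
  rw [ENNReal.toReal_add hst.ne ht.ne] at e1
  rw [ENNReal.toReal_add hts.ne hs.ne] at e2
  rw [Pi.sub_apply, Real.norm_eq_abs, Real.norm_of_nonneg ENNReal.toReal_nonneg, abs_le]
  constructor <;> linarith

/-- The pointwise norm `|·|_* : L^p(T^*X) → L^p(X, ν)`, extended by continuity. -/
def pointwiseNorm (v : Cotangent ν p) : Lp ℝ (ENNReal.ofReal p) ν :=
  UniformSpace.Completion.extension PreCotangent.pnorm v

theorem pointwiseNorm_coe (s : PreCotangent ν p) :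
    pointwiseNorm (s : Cotangent ν p) = s.pnorm :=
  UniformSpace.Completion.extension_coe PreCotangent.lipschitzWith_pnorm.uniformContinuous s

/-- Multiplication of an element of the pre-cotangent module by a Borel function with countably
many values. -/
theorem PreCotangent.mul_mem {c : X → ℝ} (hc : Measurable c) (hr : (range c).Countable) {K : ℝ}
    (hK : ∀ᵐ x ∂ν, |c x| ≤ K) (s : PreCotangent ν p) :
    (fun x => c x • s.fn x) ∈ preCotangentSubmodule ν p ∧
    ∀ᵐ x ∂ν, minGradient (c x • s.fn x) x ≤ ENNReal.ofReal |c x| * s.grad x := by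
  obtain ⟨f, a, ha, hfa⟩ := s.fn_mem.1
  have hle : ∀ᵐ x ∂ν, minGradient (c x • s.fn x) x ≤ ENNReal.ofReal |c x| * s.grad x := by
    have : Countable (range c) := hr.to_subtype
    have h : ∀ᵐ x ∂ν, ∀ (r : range c) (i : ℕ), minGradient (r.1 • f i) x ≤
        ENNReal.ofReal |r.1| * minGradient (f i) x :=
      ae_all_iff.2 fun r => ae_all_iff.2 fun i => minGradient_smul_le _ _
    filter_upwards [h] with x hx
    rw [PreCotangent.grad, hfa]
    exact hx ⟨c x, mem_range_self x⟩ (a x)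
  refine ⟨⟨?_, ?_⟩, hle⟩
  · rcases isEmpty_or_nonempty X with hX | hX
    · exact ⟨fun _ => 0, fun _ => 0, measurable_const, fun x => hX.elim x⟩
    obtain ⟨r, hr'⟩ := hr.exists_eq_range (range_nonempty c)
    have hex : ∀ x, ∃ n, c x = r n := fun x => by
      have : c x ∈ range r := hr' ▸ mem_range_self x
      exact this.imp fun n hn => hn.symm
    classical
    refine ⟨fun k => r k.unpair.1 • f k.unpair.2,
      fun x => Nat.pair (Nat.find (hex x)) (a x), ?_, fun x => ?_⟩
    · have h1 : Measurable fun x => Nat.find (hex x) :=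
        measurable_find hex fun n => hc (measurableSet_singleton (r n))
      exact (measurable_of_countable (fun q : ℕ × ℕ => Nat.pair q.1 q.2)).comp (h1.prodMk ha)
    · simp only [Nat.unpair_pair]
      rw [← Nat.find_spec (hex x), hfa]
  · refine (lintegral_mono_ae ?_).trans_lt
      (lintegral_const_mul_rpow_lt_top hp.out K s.lintegral_grad_lt_top)
    filter_upwards [hle, hK] with x hx hKx
    refine ENNReal.rpow_le_rpow (hx.trans ?_) (zero_le_one.trans hp.out.le)
    refine mul_le_mul_left (ENNReal.ofReal_le_ofReal ?_) _
    exact hKx.trans (le_abs_self K)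

/-- Multiplication by an essentially bounded Borel function with countably many values, as a
continuous linear map on the pre-cotangent module. -/
def PreCotangent.mulL {c : X → ℝ} (hc : Measurable c) (hr : (range c).Countable) {K : ℝ}
    (hK : ∀ᵐ x ∂ν, |c x| ≤ K) : PreCotangent ν p →L[ℝ] PreCotangent ν p :=
  LinearMap.mkContinuous
    { toFun := fun s => PreCotangent.mk (fun x => c x • s.fn x) (PreCotangent.mul_mem hc hr hK s).1
      map_add' := fun s t => PreCotangent.fn_ext (funext fun x => smul_add (c x) (s.fn x) (t.fn x))
      map_smul' := fun k s => PreCotangent.fn_ext (funext fun x => smul_comm (c x) k (s.fn x)) }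
    |K| fun s => PreCotangent.toReal_enorm_le_of_grad_le (abs_nonneg K) (by
      filter_upwards [(PreCotangent.mul_mem hc hr hK s).2, hK] with x hx hKx
      refine hx.trans ?_
      refine mul_le_mul_left (ENNReal.ofReal_le_ofReal ?_) _
      exact hKx.trans (le_abs_self K))

/-- The approximation `⌊(n+1) f⌋ / (n+1)` of `f ∈ L^∞` by functions with countably many values. -/
def floorApprox (f : Lp ℝ ∞ ν) (n : ℕ) (x : X) : ℝ := (⌊((n : ℝ) + 1) * f x⌋ : ℝ) / ((n : ℝ) + 1)

theorem measurable_floorApprox (f : Lp ℝ ∞ ν) (n : ℕ) : Measurable (floorApprox f n) :=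
  ((measurable_from_top (f := fun k : ℤ => (k : ℝ))).comp
    (Int.measurable_floor.comp ((Lp.stronglyMeasurable f).measurable.const_mul _))).div_const _

theorem countable_range_floorApprox (f : Lp ℝ ∞ ν) (n : ℕ) : (range (floorApprox f n)).Countable :=
  (countable_range fun k : ℤ => (k : ℝ) / ((n : ℝ) + 1)).mono (by
    rintro _ ⟨x, rfl⟩
    exact ⟨_, rfl⟩)

theorem abs_floorApprox_sub_le (f : Lp ℝ ∞ ν) (n : ℕ) (x : X) :
    |floorApprox f n x - f x| ≤ 1 / ((n : ℝ) + 1) := by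
  have hn : (0 : ℝ) < (n : ℝ) + 1 := by positivity
  have h1 := Int.floor_le (((n : ℝ) + 1) * f x)
  have h2 := (Int.lt_floor_add_one (((n : ℝ) + 1) * f x)).le
  have h3 : floorApprox f n x - f x =
      ((⌊((n : ℝ) + 1) * f x⌋ : ℝ) - ((n : ℝ) + 1) * f x) / ((n : ℝ) + 1) := by
    unfold floorApprox
    field_simp
  rw [h3, abs_div, abs_of_pos hn]
  gcongr
  rw [abs_le]
  constructor <;> linarith

theorem ae_abs_floorApprox_le (f : Lp ℝ ∞ ν) (n : ℕ) :
    ∀ᵐ x ∂ν, |floorApprox f n x| ≤ ‖f‖ + 1 := by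
  have h : ∀ᵐ x ∂ν, ‖f x‖ ≤ ‖f‖ := by
    filter_upwards [ae_le_eLpNormEssSup (f := f) (μ := ν)] with x hx
    rw [← eLpNorm_exponent_top] at hx
    have := ENNReal.toReal_mono (Lp.eLpNorm_ne_top f) hx
    simpa [Lp.norm_def] using this
  filter_upwards [h] with x hx
  have h1 := abs_floorApprox_sub_le f n x
  have h2 : 1 / ((n : ℝ) + 1) ≤ 1 := by
    rw [div_le_one (by positivity)]
    linarith [n.cast_nonneg (α := ℝ)]
  have h3 := abs_sub_abs_le_abs_sub (floorApprox f n x) (f x)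
  rw [Real.norm_eq_abs] at hx
  linarith

/-- Multiplication by `⌊(n+1) f⌋ / (n+1)` on the cotangent module. -/
def floorMulL (f : Lp ℝ ∞ ν) (n : ℕ) : Cotangent ν p →L[ℝ] Cotangent ν p :=
  (PreCotangent.mulL (measurable_floorApprox f n) (countable_range_floorApprox f n)
    (ae_abs_floorApprox_le f n)).completion

/-- The multiplication `f · v` of `v ∈ L^p(T^*X)` by `f ∈ L^∞(X, ν)`: the limit, in operator norm,
of the multiplications by functions with countably many values which converge uniformly to `f`. -/
def linftyMul (f : Lp ℝ ∞ ν) : Cotangent ν p →L[ℝ] Cotangent ν p :=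
  limUnder atTop (floorMulL (p := p) f)

theorem tendsto_floorMulL (f : Lp ℝ ∞ ν) :
    Tendsto (floorMulL (p := p) f) atTop (𝓝 (linftyMul f)) := by
  have hb : ∀ m n : ℕ, ‖floorMulL (p := p) f m - floorMulL f n‖ ≤
      1 / ((m : ℝ) + 1) + 1 / ((n : ℝ) + 1) := by
    intro m n
    have h0 : (0 : ℝ) ≤ 1 / ((m : ℝ) + 1) + 1 / ((n : ℝ) + 1) := by positivity
    refine ContinuousLinearMap.opNorm_le_bound _ h0 fun v => ?_
    induction v using UniformSpace.Completion.induction_on with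
    | hp => exact isClosed_le (by fun_prop) (by fun_prop)
    | ih s =>
      simp only [floorMulL, sub_apply, ContinuousLinearMap.completion_apply_coe]
      rw [← UniformSpace.Completion.coe_sub, UniformSpace.Completion.norm_coe,
        UniformSpace.Completion.norm_coe]
      refine PreCotangent.toReal_enorm_le_of_grad_le h0 ?_
      have hle : ∀ x, |floorApprox f m x - floorApprox f n x| ≤
          1 / ((m : ℝ) + 1) + 1 / ((n : ℝ) + 1) := fun x => by
        have h1 := abs_floorApprox_sub_le f m x
        have h2 := abs_floorApprox_sub_le f n x
        have h3 := abs_sub_le (floorApprox f m x) (f x) (floorApprox f n x)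
        rw [abs_sub_comm (f x)] at h3
        linarith
      have hr : (range fun x => floorApprox f m x - floorApprox f n x).Countable :=
        (((countable_range_floorApprox f m).prod (countable_range_floorApprox f n)).image
          fun q : ℝ × ℝ => q.1 - q.2).mono (by
            rintro _ ⟨x, rfl⟩
            exact ⟨(floorApprox f m x, floorApprox f n x),
              ⟨mem_range_self x, mem_range_self x⟩, rfl⟩)
      filter_upwards [(PreCotangent.mul_mem ((measurable_floorApprox f m).sub
        (measurable_floorApprox f n)) hr (Eventually.of_forall hle) s).2] with x hx
      have hx' : minGradient (floorApprox f m x • s.fn x - floorApprox f n x • s.fn x) x ≤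
          ENNReal.ofReal |floorApprox f m x - floorApprox f n x| * s.grad x := by
        have e := sub_smul (floorApprox f m x) (floorApprox f n x) (s.fn x)
        exact e ▸ hx
      refine hx'.trans ?_
      gcongr
      exact hle x
  refine CauchySeq.tendsto_limUnder (cauchySeq_of_le_tendsto_0
    (fun N : ℕ => 2 * (1 / ((N : ℝ) + 1))) (fun m n N hm hn => ?_) ?_)
  · rw [dist_eq_norm]
    refine (hb m n).trans ?_
    rw [two_mul]
    gcongr
  · simpa using (tendsto_one_div_add_atTop_nhds_zero_nat (𝕜 := ℝ)).const_mul 2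

/-! ### Vector fields and divergence -/

/-- The tangent module `L^{p'}(TX) = HOM(L^p(T^*X), L^1(X, ν))`: bounded linear maps which commute
with the multiplication by functions in `L^∞(X, ν)`. -/
def VectorField (ν : Measure X) (p : ℝ) [Fact (1 < p)] : Type _ :=
  {Y : Cotangent ν p →L[ℝ] Lp ℝ 1 ν //
    ∀ (f : Lp ℝ ∞ ν) (v : Cotangent ν p), Y (linftyMul f v) = f • Y v}

/-- The integral `∫_X ω(Y) dν` of the duality pairing `ω(Y) ∈ L^1(X, ν)`. -/
def VectorField.pairing (Y : VectorField ν p) (ω : Cotangent ν p) : ℝ := ∫ x, Y.1 ω x ∂ν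

/-- `Y ∈ 𝒟^{p',2}(X)` and `div Y = f`, with `f ∈ L^2(X, ν)`. -/
def VectorField.HasDivergence (Y : VectorField ν p) (f : Lp ℝ 2 ν) : Prop :=
  ∀ g : dirichletClass ν p, MemLp g.1 (ENNReal.ofReal p) ν → MemLp g.1 2 ν →
    ∫ x, f x * g.1 x ∂ν = - Y.pairing (differential g)

/-- `∂E(ω)` in the duality between `L^p(T^*X)` and `L^{p'}(TX)`. -/
def subdifferentialE (E : Cotangent ν p → ℝ) (ω : Cotangent ν p) : Set (VectorField ν p) :=
  {Y | ∀ η : Cotangent ν p, Y.pairing η ≤ E (ω + η) - E ω}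

/-! ### The functional on `L^2(X, ν)` -/

/-- The class `u ∈ L^2(X, ν)` belongs to `W^{1,p}(X, d, ν) = D^{1,p}(X) ∩ L^p(X, ν)`: it has a
representative there. -/
def MemW1 (p : ℝ) [Fact (1 < p)] (u : Lp ℝ 2 ν) : Prop :=
  ∃ f : dirichletClass ν p, MemLp f.1 (ENNReal.ofReal p) ν ∧ f.1 =ᵐ[ν] u

/-- The differential `du` of a class `u ∈ L^2(X, ν) ∩ W^{1,p}(X, d, ν)`, through a representative
in `D^{1,p}(X)`. -/
def MemW1.d {u : Lp ℝ 2 ν} (h : MemW1 p u) : Cotangent ν p := differential h.choose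

open Classical in
/-- The functional `ℱ(u) = E(du)` for `u ∈ W^{1,p}(X, d, ν)`, and `ℱ(u) = +∞` otherwise. -/
def energy (E : Cotangent ν p → ℝ) (u : Lp ℝ 2 ν) : EReal :=
  if h : MemW1 p u then (E h.d : EReal) else ⊤

end Sobolev

/-! ### Gradient flows -/

/-- The subdifferential of a functional on a Hilbert space. -/
def subdifferential {H : Type*} [NormedAddCommGroup H] [InnerProductSpace ℝ H] (F : H → EReal)
    (u : H) : Set H :=
  {v | ∀ w : H, F u + ((inner ℝ w v : ℝ) : EReal) ≤ F (u + w)}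

/-- `u ∈ W^{1,2}(a, b; H)`. -/
def MemW12 {H : Type*} [NormedAddCommGroup H] [NormedSpace ℝ H] (u : ℝ → H) (a b : ℝ) : Prop :=
  MemLp u 2 (volume.restrict (Icc a b)) ∧
  ∃ v : ℝ → H, MemLp v 2 (volume.restrict (Icc a b)) ∧
    ∀ t ∈ Ioo a b, u t - u a = ∫ s in a..t, v s

/-- `u ∈ C([0, T]; H) ∩ W^{1,2}_loc(0, T; H)`. -/
def FlowRegular {H : Type*} [NormedAddCommGroup H] [NormedSpace ℝ H] (T : ℝ) (u : ℝ → H) : Prop :=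
  ContinuousOn u (Icc 0 T) ∧ ∀ a b : ℝ, 0 < a → a < b → b < T → MemW12 u a b

variable {X : Type*} [MetricSpace X] [MeasurableSpace X] {ν : Measure X} {p : ℝ} [Fact (1 < p)]

/-- `u` is a weak solution on `[0, T]` of `-u_t ∈ ∂ℱ(u)`, `u(0) = u₀`, where `ℱ = energy E`. -/
def IsWeakSolution (E : Cotangent ν p → ℝ) (u₀ : Lp ℝ 2 ν) (T : ℝ) (u : ℝ → Lp ℝ 2 ν) : Prop :=
  FlowRegular T u ∧ u 0 = u₀ ∧
  ∀ᵐ t ∂(volume.restrict (Ioo 0 T)), ∃ u' : Lp ℝ 2 ν, HasDerivAt u u' t ∧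
    -u' ∈ subdifferential (energy E) (u t)

/-- `u` is a solution on `[0, T]` of `u_t = div Y(t)` with `Y(t) ∈ ∂E(du(t))`, `u(0) = u₀`. -/
def IsDivergenceSolution (E : Cotangent ν p → ℝ) (u₀ : Lp ℝ 2 ν) (T : ℝ) (u : ℝ → Lp ℝ 2 ν) :
    Prop :=
  FlowRegular T u ∧ u 0 = u₀ ∧
  ∀ᵐ t ∂(volume.restrict (Ioo 0 T)), ∃ u' : Lp ℝ 2 ν, HasDerivAt u u' t ∧
    ∃ h : MemW1 p (u t), ∃ Y : VectorField ν p, Y.HasDivergence u' ∧ Y ∈ subdifferentialE E h.d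

end MetricFlow

end

/-! The equation is the gradient flow of a convex, lower semicontinuous functional on the Hilbert
space `L²`. Well-posedness is therefore Brezis–Komura theory, and the second claim amounts to
computing `∂ℱ`.

Existence: the Yosida approximation `A` of `∂f` with parameter `l` is Lipschitz, so `u' = -A u` has
global solutions (`exists_solvesODE`). These flows are contractions, and from a point `x` of the
domain the flows with parameters `l`, `l'` satisfy `‖u - v‖² ≤ (l + l') * 2 f(x)`
(`IsYosida.norm_sub_sq_le_add`); they converge uniformly as `l → 0` from every point in the closure
of the domain. The limit is taken in the evolution variational inequality, which contains no
derivative and is stable under lower semicontinuity (`LscConvex.exists_evi`). Differentiating it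
recovers `-u' ∈ ∂f(u)` (`EVI.le_of_hasDerivAt`). Every initial value in `L²` is allowed because
Lipschitz cut-offs make the domain dense (`dense_sobolevSubmodule`). Uniqueness is the monotonicity
of `∂ℱ`, integrated in time (`FlowRegular.eqOn`).

Characterisation: if `-u' ∈ ∂ℱ(u)`, the functional `w ↦ -⟨u', w⟩` on Sobolev classes is bounded by
`E(du + dw) - E(du)`. Separating its graph from a strict epigraph extends it to a bounded functional
`L` on the cotangent module which is a subgradient of `E` at `du`
(`exists_clm_extension_of_le_sub`). For each `v`, `A ↦ L(1_A v)` is a signed measure absolutely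
continuous with respect to `ν`; its density is the pairing of `v` with a vector field `Y`
(`exists_vectorField_pairing_eq`). On differentials this says `div Y = u'`. The converse inserts `dz
- du` into the subgradient inequality for `Y`. All this requires `du` to depend only on the class of
`u`, which is a modulus argument (`differential_congr`). -/

namespace MetricFlow

/-! ### Autonomous ODEs with a Lipschitz right-hand side -/

section ODE

variable {H : Type*} [NormedAddCommGroup H] [NormedSpace ℝ H]

/-- `u` solves `u' = g(u)` on `[0, T]`. -/
def SolvesODE (g : H → H) (T : ℝ) (u : ℝ → H) : Prop :=
  ∀ t ∈ Icc 0 T, HasDerivWithinAt u (g (u t)) (Icc 0 T) t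

theorem SolvesODE.continuousOn {g : H → H} {T : ℝ} {u : ℝ → H} (h : SolvesODE g T u) :
    ContinuousOn u (Icc 0 T) := fun t ht => (h t ht).continuousWithinAt

theorem SolvesODE.hasDerivAt {g : H → H} {T : ℝ} {u : ℝ → H} (h : SolvesODE g T u) {t : ℝ}
    (ht : t ∈ Ioo 0 T) : HasDerivAt u (g (u t)) t :=
  (h t (Ioo_subset_Icc_self ht)).hasDerivAt (Icc_mem_nhds ht.1 ht.2)

theorem SolvesODE.mono {g : H → H} {S T : ℝ} {u : ℝ → H} (h : SolvesODE g T u) (hST : S ≤ T) :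
    SolvesODE g S u := fun t ht =>
  (h t ⟨ht.1, ht.2.trans hST⟩).mono (Icc_subset_Icc_right hST)

/-- Concatenation of two solutions of an autonomous ODE. -/
theorem SolvesODE.concat {g : H → H} {b c : ℝ} (hb : 0 ≤ b) (hc : 0 ≤ c) {u v : ℝ → H}
    (hu : SolvesODE g b u) (hv : SolvesODE g c v) (huv : v 0 = u b) :
    SolvesODE g (b + c) fun t => if t ≤ b then u t else v (t - b) := by
  set w : ℝ → H := fun t => if t ≤ b then u t else v (t - b) with hw
  have w1 : ∀ t ≤ b, w t = u t := fun t ht => if_pos ht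
  have w2 : ∀ t, b ≤ t → w t = v (t - b) := fun t ht => by
    rcases ht.eq_or_lt with rfl | h
    · rw [w1 _ le_rfl, sub_self, huv]
    · exact if_neg h.not_ge
  intro t ht
  have hunion : Icc 0 (b + c) = Icc 0 b ∪ Icc b (b + c) :=
    (Icc_union_Icc_eq_Icc hb (by linarith)).symm
  rw [hunion]
  refine HasDerivWithinAt.union ?_ ?_
  · rcases le_or_gt t b with h | h
    · rw [w1 t h]
      exact (hu t ⟨ht.1, h⟩).congr (fun s hs => w1 s hs.2) (w1 t h)
    -- Away from the closure of a piece, every vector is a derivative within that piece.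
    · exact HasFDerivWithinAt.of_notMem_closure
        (by rw [isClosed_Icc.closure_eq]; exact fun h' => h'.2.not_gt h)
  · rcases le_or_gt b t with h | h
    · rw [w2 t h]
      have h1 := hv (t - b) ⟨by linarith, by linarith [ht.2]⟩
      have h2 : HasDerivWithinAt (fun s => v (s - b)) (g (v (t - b))) (Icc b (b + c)) t := by
        have := HasDerivWithinAt.scomp (h := fun s : ℝ => s - b) (h' := 1) t
          (t' := Icc 0 c) (s := Icc b (b + c)) h1
          ((hasDerivWithinAt_id t _).sub_const b)
          (fun s hs => ⟨by linarith [hs.1], by linarith [hs.2]⟩)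
        simpa [Function.comp_def] using this
      exact h2.congr (fun s hs => w2 s hs.1) (w2 t h)
    · exact HasFDerivWithinAt.of_notMem_closure
        (by rw [isClosed_Icc.closure_eq]; exact fun h' => h'.1.not_gt h)

/-- Global existence for an autonomous ODE with Lipschitz right-hand side. -/
theorem exists_solvesODE [CompleteSpace H] {g : H → H} {K : ℝ≥0} (hg : LipschitzWith K g) (x : H)
    (T : ℝ) : ∃ u : ℝ → H, u 0 = x ∧ SolvesODE g T u := by
  -- On the ball of radius `‖g y‖` about `y` the speed is at most `(K + 1) * ‖g y‖`, so within time
  -- `τ` a solution moves by at most half the radius. Since `τ` does not depend on `y`, the local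
  -- solutions can be concatenated indefinitely.
  set τ : ℝ := 1 / (2 * ((K : ℝ) + 1)) with hτ
  have hK : (0 : ℝ) ≤ K := K.2
  have hτ0 : 0 < τ := by positivity
  have hstep : ∀ y : H, ∃ u : ℝ → H, u 0 = y ∧ SolvesODE g τ u := by
    intro y
    have key : IsPicardLindelof (fun _ => g) (tmin := 0) (tmax := τ) ⟨0, le_rfl, hτ0.le⟩ y
        ‖g y‖₊ 0 ((K + 1) * ‖g y‖₊) K := by
      refine IsPicardLindelof.of_time_independent (fun z hz => ?_) hg.lipschitzOnWith ?_
      · have h1 := hg.dist_le_mul z y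
        rw [Metric.mem_closedBall] at hz
        have h2 : ‖g z‖ ≤ ‖g y‖ + dist (g z) (g y) := by
          rw [dist_eq_norm]; simpa using norm_add_le (g y) (g z - g y)
        have h3 : (K : ℝ) * dist z y ≤ K * ‖g y‖ := mul_le_mul_of_nonneg_left hz hK
        push_cast
        linarith
      · push_cast
        simp only [sub_zero, sub_self]
        rw [max_eq_left hτ0.le]
        have : ((K : ℝ) + 1) * ‖g y‖ * τ = ‖g y‖ / 2 := by rw [hτ]; field_simp
        rw [this]
        linarith [norm_nonneg (g y)]
    obtain ⟨u, h0, hu⟩ := key.exists_eq_forall_mem_Icc_hasDerivWithinAt₀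
    exact ⟨u, h0, hu⟩
  have hall : ∀ n : ℕ, ∀ y : H, ∃ u : ℝ → H, u 0 = y ∧ SolvesODE g (n * τ) u := by
    intro n
    induction n with
    | zero =>
      intro y
      obtain ⟨u, h0, hu⟩ := hstep y
      exact ⟨u, h0, hu.mono (by simpa using hτ0.le)⟩
    | succ n ih =>
      intro y
      obtain ⟨u, h0, hu⟩ := ih y
      obtain ⟨v, hv0, hv⟩ := hstep (u (n * τ))
      refine ⟨_, ?_, by
        rw [Nat.cast_succ, add_mul, one_mul]
        exact hu.concat (by positivity) hτ0.le hv hv0⟩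
      simp only [if_pos (show (0 : ℝ) ≤ n * τ by positivity), h0]
  obtain ⟨n, hn⟩ := exists_nat_ge (T / τ)
  obtain ⟨u, h0, hu⟩ := hall n x
  exact ⟨u, h0, hu.mono ((div_le_iff₀ hτ0).1 hn)⟩

end ODE

/-! ### The proximal map, the Yosida approximation and the Moreau envelope -/

section Prox

variable {H : Type*} [NormedAddCommGroup H] [InnerProductSpace ℝ H]

local notation "⟪" x ", " y "⟫" => inner ℝ x y

/-- `f` is a nonnegative convex function with nonempty domain `D` and closed sublevel sets, that is,
`f` extended by `+∞` outside `D` is proper, convex and lower semicontinuous. -/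
structure LscConvex (D : Set H) (f : H → ℝ) : Prop where
  nonempty : D.Nonempty
  convexOn : ConvexOn ℝ D f
  nonneg : ∀ x ∈ D, 0 ≤ f x
  isClosed : ∀ c : ℝ, IsClosed {x | x ∈ D ∧ f x ≤ c}

/-- Each closed sublevel set at height `c + ε` contains a tail of the sequence. Bounds that vary
with `n` are allowed because the energies are controlled only through other convergent quantities.
-/
theorem LscConvex.mem_of_tendsto {D : Set H} {f : H → ℝ} (h : LscConvex D f) {u : ℕ → H}
    {x : H} (hu : Tendsto u atTop (𝓝 x)) (hD : ∀ n, u n ∈ D) {r : ℕ → ℝ} {c : ℝ}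
    (hr : Tendsto r atTop (𝓝 c)) (hle : ∀ n, f (u n) ≤ r n) : x ∈ D ∧ f x ≤ c := by
  have key : ∀ ε > 0, x ∈ D ∧ f x ≤ c + ε := fun ε hε => by
    refine (h.isClosed (c + ε)).mem_of_tendsto hu ?_
    filter_upwards [hr.eventually_lt_const (show c < c + ε by linarith)] with n hn
    exact ⟨hD n, (hle n).trans hn.le⟩
  exact ⟨(key 1 one_pos).1, le_of_forall_pos_le_add fun ε hε => (key ε hε).2⟩

/-- Existence of a minimiser of `f + ‖· - u‖² / (2 l)`. -/
theorem LscConvex.exists_min [CompleteSpace H] {D : Set H} {f : H → ℝ} (h : LscConvex D f) {l : ℝ}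
    (hl : 0 < l) (u : H) :
    ∃ y ∈ D, ∀ z ∈ D, f y + (2 * l)⁻¹ * ‖y - u‖ ^ 2 ≤ f z + (2 * l)⁻¹ * ‖z - u‖ ^ 2 := by
  set k : ℝ := (2 * l)⁻¹ with hk
  have hk0 : 0 < k := by positivity
  set G : H → ℝ := fun z => f z + k * ‖z - u‖ ^ 2 with hG
  have hG0 : ∀ z ∈ D, 0 ≤ G z := fun z hz => add_nonneg (h.nonneg z hz) (by positivity)
  have hbdd : BddBelow (G '' D) := ⟨0, by rintro _ ⟨z, hz, rfl⟩; exact hG0 z hz⟩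
  set m : ℝ := sInf (G '' D) with hm
  have hmle : ∀ z ∈ D, m ≤ G z := fun z hz => csInf_le hbdd ⟨z, hz, rfl⟩
  have hex : ∀ n : ℕ, ∃ z ∈ D, G z < m + 1 / ((n : ℝ) + 1) := fun n => by
    obtain ⟨_, ⟨z, hz, rfl⟩, hlt⟩ := exists_lt_of_csInf_lt (h.nonempty.image G)
      (show m < m + 1 / ((n : ℝ) + 1) by linarith [Nat.one_div_pos_of_nat (α := ℝ) (n := n)])
    exact ⟨z, hz, hlt⟩
  choose z hzD hzlt using hex
  -- Parallelogram identity: the midpoint has value at least `m`, so the distance of two points is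
  -- controlled by their excess over the infimum. Minimising sequences are therefore Cauchy.
  have hpar : ∀ a ∈ D, ∀ b ∈ D, k * ‖a - b‖ ^ 2 ≤ 2 * (G a - m) + 2 * (G b - m) := by
    intro a ha b hb
    have hmid : (1 / 2 : ℝ) • a + (1 / 2 : ℝ) • b ∈ D :=
      h.convexOn.1 ha hb (by norm_num) (by norm_num) (by norm_num)
    have h1 := hmle _ hmid
    have h2 := h.convexOn.2 ha hb (show (0 : ℝ) ≤ 1 / 2 by norm_num)
      (show (0 : ℝ) ≤ 1 / 2 by norm_num) (by norm_num)
    have h3 : ‖(1 / 2 : ℝ) • a + (1 / 2 : ℝ) • b - u‖ ^ 2 =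
        (1 / 2) * ‖a - u‖ ^ 2 + (1 / 2) * ‖b - u‖ ^ 2 - (1 / 4) * ‖a - b‖ ^ 2 := by
      have e1 : (1 / 2 : ℝ) • a + (1 / 2 : ℝ) • b - u = (1 / 2 : ℝ) • ((a - u) + (b - u)) := by
        module
      have e2 : a - b = (a - u) - (b - u) := by abel
      rw [e1, e2, norm_smul, mul_pow, norm_add_sq_real, norm_sub_sq_real (a - u)]
      norm_num
      ring
    simp only [hG, smul_eq_mul] at h1 h2 ⊢
    rw [h3] at h1
    nlinarith
  have hcau : CauchySeq z := by
    have hlim : Tendsto (fun N : ℕ => √(4 / k * (1 / ((N : ℝ) + 1)))) atTop (𝓝 0) := by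
      have h0 := (tendsto_one_div_add_atTop_nhds_zero_nat (𝕜 := ℝ)).const_mul (4 / k)
      rw [mul_zero] at h0
      simpa [Function.comp_def] using (Real.continuous_sqrt.tendsto 0).comp h0
    refine cauchySeq_of_le_tendsto_0 _ (fun a b N ha hb => ?_) hlim
    rw [dist_eq_norm]
    refine Real.le_sqrt_of_sq_le ?_
    have h1 := hpar _ (hzD a) _ (hzD b)
    have h2 : ∀ {a : ℕ}, N ≤ a → G (z a) - m ≤ 1 / ((N : ℝ) + 1) := fun {a} ha => by
      have : 1 / ((a : ℝ) + 1) ≤ 1 / ((N : ℝ) + 1) := by gcongr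
      linarith [hzlt a]
    have h3 := h2 ha
    have h4 := h2 hb
    rw [div_mul_eq_mul_div, le_div_iff₀ hk0]
    linarith
  obtain ⟨y, hy⟩ := cauchySeq_tendsto_of_complete hcau
  -- The quadratic term converges along `z`, so it is moved to the right before lower semicontinuity
  -- of `f` is used.
  have hlim := h.mem_of_tendsto hy hzD
    (r := fun n => m + 1 / ((n : ℝ) + 1) - k * ‖z n - u‖ ^ 2) (c := m + 0 - k * ‖y - u‖ ^ 2)
    ((tendsto_one_div_add_atTop_nhds_zero_nat.const_add m).sub
      (((hy.sub_const u).norm.pow 2).const_mul k))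
    (fun n => by have := (hzlt n).le; simp only [hG] at this; linarith)
  refine ⟨y, hlim.1, fun w hw => ?_⟩
  have := hmle w hw
  simp only [hG] at this
  linarith [hlim.2]

/-- First-order optimality of the minimiser: compare `y` with `(1 - t) y + t z`, use convexity of
`f`, divide by `t` and let `t → 0`. -/
theorem LscConvex.exists_prox [CompleteSpace H] {D : Set H} {f : H → ℝ} (h : LscConvex D f) {l : ℝ}
    (hl : 0 < l) (u : H) :
    ∃ y ∈ D, ∀ z ∈ D, f y + ⟪l⁻¹ • (u - y), z - y⟫ ≤ f z := by
  obtain ⟨y, hy, hmin⟩ := h.exists_min hl u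
  refine ⟨y, hy, fun z hz => ?_⟩
  have key : ∀ t : ℝ, 0 < t → t ≤ 1 →
      f y + ⟪l⁻¹ • (u - y), z - y⟫ ≤ f z + (2 * l)⁻¹ * ‖z - y‖ ^ 2 * t := by
    intro t ht ht1
    have h1 := h.convexOn.2 hy hz (show 0 ≤ 1 - t by linarith) ht.le (by ring)
    have h2 := hmin _ (h.convexOn.1 hy hz (show 0 ≤ 1 - t by linarith) ht.le (by ring))
    have e : (1 - t) • y + t • z - u = (y - u) + t • (z - y) := by module
    rw [e, norm_add_sq_real, norm_smul, inner_smul_right, Real.norm_eq_abs, mul_pow, sq_abs] at h2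
    have e2 : ⟪l⁻¹ • (u - y), z - y⟫ = - (l⁻¹ * ⟪y - u, z - y⟫) := by
      rw [inner_smul_left, ← neg_sub y u, inner_neg_left]
      simp
    rw [e2]
    simp only [smul_eq_mul] at h1
    have e3 : (2 * l)⁻¹ = l⁻¹ / 2 := by rw [mul_inv]; ring
    rw [e3] at h2 ⊢
    have h3 : t * (f y) ≤ t * (f z + l⁻¹ * ⟪y - u, z - y⟫ + l⁻¹ / 2 * ‖z - y‖ ^ 2 * t) := by
      nlinarith
    have h4 := le_of_mul_le_mul_left h3 ht
    linarith
  have hlim : Tendsto (fun t : ℝ => f z + (2 * l)⁻¹ * ‖z - y‖ ^ 2 * t) (𝓝[>] 0) (𝓝 (f z)) := by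
    have : Tendsto (fun t : ℝ => f z + (2 * l)⁻¹ * ‖z - y‖ ^ 2 * t) (𝓝 0)
        (𝓝 (f z + (2 * l)⁻¹ * ‖z - y‖ ^ 2 * 0)) :=
      (continuous_const.add (continuous_const.mul continuous_id)).tendsto 0
    rw [mul_zero, add_zero] at this
    exact this.mono_left nhdsWithin_le_nhds
  refine ge_of_tendsto hlim ?_
  filter_upwards [Ioc_mem_nhdsGT (zero_lt_one (α := ℝ))] with t ht using key t ht.1 ht.2

variable {D : Set H} {f : H → ℝ} {l : ℝ}

/-- `J = J_l` and `A = A_l` are the proximal map and the Yosida approximation of `∂f` with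
parameter `l`: `u = J u + l A u`, where `A u ∈ ∂f(J u)`. -/
structure IsYosida (D : Set H) (f : H → ℝ) (l : ℝ) (J A : H → H) : Prop where
  pos : 0 < l
  mem : ∀ u, J u ∈ D
  eq : ∀ u, u = J u + l • A u
  le : ∀ u, ∀ z ∈ D, f (J u) + ⟪A u, z - J u⟫ ≤ f z

theorem LscConvex.exists_isYosida [CompleteSpace H] (h : LscConvex D f) (hl : 0 < l) :
    ∃ J A : H → H, IsYosida D f l J A := by
  choose J hJ hle using fun u => h.exists_prox hl u
  refine ⟨J, fun u => l⁻¹ • (u - J u), hl, hJ, fun u => ?_, hle⟩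
  rw [smul_smul, mul_inv_cancel₀ hl.ne', one_smul, add_sub_cancel]

/-- The Moreau envelope of `f`. -/
noncomputable def envelope (f : H → ℝ) (l : ℝ) (J A : H → H) (u : H) : ℝ :=
  f (J u) + l / 2 * ‖A u‖ ^ 2

variable {J A : H → H}

/-- `A u` and `A' w` are subgradients of the same `f` at `J u` and `J' w`; add the two inequalities.
Distinct parameters are allowed in order to compare two regularised flows. -/
theorem IsYosida.monotone {l' : ℝ} {J' A' : H → H} (h : IsYosida D f l J A)
    (h' : IsYosida D f l' J' A') (u w : H) : 0 ≤ ⟪A u - A' w, J u - J' w⟫ := by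
  have h1 := h.le u _ (h'.mem w)
  have h2 := h'.le w _ (h.mem u)
  have e1 : ⟪A u, J' w - J u⟫ = - ⟪A u, J u - J' w⟫ := by rw [← inner_neg_right, neg_sub]
  rw [inner_sub_left]
  linarith

/-- Split `u - w` into the difference of the proximal points, which contributes a nonnegative term
by monotonicity, and `l` times the difference of the values of `A`. -/
theorem IsYosida.cocoercive (h : IsYosida D f l J A) (u w : H) :
    l * ‖A u - A w‖ ^ 2 ≤ ⟪A u - A w, u - w⟫ := by
  have h1 := h.monotone h u w
  have e : u - w = (J u - J w) + l • (A u - A w) := by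
    rw [smul_sub]
    nth_rewrite 1 [h.eq u, h.eq w]
    abel
  rw [e, inner_add_right, inner_smul_right, real_inner_self_eq_norm_sq]
  linarith

theorem IsYosida.lipschitz (h : IsYosida D f l J A) : LipschitzWith (Real.toNNReal l⁻¹) A := by
  refine LipschitzWith.of_dist_le_mul fun u w => ?_
  rw [dist_eq_norm, dist_eq_norm, Real.coe_toNNReal _ (inv_nonneg.2 h.pos.le)]
  have h1 := (h.cocoercive u w).trans (real_inner_le_norm _ _)
  rcases (norm_nonneg (A u - A w)).eq_or_lt with h0 | h0
  · rw [← h0]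
    have := h.pos
    positivity
  · rw [le_inv_mul_iff₀ h.pos]
    have h2 : ‖A u - A w‖ * (l * ‖A u - A w‖) ≤ ‖A u - A w‖ * ‖u - w‖ := by nlinarith
    exact le_of_mul_le_mul_left h2 h0

theorem IsYosida.envelope_le (h : IsYosida D f l J A) {z : H} (hz : z ∈ D) :
    envelope f l J A z ≤ f z := by
  have h1 := h.le z z hz
  have e : z - J z = l • A z := by
    nth_rewrite 1 [h.eq z]
    abel
  rw [e, inner_smul_right, real_inner_self_eq_norm_sq] at h1
  have := h.pos
  have h2 : 0 ≤ l * ‖A z‖ ^ 2 := by positivity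
  rw [envelope]
  linarith

/-- The subgradient inequality at `J u`, tested at `J w`, gives this with `l / 2 * ‖A w - A u‖ ^ 2`
to spare. It exhibits `A u` as a subgradient of the envelope at `u`. -/
theorem IsYosida.le_envelope (h : IsYosida D f l J A) (u w : H) :
    envelope f l J A u + ⟪A u, w - u⟫ ≤ envelope f l J A w := by
  have h1 := h.le u _ (h.mem w)
  have e : J w - J u = (w - u) - l • (A w - A u) := by
    rw [smul_sub]
    nth_rewrite 2 [h.eq u, h.eq w]
    abel
  rw [e, inner_sub_right, inner_smul_right, inner_sub_right (A u) (A w),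
    real_inner_self_eq_norm_sq] at h1
  have h2 : 0 ≤ ‖A w - A u‖ ^ 2 := by positivity
  rw [norm_sub_sq_real, real_inner_comm] at h2
  have := h.pos
  have h3 : 0 ≤ l / 2 * (‖A w‖ ^ 2 - 2 * ⟪A u, A w⟫ + ‖A u‖ ^ 2) := by positivity
  simp only [envelope]
  linarith

theorem IsYosida.envelope_nonneg (hf : LscConvex D f) (h : IsYosida D f l J A) (u : H) :
    0 ≤ envelope f l J A u := by
  have := h.pos
  have := hf.nonneg _ (h.mem u)
  rw [envelope]
  positivity

/-- Here `J u - u = -(l • A u)`. Under a uniform bound on the envelope, proximal points and their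
base points acquire the same limit as `l → 0`. -/
theorem IsYosida.norm_sub_sq_le (hf : LscConvex D f) (h : IsYosida D f l J A) (u : H) :
    ‖J u - u‖ ^ 2 ≤ 2 * l * envelope f l J A u := by
  have hl := h.pos
  have e : J u - u = - (l • A u) := by
    nth_rewrite 2 [h.eq u]
    abel
  rw [e, norm_neg, norm_smul, Real.norm_of_nonneg hl.le, envelope]
  have := mul_nonneg hl.le (hf.nonneg _ (h.mem u))
  nlinarith

/-- The inequalities of `le_envelope` from `u` to `w` and from `w` to `u` trap the remainder between
`0` and `⟪A w - A u, w - u⟫`, which is quadratic in `w - u` by the Lipschitz bound. -/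
theorem IsYosida.hasFDerivAt_envelope (h : IsYosida D f l J A) (u : H) :
    HasFDerivAt (envelope f l J A) (innerSL ℝ (A u)) u := by
  rw [hasFDerivAt_iff_isLittleO]
  have hb : ∀ w, ‖envelope f l J A w - envelope f l J A u - innerSL ℝ (A u) (w - u)‖ ≤
      ‖l⁻¹ * (‖w - u‖ * ‖w - u‖)‖ := by
    intro w
    rw [innerSL_apply_apply]
    have h1 := h.le_envelope u w
    have h2 := h.le_envelope w u
    have h3 : ⟪A w, u - w⟫ = - ⟪A w, w - u⟫ := by rw [← inner_neg_right, neg_sub]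
    have h4 : ⟪A w - A u, w - u⟫ ≤ l⁻¹ * (‖w - u‖ * ‖w - u‖) := by
      refine (real_inner_le_norm _ _).trans ?_
      have := h.lipschitz.dist_le_mul w u
      rw [dist_eq_norm, dist_eq_norm, Real.coe_toNNReal _ (inv_nonneg.2 h.pos.le)] at this
      rw [← mul_assoc]
      gcongr
    rw [inner_sub_left] at h4
    rw [Real.norm_eq_abs, Real.norm_eq_abs]
    refine le_trans ?_ (le_abs_self _)
    rw [abs_le]
    constructor <;> linarith
  have h0 : Tendsto (fun w => ‖w - u‖) (𝓝 u) (𝓝 0) := by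
    have : Continuous fun w => ‖w - u‖ := by fun_prop
    simpa using this.tendsto u
  have h1 : (fun w => ‖w - u‖) =o[𝓝 u] fun _ => (1 : ℝ) := (Asymptotics.isLittleO_one_iff ℝ).2 h0
  have h2 := h1.mul_isBigO (Asymptotics.isBigO_refl (fun w => ‖w - u‖) (𝓝 u))
  simp only [one_mul] at h2
  have h3 := h2.trans_isBigO (Asymptotics.isBigO_norm_left.2
    (Asymptotics.isBigO_refl (fun w => w - u) (𝓝 u)))
  exact (Asymptotics.IsBigO.of_norm_le hb).trans_isLittleO (h3.const_mul_left l⁻¹).norm_left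

end Prox

/-! ### Estimates for the regularised flow `u' = -A u` -/

section Regularised

variable {H : Type*} [NormedAddCommGroup H] [InnerProductSpace ℝ H]

local notation "⟪" x ", " y "⟫" => inner ℝ x y

theorem antitoneOn_Icc_of_hasDerivAt_nonpos {φ φ' : ℝ → ℝ} {a b : ℝ}
    (hc : ContinuousOn φ (Icc a b)) (hd : ∀ t ∈ Ioo a b, HasDerivAt φ (φ' t) t)
    (hn : ∀ t ∈ Ioo a b, φ' t ≤ 0) : AntitoneOn φ (Icc a b) := by
  refine antitoneOn_of_hasDerivWithinAt_nonpos (f' := φ') (convex_Icc a b) hc ?_ ?_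
  · intro t ht
    rw [interior_Icc] at ht
    exact (hd t ht).hasDerivWithinAt
  · intro t ht
    rw [interior_Icc] at ht
    exact hn t ht

theorem hasDerivAt_norm_sq {w : ℝ → H} {w' : H} {t : ℝ} (h : HasDerivAt w w' t) :
    HasDerivAt (fun s => ‖w s‖ ^ 2) (2 * ⟪w t, w'⟫) t := by
  simpa using h.norm_sq

variable {D : Set H} {f : H → ℝ} {l : ℝ} {J A : H → H}

theorem IsYosida.continuous_envelope (h : IsYosida D f l J A) : Continuous (envelope f l J A) :=
  continuous_iff_continuousAt.2 fun u => (h.hasFDerivAt_envelope u).continuousAt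

theorem IsYosida.hasDerivAt_envelope (h : IsYosida D f l J A) {T : ℝ} {u : ℝ → H}
    (hu : SolvesODE (fun x => -A x) T u) {t : ℝ} (ht : t ∈ Ioo 0 T) :
    HasDerivAt (fun s => envelope f l J A (u s)) (-‖A (u t)‖ ^ 2) t := by
  have := (h.hasFDerivAt_envelope (u t)).comp_hasDerivAt t (hu.hasDerivAt ht)
  simpa [Function.comp_def, real_inner_self_eq_norm_sq] using this

theorem IsYosida.antitoneOn_envelope (h : IsYosida D f l J A) {T : ℝ} {u : ℝ → H}
    (hu : SolvesODE (fun x => -A x) T u) :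
    AntitoneOn (fun s => envelope f l J A (u s)) (Icc 0 T) :=
  antitoneOn_Icc_of_hasDerivAt_nonpos (h.continuous_envelope.comp_continuousOn hu.continuousOn)
    (fun _ ht => h.hasDerivAt_envelope hu ht) fun t _ => by
      have : 0 ≤ ‖A (u t)‖ ^ 2 := by positivity
      linarith

/-- The flow is a contraction. -/
theorem IsYosida.norm_sub_le (h : IsYosida D f l J A) {T : ℝ} {u v : ℝ → H}
    (hu : SolvesODE (fun x => -A x) T u) (hv : SolvesODE (fun x => -A x) T v) {t : ℝ}
    (ht : t ∈ Icc 0 T) : ‖u t - v t‖ ≤ ‖u 0 - v 0‖ := by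
  have hanti : AntitoneOn (fun s => ‖u s - v s‖ ^ 2) (Icc 0 T) := by
    refine antitoneOn_Icc_of_hasDerivAt_nonpos ((hu.continuousOn.sub hv.continuousOn).norm.pow 2)
      (fun s hs => hasDerivAt_norm_sq ((hu.hasDerivAt hs).sub (hv.hasDerivAt hs))) fun s _ => ?_
    have h1 := h.cocoercive (u s) (v s)
    have h2 : 0 ≤ l * ‖A (u s) - A (v s)‖ ^ 2 := by have := h.pos; positivity
    have e : -A (u s) - -A (v s) = - (A (u s) - A (v s)) := by abel
    rw [e, inner_neg_right, real_inner_comm]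
    linarith
  have := hanti ⟨le_rfl, ht.1.trans ht.2⟩ ht ht.1
  exact (sq_le_sq₀ (norm_nonneg _) (norm_nonneg _)).1 this

/-- The evolution variational inequality for the regularised flow. -/
theorem IsYosida.evi (h : IsYosida D f l J A) {T : ℝ} {u : ℝ → H}
    (hu : SolvesODE (fun x => -A x) T u) {z : H} (hz : z ∈ D) {s t : ℝ} (hs : 0 ≤ s) (hst : s ≤ t)
    (ht : t ≤ T) :
    ‖u t - z‖ ^ 2 - ‖u s - z‖ ^ 2 ≤ 2 * (t - s) * (f z - envelope f l J A (u t)) := by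
  set c : ℝ := f z - envelope f l J A (u t) with hc
  have hsub : Icc s t ⊆ Icc 0 T := Icc_subset_Icc hs ht
  -- The envelope decreases along the flow, so on `[s, t]` it is at least its value at `t`. Freezing
  -- that value in `c` makes the derivative nonpositive.
  have hanti : AntitoneOn (fun r => ‖u r - z‖ ^ 2 - 2 * c * r) (Icc s t) := by
    refine antitoneOn_Icc_of_hasDerivAt_nonpos
      (φ' := fun r => 2 * ⟪u r - z, -A (u r)⟫ - 2 * c * 1) ?_ (fun r hr => ?_) fun r hr => ?_
    · exact (((hu.continuousOn.mono hsub).sub continuousOn_const).norm.pow 2).sub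
        (by fun_prop)
    · have hr' : r ∈ Ioo 0 T := ⟨hs.trans_lt hr.1, hr.2.trans_le ht⟩
      exact (hasDerivAt_norm_sq ((hu.hasDerivAt hr').sub_const z)).sub
        ((hasDerivAt_id r).const_mul (2 * c))
    · have h1 := h.le_envelope (u r) z
      have h2 := h.envelope_le hz
      have h3 := h.antitoneOn_envelope hu (hsub ⟨hr.1.le, hr.2.le⟩) (hsub ⟨hst, le_rfl⟩) hr.2.le
      have e : ⟪u r - z, -A (u r)⟫ = ⟪A (u r), z - u r⟫ := by
        rw [inner_neg_right, real_inner_comm, ← inner_neg_right, neg_sub]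
      simp only at h3
      rw [e]
      linarith
  have := hanti ⟨le_rfl, hst⟩ ⟨hst, le_rfl⟩ hst
  simp only at this
  linarith

/-- Comparison of the regularised flows for two parameters. -/
theorem IsYosida.norm_sub_sq_le_add (hf : LscConvex D f) (h : IsYosida D f l J A) {l' : ℝ}
    {J' A' : H → H} (h' : IsYosida D f l' J' A') {T : ℝ} {u v : ℝ → H}
    (hu : SolvesODE (fun x => -A x) T u) (hv : SolvesODE (fun x => -A' x) T v) {x : H}
    (hx : x ∈ D) (hu0 : u 0 = x) (hv0 : v 0 = x) {t : ℝ} (ht : t ∈ Icc 0 T) :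
    ‖u t - v t‖ ^ 2 ≤ (l + l') * (2 * f x) := by
  have hl := h.pos
  have hl' := h'.pos
  set e : H → ℝ := envelope f l J A with he
  set e' : H → ℝ := envelope f l' J' A' with he'
  -- For two parameters, differentiating the squared distance leaves a cross term `2 (l + l') ⟪a,
  -- b⟫` of no definite sign. The dissipation of the added envelopes contributes `-(l + l') (‖a‖² +
  -- ‖b‖²)`, which completes the square.
  have hanti : AntitoneOn (fun s => ‖u s - v s‖ ^ 2 + (l + l') * (e (u s) + e' (v s)))
      (Icc 0 T) := by
    refine antitoneOn_Icc_of_hasDerivAt_nonpos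
      (φ' := fun s => 2 * ⟪u s - v s, -A (u s) - -A' (v s)⟫ +
        (l + l') * (-‖A (u s)‖ ^ 2 + -‖A' (v s)‖ ^ 2)) ?_ (fun s hs => ?_) fun s hs => ?_
    · exact ((hu.continuousOn.sub hv.continuousOn).norm.pow 2).add (continuousOn_const.mul
        ((h.continuous_envelope.comp_continuousOn hu.continuousOn).add
          (h'.continuous_envelope.comp_continuousOn hv.continuousOn)))
    · exact (hasDerivAt_norm_sq ((hu.hasDerivAt hs).sub (hv.hasDerivAt hs))).add
        (((h.hasDerivAt_envelope hu hs).add (h'.hasDerivAt_envelope hv hs)).const_mul (l + l'))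
    · set a := A (u s) with ha
      set b := A' (v s) with hb
      have h1 := h.monotone h' (u s) (v s)
      have e1 : u s - v s = (J (u s) - J' (v s)) + (l • a - l' • b) := by
        nth_rewrite 1 [h.eq (u s), h'.eq (v s)]
        abel
      have e2 : -a - -b = - (a - b) := by abel
      have e3 : ⟪l • a - l' • b, a - b⟫ = l * ‖a‖ ^ 2 + l' * ‖b‖ ^ 2 - (l + l') * ⟪a, b⟫ := by
        simp only [inner_sub_left, inner_sub_right, inner_smul_left, real_inner_self_eq_norm_sq,
          real_inner_comm a b, conj_trivial]
        ring
      have h2 : 0 ≤ ‖a - b‖ ^ 2 := by positivity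
      rw [norm_sub_sq_real] at h2
      rw [e2, inner_neg_right, e1, inner_add_left, e3, real_inner_comm (a - b)]
      have h3 : 0 ≤ (l + l') * (‖a‖ ^ 2 - 2 * ⟪a, b⟫ + ‖b‖ ^ 2) := by positivity
      have h4 : 0 ≤ l * ‖a‖ ^ 2 := by positivity
      have h5 : 0 ≤ l' * ‖b‖ ^ 2 := by positivity
      linarith
  have h1 := hanti ⟨le_rfl, ht.1.trans ht.2⟩ ht ht.1
  simp only [hu0, hv0, sub_self, norm_zero] at h1
  have h2 : 0 ≤ (l + l') * (e (u t) + e' (v t)) :=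
    mul_nonneg (by positivity) (add_nonneg (h.envelope_nonneg hf _) (h'.envelope_nonneg hf _))
  have h3 : (l + l') * (e x + e' x) ≤ (l + l') * (2 * f x) := by
    have := h.envelope_le hx
    have := h'.envelope_le hx
    gcongr
    linarith
  linarith

/-- The energy dissipation estimate for the regularised flow. -/
theorem IsYosida.integral_norm_sq_le (hf : LscConvex D f) (h : IsYosida D f l J A) {T : ℝ}
    {u : ℝ → H} (hu : SolvesODE (fun x => -A x) T u) {a b : ℝ} (ha : 0 ≤ a) (hab : a ≤ b)
    (hb : b ≤ T) : ∫ t in a..b, ‖A (u t)‖ ^ 2 ≤ envelope f l J A (u a) := by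
  have hsub : Icc a b ⊆ Icc 0 T := Icc_subset_Icc ha hb
  have hcu := hu.continuousOn.mono hsub
  have hcA : ContinuousOn (fun t => ‖A (u t)‖ ^ 2) (Icc a b) :=
    (h.lipschitz.continuous.comp_continuousOn hcu).norm.pow 2
  have hi : IntervalIntegrable (fun t => -‖A (u t)‖ ^ 2) volume a b :=
    (hcA.neg).intervalIntegrable_of_Icc hab
  have := intervalIntegral.integral_eq_sub_of_hasDerivAt_of_le hab
    (h.continuous_envelope.comp_continuousOn hcu)
    (fun t ht => h.hasDerivAt_envelope hu ⟨ha.trans_lt ht.1, ht.2.trans_le hb⟩) hi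
  rw [intervalIntegral.integral_neg] at this
  have h0 := h.envelope_nonneg hf (u b)
  simp only [Function.comp_apply] at this
  linarith

end Regularised

/-! ### Existence and uniqueness for gradient flows in a Hilbert space -/

section GradientFlow

variable {H : Type*} [NormedAddCommGroup H] [InnerProductSpace ℝ H]

local notation "⟪" x ", " y "⟫" => inner ℝ x y

/-- A pointwise limit of curves with derivatives bounded in `L²` has a weak derivative in `L²`. -/
theorem exists_memLp_integral_eq_of_tendsto [CompleteSpace H] {a b M : ℝ} (hab : a ≤ b)
    {U W : ℕ → ℝ → H} {u : ℝ → H} (hW : ∀ n, ContinuousOn (W n) (Icc a b))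
    (hM : ∀ n, ∫ t in a..b, ‖W n t‖ ^ 2 ≤ M)
    (hU : ∀ n, ∀ t ∈ Icc a b, U n t - U n a = ∫ s in a..t, W n s)
    (hlim : ∀ t ∈ Icc a b, Tendsto (fun n => U n t) atTop (𝓝 (u t))) :
    ∃ v : ℝ → H, MemLp v 2 (volume.restrict (Icc a b)) ∧
      ∀ t ∈ Icc a b, u t - u a = ∫ s in a..t, v s := by
  set μ : Measure ℝ := volume.restrict (Icc a b) with hμ
  have hmem : ∀ n, MemLp (W n) 2 μ := fun n => by
    obtain ⟨C, hC⟩ := isCompact_Icc.exists_bound_of_continuousOn (hW n)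
    refine MemLp.of_bound ((hW n).aestronglyMeasurable_of_isCompact isCompact_Icc measurableSet_Icc)
      C ?_
    exact (ae_restrict_iff' measurableSet_Icc).2 (Eventually.of_forall hC)
  set w : ℕ → Lp H 2 μ := fun n => (hmem n).toLp (W n) with hw
  have hwae : ∀ n, w n =ᵐ[μ] W n := fun n => (hmem n).coeFn_toLp
  have hnorm : ∀ n, ‖w n‖ ≤ √M := fun n => by
    refine Real.le_sqrt_of_sq_le ?_
    rw [← real_inner_self_eq_norm_sq, L2.inner_def]
    refine le_trans (le_of_eq ?_) (hM n)
    rw [intervalIntegral.integral_of_le hab, ← integral_Icc_eq_integral_Ioc]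
    refine integral_congr_ae ?_
    filter_upwards [hwae n] with x hx
    rw [hx, real_inner_self_eq_norm_sq]
  -- The weak limit is taken along a nonprincipal ultrafilter: Banach–Alaoglu then requires no
  -- subsequence and no separability, and limits along `atTop` persist.
  set φ : ℕ → WeakDual ℝ (Lp H 2 μ) := fun n =>
    StrongDual.toWeakDual (InnerProductSpace.toDual ℝ (Lp H 2 μ) (w n)) with hφ
  have hφmem : ∀ n, φ n ∈ WeakDual.toStrongDual ⁻¹'
      Metric.closedBall (0 : StrongDual ℝ (Lp H 2 μ)) (√M) := fun n => by
    have e : ‖InnerProductSpace.toDual ℝ (Lp H 2 μ) (w n)‖ ≤ √M := by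
      rw [LinearIsometryEquiv.norm_map]
      exact hnorm n
    exact mem_closedBall_zero_iff.2 e
  obtain ⟨ψ, -, hψ⟩ := (WeakDual.isCompact_closedBall (0 : StrongDual ℝ (Lp H 2 μ))
    (√M)).ultrafilter_le_nhds ((hyperfilter ℕ).map φ) (by
      rw [le_principal_iff]
      exact Filter.mem_map.2 (univ_mem' hφmem))
  have hten : ∀ g : Lp H 2 μ, Tendsto (fun n => ⟪w n, g⟫) (hyperfilter ℕ) (𝓝 (ψ g)) := fun g => by
    have h1 : Tendsto φ (hyperfilter ℕ) (𝓝 ψ) := hψ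
    exact ((WeakDual.eval_continuous g).tendsto ψ).comp h1
  set v : Lp H 2 μ := (InnerProductSpace.toDual ℝ (Lp H 2 μ)).symm (WeakDual.toStrongDual ψ)
    with hv
  have hvψ : ∀ g, ⟪v, g⟫ = ψ g := fun g => InnerProductSpace.toDual_symm_apply
  refine ⟨v, Lp.memLp v, fun t ht => ?_⟩
  have hset : ∀ g : ℝ → H, ∫ s in Ioc a t, g s ∂μ = ∫ s in a..t, g s := fun g => by
    rw [hμ, Measure.restrict_restrict measurableSet_Ioc, intervalIntegral.integral_of_le ht.1,
      inter_eq_left.2 (Ioc_subset_Icc_self.trans (Icc_subset_Icc_right ht.2))]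
  have hfin : μ (Ioc a t) ≠ ∞ := measure_ne_top _ _
  -- Pairing with `c` times the indicator of `(a, t]` turns `w n` into `⟪c, U n t - U n a⟫`, whose
  -- limit is known.
  refine ext_inner_left ℝ fun c => ?_
  have h1 := hten (indicatorConstLp 2 measurableSet_Ioc hfin c)
  have h2 : ∀ n, ⟪w n, indicatorConstLp 2 measurableSet_Ioc hfin c⟫ = ⟪c, U n t - U n a⟫ := by
    intro n
    rw [real_inner_comm, L2.inner_indicatorConstLp_eq_inner_setIntegral, hU n t ht, ← hset]
    congr 1
    exact integral_congr_ae (ae_restrict_of_ae (hwae n))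
  have h3 : Tendsto (fun n => ⟪c, U n t - U n a⟫) atTop (𝓝 ⟪c, u t - u a⟫) :=
    tendsto_const_nhds.inner ((hlim t ht).sub (hlim a ⟨le_rfl, hab⟩))
  simp only [h2] at h1
  have h4 := tendsto_nhds_unique h1 (h3.mono_left Nat.hyperfilter_le_atTop)
  rw [← h4, ← hvψ, real_inner_comm, L2.inner_indicatorConstLp_eq_inner_setIntegral, hset]

variable {D : Set H} {f : H → ℝ}

/-- The curve `u` satisfies the evolution variational inequality on `[0, T]`. -/
def EVI (D : Set H) (f : H → ℝ) (T : ℝ) (u : ℝ → H) : Prop :=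
  ∀ s t, 0 ≤ s → s < t → t ≤ T → u t ∈ D ∧
    ∀ z ∈ D, ‖u t - z‖ ^ 2 - ‖u s - z‖ ^ 2 ≤ 2 * (t - s) * (f z - f (u t))

/-- At a point of differentiability, the evolution variational inequality gives `-u' ∈ ∂f(u)`. -/
theorem EVI.le_of_hasDerivAt {T : ℝ} {u : ℝ → H} (h : EVI D f T u) {t : ℝ} (ht : t ∈ Ioo 0 T)
    {u' : H} (hu : HasDerivAt u u' t) {z : H} (hz : z ∈ D) :
    f (u t) + ⟪-u', z - u t⟫ ≤ f z := by
  have hd : HasDerivAt (fun s => ‖u s - z‖ ^ 2) (2 * ⟪u t - z, u'⟫) t :=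
    hasDerivAt_norm_sq (hu.sub_const z)
  -- The variational inequality contains `f` at the later time only, so `t` must be the later point
  -- and the difference quotient is taken from the left.
  have h1 := (hasDerivAt_iff_tendsto_slope.1 hd).mono_left
    (nhdsWithin_mono t (show Iio t ⊆ {t}ᶜ from fun s (hs : s < t) => hs.ne))
  have h2 : ∀ᶠ s in 𝓝[<] t, slope (fun s => ‖u s - z‖ ^ 2) t s ≤ 2 * (f z - f (u t)) := by
    filter_upwards [Ioo_mem_nhdsLT ht.1] with s hs
    have h3 := (h s t hs.1.le hs.2 ht.2.le).2 z hz
    have h4 : 0 < t - s := sub_pos.2 hs.2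
    rw [slope_comm, slope_def_field, div_le_iff₀ h4]
    linarith
  have h5 := le_of_tendsto h1 h2
  have e : ⟪-u', z - u t⟫ = ⟪u t - z, u'⟫ := by
    rw [inner_neg_left, ← inner_neg_right, neg_sub, real_inner_comm]
  rw [e]
  linarith

/-- Existence of a gradient flow for every initial value in the closure of the domain. -/
theorem LscConvex.exists_evi [CompleteSpace H] (hf : LscConvex D f) {x : H} (hx : x ∈ closure D)
    {T : ℝ} : ∃ u : ℝ → H, FlowRegular T u ∧ u 0 = x ∧ EVI D f T u := by
  set l : ℕ → ℝ := fun n => 1 / ((n : ℝ) + 1) with hl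
  have hl0 : ∀ n, 0 < l n := fun n => Nat.one_div_pos_of_nat
  have hllim : Tendsto l atTop (𝓝 0) := tendsto_one_div_add_atTop_nhds_zero_nat
  choose J A hY using fun n => hf.exists_isYosida (hl0 n)
  have hode : ∀ (n : ℕ) (y : H), ∃ u : ℝ → H, u 0 = y ∧ SolvesODE (fun x => -A n x) T u :=
    fun n y => exists_solvesODE (hY n).lipschitz.neg y T
  choose V hV0 hV using hode
  set U : ℕ → ℝ → H := fun n => V n x with hU
  -- As `x` need not lie in `D`, choose `y ∈ D` within `ε / 4`. Contraction costs `ε / 4` for each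
  -- of the two parameters, and the comparison estimate from `y` costs `ε / 2`.
  have hcau : UniformCauchySeqOn U atTop (Icc 0 T) := by
    rw [Metric.uniformCauchySeqOn_iff]
    intro ε hε
    obtain ⟨y, hy, hxy⟩ := Metric.mem_closure_iff.1 hx (ε / 4) (by positivity)
    rw [dist_eq_norm] at hxy
    have hlim : Tendsto (fun n => l n * (4 * f y)) atTop (𝓝 0) := by
      simpa using hllim.mul_const (4 * f y)
    obtain ⟨N, hN⟩ := (hlim.eventually_lt_const (show (0 : ℝ) < (ε / 2) ^ 2 by positivity)).exists
    refine ⟨N, fun m hm n hn t ht => ?_⟩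
    have hfy := hf.nonneg y hy
    have hle : ∀ k, N ≤ k → l k ≤ l N := fun k hk => by
      simp only [hl]
      gcongr
    have h1 := (hY m).norm_sub_sq_le_add hf (hY n) (hV m y) (hV n y) hy (hV0 m y) (hV0 n y) ht
    have h2 : (l m + l n) * (2 * f y) ≤ (l N + l N) * (2 * f y) := by
      have := hle m hm
      have := hle n hn
      gcongr
    have h3 : ‖V m y t - V n y t‖ < ε / 2 :=
      (sq_lt_sq₀ (norm_nonneg _) (by positivity)).1 (by linarith)
    have h4 := (hY m).norm_sub_le (hV m x) (hV m y) ht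
    have h5 := (hY n).norm_sub_le (hV n y) (hV n x) ht
    rw [hV0, hV0] at h4 h5
    rw [norm_sub_rev y x] at h5
    rw [dist_eq_norm]
    have h6 : ‖V m x t - V n x t‖ ≤ ‖V m x t - V m y t‖ + ‖V m y t - V n y t‖ +
        ‖V n y t - V n x t‖ := by
      have e : V m x t - V n x t = (V m x t - V m y t) + (V m y t - V n y t) +
        (V n y t - V n x t) := by abel
      rw [e]
      exact norm_add₃_le
    simp only [hU]
    linarith
  have hex : ∀ t, ∃ y : H, t ∈ Icc 0 T → Tendsto (fun n => U n t) atTop (𝓝 y) := fun t => by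
    by_cases ht : t ∈ Icc 0 T
    · obtain ⟨y, hy⟩ := cauchySeq_tendsto_of_complete (hcau.cauchySeq ht)
      exact ⟨y, fun _ => hy⟩
    · exact ⟨x, fun h => absurd h ht⟩
  choose u₁ hu₁ using hex
  -- No sign of `T` is assumed, so `0` may lie outside `Icc 0 T`; the initial value is therefore
  -- prescribed.
  set u : ℝ → H := fun t => if t = 0 then x else u₁ t with hu
  have hlim : ∀ t ∈ Icc 0 T, Tendsto (fun n => U n t) atTop (𝓝 (u t)) := by
    intro t ht
    by_cases h0 : t = 0
    · simp only [hu, h0, if_true, hU, hV0]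
      exact tendsto_const_nhds
    · simp only [hu, h0, if_false]
      exact hu₁ t ht
  have hu0 : u 0 = x := if_pos rfl
  have hunif : TendstoUniformlyOn U u atTop (Icc 0 T) :=
    hcau.tendstoUniformlyOn_of_tendsto hlim
  have hcont : ContinuousOn u (Icc 0 T) :=
    hunif.continuousOn (Frequently.of_forall fun n => (hV n x).continuousOn)
  have hevi : EVI D f T u := by
    intro s t hs hst ht
    have hs' : s ∈ Icc 0 T := ⟨hs, hst.le.trans ht⟩
    have ht' : t ∈ Icc 0 T := ⟨hs.trans hst.le, ht⟩
    have hts : 0 < 2 * (t - s) := by linarith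
    have key : ∀ z ∈ D, u t ∈ D ∧
        f (u t) ≤ f z - (‖u t - z‖ ^ 2 - ‖u s - z‖ ^ 2) / (2 * (t - s)) := by
      intro z hz
      set r : ℕ → ℝ := fun n => f z - (‖U n t - z‖ ^ 2 - ‖U n s - z‖ ^ 2) / (2 * (t - s)) with hr
      have hrlim : Tendsto r atTop
          (𝓝 (f z - (‖u t - z‖ ^ 2 - ‖u s - z‖ ^ 2) / (2 * (t - s)))) :=
        tendsto_const_nhds.sub (((((hlim t ht').sub_const z).norm.pow 2).sub
          (((hlim s hs').sub_const z).norm.pow 2)).div_const _)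
      have henv : ∀ n, envelope f (l n) (J n) (A n) (U n t) ≤ r n := fun n => by
        have h1 := (hY n).evi (hV n x) hz hs hst.le ht
        have h2 : (‖U n t - z‖ ^ 2 - ‖U n s - z‖ ^ 2) / (2 * (t - s)) ≤
            f z - envelope f (l n) (J n) (A n) (U n t) := by
          rw [div_le_iff₀ hts]
          linarith
        simp only [hr]
        linarith
      -- `U n t` itself need not lie in `D`, so lower semicontinuity is applied to the proximal
      -- points, which have the same limit.
      have hJlim : Tendsto (fun n => J n (U n t)) atTop (𝓝 (u t)) := by
        have h0 : Tendsto (fun n => √(2 * l n * r n)) atTop (𝓝 0) := by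
          have h1 := (hllim.const_mul 2).mul hrlim
          rw [mul_zero, zero_mul] at h1
          simpa [Function.comp_def] using (Real.continuous_sqrt.tendsto 0).comp h1
        have h2 : Tendsto (fun n => J n (U n t) - U n t) atTop (𝓝 0) := by
          refine squeeze_zero_norm (fun n => Real.le_sqrt_of_sq_le ?_) h0
          refine ((hY n).norm_sub_sq_le hf (U n t)).trans ?_
          have := hl0 n
          have := henv n
          gcongr
        simpa using h2.add (hlim t ht')
      refine hf.mem_of_tendsto hJlim (fun n => (hY n).mem _) hrlim fun n => ?_
      refine le_trans ?_ (henv n)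
      have := hl0 n
      have : 0 ≤ l n / 2 * ‖A n (U n t)‖ ^ 2 := by positivity
      rw [envelope]
      linarith
    obtain ⟨z₀, hz₀⟩ := hf.nonempty
    refine ⟨(key z₀ hz₀).1, fun z hz => ?_⟩
    have h1 := (key z hz).2
    have h2 : (‖u t - z‖ ^ 2 - ‖u s - z‖ ^ 2) / (2 * (t - s)) ≤ f z - f (u t) := by linarith
    rw [div_le_iff₀ hts] at h2
    linarith
  refine ⟨u, ⟨hcont, fun a b ha hab hb => ?_⟩, hu0, hevi⟩
  have hsub : Icc a b ⊆ Icc 0 T := Icc_subset_Icc ha.le hb.le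
  have hcAU : ∀ n, ContinuousOn (fun t => -A n (U n t)) (Icc a b) := fun n =>
    ((hY n).lipschitz.continuous.comp_continuousOn ((hV n x).continuousOn.mono hsub)).neg
  obtain ⟨z, hz⟩ := hf.nonempty
  -- The variational inequality between `0` and `a` bounds the envelope at time `a` uniformly in
  -- `n`, and the dissipation after `a` is at most this value. The bound degenerates as `a → 0`,
  -- which is why the regularity is local.
  obtain ⟨v, hv, hvint⟩ := exists_memLp_integral_eq_of_tendsto (M := f z + ‖x - z‖ ^ 2 / (2 * a))
    hab.le (U := U) (W := fun n t => -A n (U n t)) (u := u) hcAU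
    (fun n => by
      simp only [norm_neg]
      refine ((hY n).integral_norm_sq_le hf (hV n x) ha.le hab.le hb.le).trans ?_
      have h1 := (hY n).evi (hV n x) hz le_rfl ha.le (hab.le.trans hb.le)
      rw [hV0, sub_zero] at h1
      have h2 : 0 ≤ ‖V n x a - z‖ ^ 2 := by positivity
      have h3 : envelope f (l n) (J n) (A n) (V n x a) - f z ≤ ‖x - z‖ ^ 2 / (2 * a) := by
        rw [le_div_iff₀ (by positivity)]
        linarith
      change envelope f (l n) (J n) (A n) (V n x a) ≤ _
      linarith)
    (fun n t ht => by
      have hsub' : Icc a t ⊆ Icc a b := Icc_subset_Icc_right ht.2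
      refine (intervalIntegral.integral_eq_sub_of_hasDerivAt_of_le ht.1
        ((hV n x).continuousOn.mono (hsub'.trans hsub)) (fun r hr => ?_) ?_).symm
      · exact (hV n x).hasDerivAt ⟨ha.trans hr.1, (hr.2.trans_le ht.2).trans hb⟩
      · exact ((hcAU n).mono hsub').intervalIntegrable_of_Icc ht.1)
    (fun t ht => hlim t (hsub ht))
  refine ⟨?_, v, hv, fun t ht => hvint t (Ioo_subset_Icc_self ht)⟩
  have hc' := hcont.mono hsub
  obtain ⟨C, hC⟩ := isCompact_Icc.exists_bound_of_continuousOn hc'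
  exact MemLp.of_bound (hc'.aestronglyMeasurable_of_isCompact isCompact_Icc measurableSet_Icc)
    C ((ae_restrict_iff' measurableSet_Icc).2 (Eventually.of_forall hC))

/-! ### Differentiability almost everywhere and uniqueness for regular curves. -/

/-- A regular curve is differentiable almost everywhere. -/
theorem FlowRegular.ae_hasDerivAt [CompleteSpace H] {T : ℝ} {u : ℝ → H} (h : FlowRegular T u) :
    ∀ᵐ t ∂(volume.restrict (Ioo 0 T)), ∃ u', HasDerivAt u u' t := by
  have key : ∀ a b : ℝ, 0 < a → a < b → b < T → ∀ᵐ t, t ∈ Ioo a b → ∃ u', HasDerivAt u u' t := by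
    intro a b ha hab hb
    obtain ⟨-, v, hv, hint⟩ := h.2 a b ha hab hb
    have hvi : IntervalIntegrable v volume a b :=
      (intervalIntegrable_iff_integrableOn_Icc_of_le hab.le).2 (hv.integrable (by norm_num))
    filter_upwards [hvi.ae_hasDerivAt_integral] with t ht htab
    have h1 := ht (by rw [uIcc_of_le hab.le]; exact Ioo_subset_Icc_self htab) a left_mem_uIcc
    refine ⟨v t, (h1.const_add (u a)).congr_of_eventuallyEq ?_⟩
    filter_upwards [Ioo_mem_nhds htab.1 htab.2] with s hs
    rw [← hint s hs]
    abel
  rw [ae_restrict_iff' measurableSet_Ioo]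
  -- Each compact subinterval has its own exceptional null set; rational endpoints leave only
  -- countably many.
  have hall : ∀ᵐ t, ∀ q r : ℚ, 0 < (q : ℝ) → (q : ℝ) < r → (r : ℝ) < T → t ∈ Ioo (q : ℝ) r →
      ∃ u', HasDerivAt u u' t := by
    refine ae_all_iff.2 fun q => ae_all_iff.2 fun r => ?_
    by_cases hq : 0 < (q : ℝ) ∧ (q : ℝ) < r ∧ (r : ℝ) < T
    · filter_upwards [key q r hq.1 hq.2.1 hq.2.2] with t ht _ _ _ using ht
    · exact Eventually.of_forall fun t h1 h2 h3 => absurd ⟨h1, h2, h3⟩ hq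
  filter_upwards [hall] with t ht htT
  obtain ⟨q, hq0, hqt⟩ := exists_rat_btwn htT.1
  obtain ⟨r, htr, hrT⟩ := exists_rat_btwn htT.2
  exact ht q r hq0 (hqt.trans htr) hrT ⟨hqt, htr⟩

/-- The sums over disjoint intervals for `φ` are at most `K` times those for `G`. It transfers
absolute continuity from a primitive of `‖u' - v'‖` to `‖u - v‖²`. -/
theorem absolutelyContinuousOnInterval_of_dist_le {Y Z : Type*} [PseudoMetricSpace Y]
    [PseudoMetricSpace Z] {φ : ℝ → Y} {G : ℝ → Z} {a b K : ℝ}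
    (hG : AbsolutelyContinuousOnInterval G a b)
    (hle : ∀ x ∈ uIcc a b, ∀ y ∈ uIcc a b, dist (φ x) (φ y) ≤ K * dist (G x) (G y)) :
    AbsolutelyContinuousOnInterval φ a b := by
  have h0 := Tendsto.const_mul K hG
  rw [mul_zero] at h0
  refine squeeze_zero' (Eventually.of_forall fun E => Finset.sum_nonneg fun _ _ => dist_nonneg) ?_
    h0
  have : ∀ᶠ E in AbsolutelyContinuousOnInterval.totalLengthFilter ⊓
      𝓟 (AbsolutelyContinuousOnInterval.disjWithin a b),
      E ∈ AbsolutelyContinuousOnInterval.disjWithin a b := eventually_inf_principal.2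
        (Eventually.of_forall fun _ h => h)
  filter_upwards [this] with E hE
  rw [Finset.mul_sum]
  refine Finset.sum_le_sum fun i hi => ?_
  have := hE.1 i hi
  exact hle _ this.1 _ this.2

/-- If `u` and `v` are regular curves, and `⟪u - v, u' - v'⟫ ≤ 0` almost everywhere, then they
coincide as soon as they have the same initial value. -/
theorem FlowRegular.eqOn {T : ℝ} {u v : ℝ → H} (hT : 0 < T)
    (hu : FlowRegular T u) (hv : FlowRegular T v) (h0 : u 0 = v 0)
    (h : ∀ᵐ t ∂(volume.restrict (Ioo 0 T)), ∃ u' v', HasDerivAt u u' t ∧ HasDerivAt v v' t ∧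
      ⟪u t - v t, u' - v'⟫ ≤ 0) : EqOn u v (Icc 0 T) := by
  have hcw : ContinuousOn (fun t => u t - v t) (Icc 0 T) := hu.1.sub hv.1
  have hmono : ∀ s t : ℝ, 0 < s → s < t → t < T → ‖u t - v t‖ ^ 2 ≤ ‖u s - v s‖ ^ 2 := by
    intro s t hs hst ht
    -- The primitive formula in `MemW12` is stated on an open interval, so `[s, t]` is placed
    -- strictly inside a larger interval that is still compactly contained in `(0, T)`.
    have ha : 0 < s / 2 := by linarith
    have hab : s / 2 < (t + T) / 2 := by linarith
    have hb : (t + T) / 2 < T := by linarith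
    obtain ⟨-, x, hx, hxint⟩ := hu.2 _ _ ha hab hb
    obtain ⟨-, y, hy, hyint⟩ := hv.2 _ _ ha hab hb
    have hsub : Icc s t ⊆ Ioo (s / 2) ((t + T) / 2) := fun r hr =>
      ⟨by linarith [hr.1], by linarith [hr.2]⟩
    have hxi : IntegrableOn x (Icc (s / 2) ((t + T) / 2)) := hx.integrable (by norm_num)
    have hyi : IntegrableOn y (Icc (s / 2) ((t + T) / 2)) := hy.integrable (by norm_num)
    have hii : ∀ {g : ℝ → H}, IntegrableOn g (Icc (s / 2) ((t + T) / 2)) → ∀ p ∈ Icc (s / 2)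
        ((t + T) / 2), ∀ q ∈ Icc (s / 2) ((t + T) / 2), IntervalIntegrable g volume p q := by
      intro g hg p hp q hq
      refine intervalIntegrable_iff.2 (hg.mono_set ?_)
      exact uIoc_subset_uIcc.trans (uIcc_subset_Icc hp hq)
    have hsI : s / 2 ∈ Icc (s / 2) ((t + T) / 2) := ⟨le_rfl, hab.le⟩
    have hdiff : ∀ p ∈ Icc s t, ∀ q ∈ Icc s t,
        (u q - v q) - (u p - v p) = ∫ r in p..q, (x r - y r) := by
      intro p hp q hq
      have hp' := Ioo_subset_Icc_self (hsub hp)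
      have hq' := Ioo_subset_Icc_self (hsub hq)
      rw [intervalIntegral.integral_sub (hii hxi p hp' q hq') (hii hyi p hp' q hq'),
        ← intervalIntegral.integral_interval_sub_left (hii hxi _ hsI q hq') (hii hxi _ hsI p hp'),
        ← intervalIntegral.integral_interval_sub_left (hii hyi _ hsI q hq') (hii hyi _ hsI p hp'),
        ← hxint q (hsub hq), ← hxint p (hsub hp), ← hyint q (hsub hq), ← hyint p (hsub hp)]
      abel
    have hni : ∀ p ∈ Icc s t, ∀ q ∈ Icc s t,
        IntervalIntegrable (fun r => ‖x r - y r‖) volume p q := fun p hp q hq =>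
      ((hii hxi p (Ioo_subset_Icc_self (hsub hp)) q (Ioo_subset_Icc_self (hsub hq))).sub
        (hii hyi p (Ioo_subset_Icc_self (hsub hp)) q (Ioo_subset_Icc_self (hsub hq)))).norm
    have hsI' : s ∈ Icc s t := ⟨le_rfl, hst.le⟩
    have hsubT : Icc s t ⊆ Icc 0 T := Icc_subset_Icc hs.le ht.le
    obtain ⟨C, hC⟩ := isCompact_Icc.exists_bound_of_continuousOn (hcw.mono hsubT)
    -- Factor the difference of squares: the sum of the norms is at most `2 * C`, and the difference
    -- is bounded by the integral of `‖x - y‖`. Absolute continuity of this scalar function is what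
    -- permits integrating its pointwise derivative.
    have hac : AbsolutelyContinuousOnInterval (fun r => ‖u r - v r‖ ^ 2) s t := by
      refine absolutelyContinuousOnInterval_of_dist_le (K := 2 * C)
        ((hni s hsI' t ⟨hst.le, le_rfl⟩).absolutelyContinuousOnInterval_intervalIntegral
          left_mem_uIcc) ?_
      rw [uIcc_of_le hst.le]
      intro p hp q hq
      rw [dist_comm, dist_comm (∫ r in s..p, _), Real.dist_eq, Real.dist_eq,
        intervalIntegral.integral_interval_sub_left (hni s hsI' q hq) (hni s hsI' p hp)]
      have h1 : ‖(u q - v q) - (u p - v p)‖ ≤ |∫ r in p..q, ‖x r - y r‖| := by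
        rw [hdiff p hp q hq]
        exact intervalIntegral.norm_integral_le_abs_integral_norm
      have h2 := abs_norm_sub_norm_le (u q - v q) (u p - v p)
      have h3 := hC p hp
      have h4 := hC q hq
      have e : ‖u q - v q‖ ^ 2 - ‖u p - v p‖ ^ 2 =
          (‖u q - v q‖ + ‖u p - v p‖) * (‖u q - v q‖ - ‖u p - v p‖) := by ring
      rw [e, abs_mul, abs_of_nonneg (by positivity)]
      exact mul_le_mul (by linarith) (h2.trans h1) (abs_nonneg _)
        (by linarith [norm_nonneg (u q - v q)])
    have hint := hac.integral_deriv_eq_sub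
    have hle : ∫ r in s..t, deriv (fun r => ‖u r - v r‖ ^ 2) r ≤ 0 := by
      rw [intervalIntegral.integral_of_le hst.le]
      refine integral_nonpos_of_ae ?_
      have hsub2 : Ioc s t ⊆ Ioo 0 T := fun r hr => ⟨hs.trans hr.1, hr.2.trans_lt ht⟩
      filter_upwards [ae_restrict_of_ae_restrict_of_subset hsub2 h] with r hr
      obtain ⟨u', v', hu', hv', hle⟩ := hr
      have hd := hasDerivAt_norm_sq (hu'.sub hv')
      have hd' : deriv (fun r => ‖u r - v r‖ ^ 2) r = 2 * ⟪u r - v r, u' - v'⟫ := hd.deriv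
      rw [hd']
      simp only [Pi.zero_apply]
      linarith
    rw [hint] at hle
    linarith
  have hIoo : EqOn u v (Ioo 0 T) := by
    intro t ht
    -- The monotonicity holds only between interior times; the initial value is reached by
    -- continuity at `0`.
    have hc0 : Tendsto (fun s => ‖u s - v s‖ ^ 2) (𝓝[>] 0) (𝓝 (‖u 0 - v 0‖ ^ 2)) :=
      (((hcw.norm.pow 2) 0 ⟨le_rfl, hT.le⟩).tendsto).mono_left
        (nhdsWithin_le_of_mem (mem_of_superset (Ioo_mem_nhdsGT hT) Ioo_subset_Icc_self))
    have h1 : ‖u t - v t‖ ^ 2 ≤ ‖u 0 - v 0‖ ^ 2 := by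
      refine ge_of_tendsto hc0 ?_
      filter_upwards [Ioo_mem_nhdsGT ht.1] with s hs using hmono s t hs.1 hs.2 ht.2
    rw [h0, sub_self, norm_zero] at h1
    have h2 : ‖u t - v t‖ = 0 := by nlinarith [norm_nonneg (u t - v t)]
    exact sub_eq_zero.1 (norm_eq_zero.1 h2)
  exact hIoo.of_subset_closure hu.1 hv.1 Ioo_subset_Icc_self (by rw [closure_Ioo hT.ne])

end GradientFlow

/-! ### Curves -/

section Curves

variable {X : Type*} [MetricSpace X]

theorem Curve.dist_le (γ : Curve X) {s t : ℝ} (hs : s ∈ Icc 0 γ.len) (ht : t ∈ Icc 0 γ.len)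
    (hst : s ≤ t) : dist (γ.toFun s) (γ.toFun t) ≤ t - s := by
  have h1 : edist (γ.toFun s) (γ.toFun t) ≤ eVariationOn γ.toFun (Icc 0 γ.len ∩ Icc s t) :=
    eVariationOn.edist_le _ ⟨hs, le_rfl, hst⟩ ⟨ht, hst, le_rfl⟩
  rw [γ.unitSpeed hs ht, NNReal.coe_one, one_mul, edist_dist,
    ENNReal.ofReal_le_ofReal_iff (sub_nonneg.2 hst)] at h1
  exact h1

theorem Curve.lipschitzOnWith (γ : Curve X) : LipschitzOnWith 1 γ.toFun (Icc 0 γ.len) := by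
  refine LipschitzOnWith.of_dist_le_mul fun s hs t ht => ?_
  rw [NNReal.coe_one, one_mul]
  rcases le_total s t with h | h
  · rw [dist_comm s t, Real.dist_eq, abs_of_nonneg (sub_nonneg.2 h)]
    exact γ.dist_le hs ht h
  · rw [dist_comm, Real.dist_eq, abs_of_nonneg (sub_nonneg.2 h)]
    exact γ.dist_le ht hs h

/-- The restriction of a curve to `[s, t]`. -/
def Curve.sub (γ : Curve X) {s t : ℝ} (hs : 0 ≤ s) (hst : s ≤ t) (ht : t ≤ γ.len) : Curve X where
  len := t - s
  len_nonneg := sub_nonneg.2 hst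
  toFun := γ.toFun ∘ fun r => s + r
  unitSpeed := by
    refine hasConstantSpeedOnWith_iff_ordered.2 fun x hx y hy hxy => ?_
    have hsub : Icc x y ⊆ Icc 0 (t - s) := Icc_subset_Icc hx.1 hy.2
    have hx' : s + x ∈ Icc 0 γ.len := ⟨by linarith [hx.1], by linarith [hx.2]⟩
    have hy' : s + y ∈ Icc 0 γ.len := ⟨by linarith [hy.1], by linarith [hy.2]⟩
    have h1 := γ.unitSpeed hx' hy'
    rw [inter_eq_right.2 (Icc_subset_Icc hx'.1 hy'.2)] at h1
    rw [inter_eq_right.2 hsub, eVariationOn.comp_eq_of_monotoneOn _ _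
      (fun a _ b _ hab => by simpa using hab), image_const_add_Icc, h1]
    congr 2
    ring

theorem Curve.integral_sub (γ : Curve X) {s t : ℝ} (hs : 0 ≤ s) (hst : s ≤ t) (ht : t ≤ γ.len)
    (g : X → ℝ≥0∞) : (γ.sub hs hst ht).integral g = ∫⁻ r in Icc s t, g (γ.toFun r) := by
  have h := lintegral_add_left_eq_self (μ := volume)
    ((Icc s t).indicator fun r => g (γ.toFun r)) s
  rw [lintegral_indicator measurableSet_Icc] at h
  rw [← h, Curve.integral, ← lintegral_indicator measurableSet_Icc]
  refine lintegral_congr fun r => ?_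
  have : r ∈ Icc 0 (γ.sub hs hst ht).len ↔ s + r ∈ Icc s t := by
    simp only [Curve.sub, mem_Icc]
    constructor <;> rintro ⟨h1, h2⟩ <;> constructor <;> linarith
  by_cases hr : s + r ∈ Icc s t
  · rw [indicator_of_mem hr, indicator_of_mem (this.2 hr)]
    rfl
  · rw [indicator_of_notMem hr, indicator_of_notMem fun h' => hr (this.1 h')]

/-! ### Upper gradients along arcs, and exceptional families of curves. -/

variable [MeasurableSpace X]

/-- An arc of a curve is again a curve parametrised by arc length. Thus where `g` is integrable
along `γ`, the oscillation of `u ∘ γ` over short arcs is small. -/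
theorem IsUpperGradient.le_integral {u : X → ℝ} {g : X → ℝ≥0∞} (h : IsUpperGradient u g)
    (γ : Curve X) {s t : ℝ} (hs : s ∈ Icc 0 γ.len) (ht : t ∈ Icc 0 γ.len) :
    ENNReal.ofReal |u (γ.toFun t) - u (γ.toFun s)| ≤ ∫⁻ r in uIcc s t, g (γ.toFun r) := by
  rcases le_total s t with hst | hst
  · have h1 := h.2 (γ.sub hs.1 hst ht.2)
    rw [UpperGradientIneq, γ.integral_sub] at h1
    simpa [Curve.sub, uIcc_of_le hst] using h1
  · have h1 := h.2 (γ.sub ht.1 hst hs.2)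
    rw [UpperGradientIneq, γ.integral_sub] at h1
    rw [abs_sub_comm]
    simpa [Curve.sub, uIcc_of_ge hst] using h1

/-- For these curves every multiple `g / n` is still admissible, while its energy is scaled by
`n⁻ᵖ`. -/
theorem modulus_integral_eq_top {ν : Measure X} {p : ℝ} (hp : 1 < p) {g : X → ℝ≥0∞}
    (hg : Measurable g) (hgp : ∫⁻ x, g x ^ p ∂ν < ∞) :
    modulus ν p {γ : Curve X | γ.integral g = ∞} = 0 := by
  have hp0 : 0 < p := zero_lt_one.trans hp
  have key : ∀ n : ℕ, modulus ν p {γ : Curve X | γ.integral g = ∞} ≤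
      ((n : ℝ≥0∞)⁻¹) ^ p * ∫⁻ x, g x ^ p ∂ν := by
    intro n
    -- For `n = 0` the inverse is `∞`: the bound is trivial unless `g` has zero energy, and then `g`
    -- itself is admissible.
    rcases n.eq_zero_or_pos with rfl | hn
    · rcases eq_or_ne (∫⁻ x, g x ^ p ∂ν) 0 with h0 | h0
      · refine iInf_le_of_le g (iInf_le_of_le hg (iInf_le_of_le (fun γ hγ => ?_) ?_))
        · exact le_top.trans_eq (show γ.integral g = ∞ from hγ).symm
        · rw [h0]; exact zero_le
      · simp [ENNReal.top_rpow_of_pos hp0, ENNReal.top_mul h0]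
    have hc0 : ((n : ℝ≥0∞)⁻¹) ≠ 0 := by simp
    have hct : ((n : ℝ≥0∞)⁻¹) ≠ ∞ := by simp [hn.ne']
    refine iInf_le_of_le (fun x => (n : ℝ≥0∞)⁻¹ * g x) (iInf_le_of_le (hg.const_mul _)
      (iInf_le_of_le (fun γ hγ => ?_) ?_))
    · rw [Curve.integral, lintegral_const_mul' _ _ hct]
      have : ∫⁻ t in Icc 0 γ.len, g (γ.toFun t) = ∞ := hγ
      rw [this, ENNReal.mul_top hc0]
      exact le_top
    · simp only [ENNReal.mul_rpow_of_nonneg _ _ hp0.le]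
      rw [lintegral_const_mul' _ _ (ENNReal.rpow_ne_top_of_nonneg hp0.le hct)]
  have hlim : Tendsto (fun n : ℕ => ((n : ℝ≥0∞)⁻¹) ^ p * ∫⁻ x, g x ^ p ∂ν) atTop (𝓝 0) := by
    have h1 := ((ENNReal.continuous_rpow_const (y := p)).tendsto 0).comp
      ENNReal.tendsto_inv_nat_nhds_zero
    rw [ENNReal.zero_rpow_of_pos hp0] at h1
    have h2 := ENNReal.Tendsto.mul_const (b := ∫⁻ x, g x ^ p ∂ν) h1 (Or.inr hgp.ne)
    simpa [Function.comp_def] using h2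
  exact le_antisymm (ge_of_tendsto' hlim key) zero_le

/-- A nonempty relatively open subset of `[0, l]` meets `(0, l)` in a set of positive length, so it
cannot avoid a set of full measure. -/
theorem frequently_of_ae_restrict_Icc {l : ℝ} (hl : 0 < l) {P : ℝ → Prop}
    (hP : ∀ᵐ r ∂(volume.restrict (Icc 0 l)), P r) {t : ℝ} (ht : t ∈ Icc 0 l) :
    ∃ᶠ r in 𝓝[Icc 0 l] t, P r := by
  intro hev
  obtain ⟨V, hV, htV, hsub⟩ := mem_nhdsWithin.1 hev
  have hne : (V ∩ Ioo 0 l).Nonempty := by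
    rw [← closure_Ioo hl.ne] at ht
    exact mem_closure_iff.1 ht V hV htV
  have hpos := (hV.inter isOpen_Ioo).measure_pos volume hne
  refine hpos.ne' (measure_mono_null ?_ ((ae_restrict_iff' measurableSet_Icc).1 hP))
  rintro r ⟨hrV, hr⟩ hc
  exact hsub ⟨hrV, Ioo_subset_Icc_self hr⟩ (hc (Ioo_subset_Icc_self hr))

/-- A function with an upper gradient in `L^p` which vanishes almost everywhere has the zero
function as a weak upper gradient. -/
theorem IsUpperGradient.isWeakUpperGradient_zero [BorelSpace X] {ν : Measure X} {p : ℝ}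
    (hp : 1 < p) {u : X → ℝ} (hu : Measurable u) {g : X → ℝ≥0∞} (hg : IsUpperGradient u g)
    (hgp : ∫⁻ x, g x ^ p ∂ν < ∞) (h0 : u =ᵐ[ν] 0) :
    IsWeakUpperGradient ν p u fun _ => 0 := by
  classical
  have hp0 : 0 < p := zero_lt_one.trans hp
  -- `ρ` has zero energy because `{u ≠ 0}` is null, but infinite integral along any curve that
  -- spends positive time there. So `p`-almost every curve spends no time in `{u ≠ 0}`.
  set ρ : X → ℝ≥0∞ := {x | u x ≠ 0}.indicator fun _ => ∞ with hρ
  have hρm : Measurable ρ := measurable_const.indicator (hu (measurableSet_singleton 0).compl)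
  have hmod : modulus ν p {γ : Curve X | 1 ≤ γ.integral ρ} = 0 := by
    refine le_antisymm (iInf_le_of_le ρ (iInf_le_of_le hρm (iInf_le_of_le (fun γ hγ => hγ) ?_)))
      zero_le
    refine le_of_eq ((lintegral_congr_ae ?_).trans lintegral_zero)
    filter_upwards [h0] with x hx
    have : ρ x = 0 := indicator_of_notMem (by simpa using hx) _
    rw [this, ENNReal.zero_rpow_of_pos hp0]
  refine ⟨measurable_const, le_antisymm ?_ zero_le⟩
  refine (modulus_mono ν p ?_).trans
    (modulus_union_eq_zero hp (modulus_integral_eq_top hp hg.1 hgp) hmod).le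
  intro γ hγ
  by_contra hc
  simp only [mem_union, mem_ofPred_eq, not_or, not_le] at hc
  obtain ⟨hfin, hlt⟩ := hc
  refine hγ ?_
  rcases γ.len_nonneg.eq_or_lt with hl | hl
  · simp [UpperGradientIneq, ← hl]
  have hae : ∀ᵐ r ∂(volume.restrict (Icc 0 γ.len)), u (γ.toFun r) = 0 := by
    have hm : AEMeasurable (fun r => ρ (γ.toFun r)) (volume.restrict (Icc 0 γ.len)) :=
      hρm.comp_aemeasurable (γ.lipschitzOnWith.continuousOn.aemeasurable measurableSet_Icc)
    filter_upwards [ae_lt_top' hm (hlt.trans ENNReal.one_lt_top).ne] with r hr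
    by_contra hne
    have : ρ (γ.toFun r) = ∞ := indicator_of_mem (show γ.toFun r ∈ {x | u x ≠ 0} from hne) _
    exact hr.ne this
  have hzero : ∀ t ∈ Icc 0 γ.len, u (γ.toFun t) = 0 := by
    intro t ht
    have hfreq := frequently_of_ae_restrict_Icc hl hae ht
    -- Zeros of `u ∘ γ` accumulate at `t`, and the integral of `g` over the arcs from them to `t`
    -- tends to zero; hence `u (γ t) = 0` at every `t`, endpoints included.
    have hvol : Tendsto (fun r => volume.restrict (Icc 0 γ.len) (uIcc r t))
        (𝓝[Icc 0 γ.len] t) (𝓝 0) := by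
      have h1 : Tendsto (fun r => ENNReal.ofReal |t - r|) (𝓝[Icc 0 γ.len] t) (𝓝 0) := by
        have : Continuous fun r : ℝ => ENNReal.ofReal |t - r| :=
          ENNReal.continuous_ofReal.comp (by fun_prop)
        have := this.tendsto t
        simp only [sub_self, abs_zero, ENNReal.ofReal_zero] at this
        exact this.mono_left nhdsWithin_le_nhds
      refine tendsto_of_tendsto_of_tendsto_of_le_of_le tendsto_const_nhds h1 (fun _ => zero_le)
        fun r => ?_
      refine (Measure.restrict_apply_le _ _).trans ?_
      rw [Real.volume_interval]
    have hint := tendsto_setLIntegral_zero (μ := volume.restrict (Icc 0 γ.len))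
      (f := fun r => g (γ.toFun r)) hfin hvol
    have hle : ENNReal.ofReal |u (γ.toFun t)| ≤ 0 := by
      refine ge_of_tendsto_of_frequently hint ?_
      have hIcc : ∀ᶠ r in 𝓝[Icc 0 γ.len] t, r ∈ Icc 0 γ.len := self_mem_nhdsWithin
      refine (hfreq.and_eventually hIcc).mono fun r hr => ?_
      have h1 := hg.le_integral γ hr.2 ht
      rw [hr.1, sub_zero] at h1
      rwa [Measure.restrict_restrict measurableSet_uIcc,
        inter_eq_left.2 (uIcc_subset_Icc hr.2 ht)]
    have := ENNReal.ofReal_eq_zero.1 (le_antisymm hle zero_le)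
    exact abs_eq_zero.1 (le_antisymm this (abs_nonneg _))
  simp [UpperGradientIneq, hzero γ.len ⟨hl.le, le_rfl⟩, hzero 0 ⟨le_rfl, hl.le⟩]

/-! ### Lipschitz cut-offs in the Dirichlet class. -/

/-- A Lipschitz function which vanishes outside a Borel set `B` has the upper gradient `K 1_B`. -/
theorem isUpperGradient_indicator [BorelSpace X] {φ : X → ℝ} {K : ℝ≥0} (hφ : LipschitzWith K φ)
    {B : Set X} (hB : MeasurableSet B) (h0 : ∀ x ∉ B, φ x = 0) :
    IsUpperGradient φ (B.indicator fun _ => (K : ℝ≥0∞)) := by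
  refine ⟨measurable_const.indicator hB, fun γ => ?_⟩
  set l := γ.len with hl
  have hl0 : 0 ≤ l := γ.len_nonneg
  set F : ℝ → ℝ := fun t => φ (γ.toFun t) with hF
  have hlip : ∀ s ∈ Icc 0 l, ∀ t ∈ Icc 0 l, |F t - F s| ≤ K * |t - s| := by
    intro s hs t ht
    have h1 := hφ.dist_le_mul (γ.toFun t) (γ.toFun s)
    have h2 := γ.lipschitzOnWith.dist_le_mul t ht s hs
    rw [NNReal.coe_one, one_mul] at h2
    exact h1.trans (mul_le_mul_of_nonneg_left h2 K.2)
  have hcont : ContinuousOn F (Icc 0 l) :=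
    hφ.continuous.comp_continuousOn γ.lipschitzOnWith.continuousOn
  have hint : ∀ s t, 0 ≤ s → t ≤ l → (∀ r ∈ Ioo s t, γ.toFun r ∈ B) →
      ENNReal.ofReal (K * (t - s)) ≤ ∫⁻ r in Ioo s t, B.indicator (fun _ => (K : ℝ≥0∞))
        (γ.toFun r) := by
    intro s t _ _ hr
    rw [setLIntegral_congr_fun measurableSet_Ioo
      (fun r hr' => indicator_of_mem (hr r hr') fun _ => (K : ℝ≥0∞)), setLIntegral_const,
      Real.volume_Ioo, ENNReal.ofReal_mul NNReal.zero_le_coe, ENNReal.ofReal_coe_nnreal]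
  rw [UpperGradientIneq, Curve.integral, ← hl]
  -- Only the arcs before the infimum and after the supremum of `S` matter: both lie in `B`, and `φ
  -- ∘ γ` vanishes at the two times by continuity even if they are not in `S`.
  set S : Set ℝ := {t | t ∈ Icc 0 l ∧ γ.toFun t ∉ B} with hS
  rcases S.eq_empty_or_nonempty with hSe | hSne
  · have hall : ∀ r ∈ Icc 0 l, γ.toFun r ∈ B := fun r hr => by
      by_contra hc
      have : r ∈ S := ⟨hr, hc⟩
      rw [hSe] at this
      exact this
    have h1 := hlip 0 ⟨le_rfl, hl0⟩ l ⟨hl0, le_rfl⟩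
    rw [sub_zero, abs_of_nonneg hl0] at h1
    have h2 := hint 0 l le_rfl le_rfl fun r hr => hall r (Ioo_subset_Icc_self hr)
    rw [sub_zero] at h2
    exact ((ENNReal.ofReal_le_ofReal h1).trans h2).trans
      (lintegral_mono_set Ioo_subset_Icc_self)
  · have hSsub : S ⊆ Icc 0 l := fun t ht => ht.1
    have hFS : ∀ t ∈ closure S, t ∈ Icc 0 l ∧ F t = 0 := by
      intro t ht
      have htI : t ∈ Icc 0 l := closure_minimal hSsub isClosed_Icc ht
      have hz : ∀ s ∈ S, F s = 0 := fun s hs => h0 _ hs.2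
      refine ⟨htI, ?_⟩
      have : EqOn F (fun _ => (0 : ℝ)) (closure S) :=
        EqOn.of_subset_closure (s := S) hz
          (hcont.mono (closure_minimal hSsub isClosed_Icc)) continuousOn_const subset_closure le_rfl
      exact this ht
    have hbb : BddBelow S := ⟨0, fun t ht => ht.1.1⟩
    have hba : BddAbove S := ⟨l, fun t ht => ht.1.2⟩
    obtain ⟨h1I, h1z⟩ := hFS _ (csInf_mem_closure hSne hbb)
    obtain ⟨h2I, h2z⟩ := hFS _ (csSup_mem_closure hSne hba)
    set t₁ := sInf S with ht₁
    set t₂ := sSup S with ht₂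
    have h12 : t₁ ≤ t₂ := csInf_le_csSup hSne hbb hba
    have hb1 : ∀ r ∈ Ioo 0 t₁, γ.toFun r ∈ B := fun r hr => by
      by_contra hc
      exact hr.2.not_ge (csInf_le hbb ⟨⟨hr.1.le, hr.2.le.trans h1I.2⟩, hc⟩)
    have hb2 : ∀ r ∈ Ioo t₂ l, γ.toFun r ∈ B := fun r hr => by
      by_contra hc
      exact hr.1.not_ge (le_csSup hba ⟨⟨h2I.1.trans hr.1.le, hr.2.le⟩, hc⟩)
    have e1 := hlip 0 ⟨le_rfl, hl0⟩ t₁ h1I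
    have e2 := hlip t₂ h2I l ⟨hl0, le_rfl⟩
    rw [h1z, zero_sub, abs_neg, sub_zero, abs_of_nonneg h1I.1] at e1
    rw [h2z, sub_zero, abs_of_nonneg (sub_nonneg.2 h2I.2)] at e2
    have i1 := hint 0 t₁ le_rfl h1I.2 hb1
    have i2 := hint t₂ l h2I.1 le_rfl hb2
    rw [sub_zero] at i1
    have hK : (0 : ℝ) ≤ K := K.2
    have h3 : |F l - F 0| ≤ K * t₁ + K * (l - t₂) := by
      have := abs_sub (F l) (F 0)
      linarith
    have hdisj : Disjoint (Ioo 0 t₁) (Ioo t₂ l) := by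
      rw [Set.disjoint_left]
      intro r hr hr'
      linarith [hr.2, hr'.1]
    calc ENNReal.ofReal |F l - F 0| ≤ ENNReal.ofReal (K * t₁ + K * (l - t₂)) :=
          ENNReal.ofReal_le_ofReal h3
      _ = ENNReal.ofReal (K * t₁) + ENNReal.ofReal (K * (l - t₂)) :=
          ENNReal.ofReal_add (mul_nonneg hK h1I.1) (mul_nonneg hK (sub_nonneg.2 h2I.2))
      _ ≤ _ := add_le_add i1 i2
      _ = ∫⁻ r in Ioo 0 t₁ ∪ Ioo t₂ l, B.indicator (fun _ => (K : ℝ≥0∞)) (γ.toFun r) :=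
          (lintegral_union measurableSet_Ioo hdisj).symm
      _ ≤ _ := lintegral_mono_set (union_subset
          (Ioo_subset_Icc_self.trans (Icc_subset_Icc_right h1I.2))
          (Ioo_subset_Icc_self.trans (Icc_subset_Icc_left h2I.1)))

theorem mem_dirichletClass_of_lipschitzWith [BorelSpace X] {ν : Measure X} {p : ℝ}
    [hp : Fact (1 < p)] {φ : X → ℝ} {K : ℝ≥0} (hφ : LipschitzWith K φ) {B : Set X}
    (hB : MeasurableSet B) (hνB : ν B < ∞) (h0 : ∀ x ∉ B, φ x = 0) : φ ∈ dirichletClass ν p := by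
  have hp0 : 0 < p := zero_lt_one.trans hp.out
  refine ⟨hφ.continuous.measurable, _, isUpperGradient_indicator hφ hB h0, ?_⟩
  have e : ∀ x, B.indicator (fun _ => (K : ℝ≥0∞)) x ^ p =
      B.indicator (fun _ => (K : ℝ≥0∞) ^ p) x := fun x => by
    by_cases hx : x ∈ B
    · simp [hx]
    · simp [hx, ENNReal.zero_rpow_of_pos hp0]
  simp only [e]
  rw [lintegral_indicator hB, setLIntegral_const]
  exact ENNReal.mul_lt_top (ENNReal.rpow_lt_top_of_nonneg hp0.le ENNReal.coe_ne_top) hνB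

end Curves

/-! ### The differential on Sobolev classes -/

section SobolevClasses

variable {X : Type*} [MetricSpace X] [MeasurableSpace X] {ν : Measure X} {p : ℝ} [hp : Fact (1 < p)]

theorem differential_add (f g : dirichletClass ν p) :
    differential (f + g) = differential f + differential g := by
  unfold differential
  rw [← UniformSpace.Completion.coe_add]
  rfl

theorem differential_smul (c : ℝ) (f : dirichletClass ν p) :
    differential (c • f) = c • differential f := by
  unfold differential
  rw [← UniformSpace.Completion.coe_smul]
  rfl

/-- The zero function is a weak upper gradient of `f`, so the minimal one vanishes. This is what
makes `du` a function of the `L²` class. -/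
theorem differential_eq_zero [BorelSpace X] {f : dirichletClass ν p} (h : f.1 =ᵐ[ν] 0) :
    differential f = 0 := by
  have hp0 : 0 < p := zero_lt_one.trans hp.out
  obtain ⟨hm, g, hg, hgp⟩ := f.2
  have h1 := (isMinGradient f).2.1 _ (hg.isWeakUpperGradient_zero hp.out hm hgp h)
    (by simp [ENNReal.zero_rpow_of_pos hp0])
  rw [← norm_eq_zero, differential, UniformSpace.Completion.norm_coe, PreCotangent.norm_def,
    PreCotangent.enorm]
  have h2 : ∀ᵐ x ∂ν, minGradient f x ^ p = 0 := by
    filter_upwards [h1] with x hx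
    rw [le_antisymm hx zero_le, ENNReal.zero_rpow_of_pos hp0]
  have h3 : ∫⁻ x, minGradient f x ^ p ∂ν = 0 := (lintegral_congr_ae h2).trans lintegral_zero
  have e : ∀ s : PreCotangent ν p, s.fn = (fun _ => f) →
      ∫⁻ x, s.grad x ^ p ∂ν = ∫⁻ x, minGradient f x ^ p ∂ν := fun s hs => by
    simp only [PreCotangent.grad, hs]
  rw [e _ rfl, h3, ENNReal.zero_rpow_of_pos (by positivity), ENNReal.toReal_zero]

theorem differential_congr [BorelSpace X] {f g : dirichletClass ν p} (h : f.1 =ᵐ[ν] g.1) :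
    differential f = differential g := by
  have h1 : differential (f + (-1 : ℝ) • g) = 0 := differential_eq_zero (by
    filter_upwards [h] with x hx
    simp [hx])
  rw [differential_add, differential_smul, neg_one_smul] at h1
  exact add_neg_eq_zero.1 h1

theorem MemW1.d_eq [BorelSpace X] {u : Lp ℝ 2 ν} (h : MemW1 p u) {f : dirichletClass ν p}
    (hf : f.1 =ᵐ[ν] u) : h.d = differential f :=
  differential_congr (h.choose_spec.2.trans hf.symm)

theorem MemW1.exists_rep [BorelSpace X] {u : Lp ℝ 2 ν} (h : MemW1 p u) :
    ∃ f : dirichletClass ν p, MemLp f.1 (ENNReal.ofReal p) ν ∧ f.1 =ᵐ[ν] u ∧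
      h.d = differential f :=
  ⟨h.choose, h.choose_spec.1, h.choose_spec.2, rfl⟩

theorem MemW1.add {u v : Lp ℝ 2 ν} (hu : MemW1 p u) (hv : MemW1 p v) : MemW1 p (u + v) := by
  obtain ⟨f, hf, hfu⟩ := hu
  obtain ⟨g, hg, hgv⟩ := hv
  refine ⟨f + g, hf.add hg, ?_⟩
  filter_upwards [hfu, hgv, Lp.coeFn_add u v] with x h1 h2 h3
  rw [h3, Pi.add_apply, ← h1, ← h2]
  rfl

theorem MemW1.smul (c : ℝ) {u : Lp ℝ 2 ν} (hu : MemW1 p u) : MemW1 p (c • u) := by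
  obtain ⟨f, hf, hfu⟩ := hu
  refine ⟨c • f, hf.const_smul c, ?_⟩
  filter_upwards [hfu, Lp.coeFn_smul c u] with x h1 h2
  rw [h2, Pi.smul_apply, ← h1]
  rfl

theorem MemW1.d_add [BorelSpace X] {u v : Lp ℝ 2 ν} (hu : MemW1 p u) (hv : MemW1 p v) :
    (hu.add hv).d = hu.d + hv.d := by
  obtain ⟨f, -, hfu, hf⟩ := hu.exists_rep
  obtain ⟨g, -, hgv, hg⟩ := hv.exists_rep
  rw [hf, hg, ← differential_add]
  refine MemW1.d_eq _ ?_
  filter_upwards [hfu, hgv, Lp.coeFn_add u v] with x h1 h2 h3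
  rw [h3, Pi.add_apply, ← h1, ← h2]
  rfl

theorem MemW1.d_smul [BorelSpace X] (c : ℝ) {u : Lp ℝ 2 ν} (hu : MemW1 p u) :
    (hu.smul c).d = c • hu.d := by
  obtain ⟨f, -, hfu, hf⟩ := hu.exists_rep
  rw [hf, ← differential_smul]
  refine MemW1.d_eq _ ?_
  filter_upwards [hfu, Lp.coeFn_smul c u] with x h1 h2
  rw [h2, Pi.smul_apply, ← h1]
  rfl

theorem memW1_zero : MemW1 p (0 : Lp ℝ 2 ν) :=
  ⟨0, MemLp.zero, (Lp.coeFn_zero ℝ 2 ν).symm⟩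

/-- The subspace `W^{1,p}(X, d, ν) ∩ L²(X, ν)` of `L²(X, ν)`. -/
def sobolevSubmodule (ν : Measure X) (p : ℝ) [Fact (1 < p)] : Submodule ℝ (Lp ℝ 2 ν) where
  carrier := {u | MemW1 p u}
  add_mem' := MemW1.add
  zero_mem' := memW1_zero
  smul_mem' c _ := MemW1.smul c

/-- The differential as a linear map on `W^{1,p}(X, d, ν) ∩ L²(X, ν)`. -/
noncomputable def sobolevDifferential [BorelSpace X] (ν : Measure X) (p : ℝ) [Fact (1 < p)] :
    sobolevSubmodule ν p →ₗ[ℝ] Cotangent ν p where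
  toFun u := MemW1.d u.2
  map_add' u v := MemW1.d_add u.2 v.2
  map_smul' c u := MemW1.d_smul c u.2

theorem sobolevDifferential_apply [BorelSpace X] {u : Lp ℝ 2 ν} (h : MemW1 p u) :
    sobolevDifferential ν p ⟨u, h⟩ = h.d := rfl

/-- A bounded function which vanishes outside a set of finite measure is in `L^q`. -/
theorem memLp_of_bounded_of_support {φ : X → ℝ} (hm : Measurable φ) {B : Set X}
    (hB : MeasurableSet B) (hνB : ν B < ∞) (h0 : ∀ x ∉ B, φ x = 0) {C : ℝ} (hC : ∀ x, ‖φ x‖ ≤ C)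
    (q : ℝ≥0∞) : MemLp φ q ν := by
  have : IsFiniteMeasure (ν.restrict B) := ⟨by simpa using hνB⟩
  have h1 : MemLp φ q (ν.restrict B) :=
    MemLp.of_bound hm.aestronglyMeasurable C (Eventually.of_forall hC)
  rw [← memLp_indicator_iff_restrict hB] at h1
  have e : B.indicator φ = φ := indicator_eq_self.2 fun x hx => by
    by_contra hc
    exact hx (h0 x hc)
  rwa [e] at h1

/-- For closed `K` these Lipschitz cut-offs converge to the indicator of `K` as `δ → 0`; they are
the test functions behind density in `L²`. -/
theorem thickenedIndicator_memW1 [BorelSpace X] {K : Set X} {δ : ℝ} (hδ : 0 < δ)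
    (hK : ν (Metric.thickening δ K) < ∞) :
    ∃ f : dirichletClass ν p, MemLp f.1 (ENNReal.ofReal p) ν ∧ MemLp f.1 2 ν ∧
      ∀ x, f.1 x = (thickenedIndicator hδ K x : ℝ) := by
  set φ : X → ℝ := fun x => (thickenedIndicator hδ K x : ℝ) with hφ
  have hlip : LipschitzWith δ.toNNReal⁻¹ φ := lipschitzWith_thickenedIndicator hδ K
  have hB : MeasurableSet (Metric.thickening δ K) := Metric.isOpen_thickening.measurableSet
  have h0 : ∀ x ∉ Metric.thickening δ K, φ x = 0 := fun x hx => by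
    simp only [hφ, thickenedIndicator_zero hδ K hx, NNReal.coe_zero]
  have hC : ∀ x, ‖φ x‖ ≤ 1 := fun x => by
    rw [Real.norm_of_nonneg (NNReal.coe_nonneg _)]
    exact_mod_cast thickenedIndicator_le_one hδ K x
  exact ⟨⟨φ, mem_dirichletClass_of_lipschitzWith hlip hB hK h0⟩,
    memLp_of_bounded_of_support hlip.continuous.measurable hB hK h0 hC _,
    memLp_of_bounded_of_support hlip.continuous.measurable hB hK h0 hC _, fun _ => rfl⟩

/-- `W^{1,p}(X, d, ν) ∩ L²(X, ν)` is dense in `L²(X, ν)`. -/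
theorem dense_sobolevSubmodule [BorelSpace X]
    (hν : ∀ s : Set X, Bornology.IsBounded s → ν s < ∞) :
    Dense (sobolevSubmodule ν p : Set (Lp ℝ 2 ν)) := by
  rw [Submodule.dense_iff_topologicalClosure_eq_top, Submodule.topologicalClosure_eq_top_iff,
    Submodule.eq_bot_iff]
  intro h hh
  have hmem := Lp.memLp h
  have hIon : ∀ B : Set X, MeasurableSet B → ν B < ∞ → IntegrableOn h B ν := fun B hB hνB => by
    have : IsFiniteMeasure (ν.restrict B) := ⟨by simpa using hνB⟩
    exact (hmem.restrict B).integrable (by norm_num)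
  -- An `h` orthogonal to all Sobolev classes is tested with the cut-offs of `K`. Dominated
  -- convergence applies because `h` is integrable on the `1`-thickening, which has finite measure.
  have hclosed : ∀ K : Set X, IsClosed K → Bornology.IsBounded K → ∫ x in K, h x ∂ν = 0 := by
    intro K hKc hKb
    set δ : ℕ → ℝ := fun n => 1 / ((n : ℝ) + 1) with hδ
    have hδ0 : ∀ n, 0 < δ n := fun n => Nat.one_div_pos_of_nat
    have hδ1 : ∀ n, δ n ≤ 1 := fun n => by
      simp only [hδ]
      rw [div_le_one (by positivity)]
      linarith [n.cast_nonneg (α := ℝ)]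
    have hδlim : Tendsto δ atTop (𝓝 0) := tendsto_one_div_add_atTop_nhds_zero_nat
    have hfin : ∀ r : ℝ, ν (Metric.thickening r K) < ∞ := fun r => hν _ hKb.thickening
    have hzero : ∀ n, ∫ x, h x * (thickenedIndicator (hδ0 n) K x : ℝ) ∂ν = 0 := by
      intro n
      obtain ⟨f, hfp, hf2, hf⟩ := thickenedIndicator_memW1 (p := p) (hδ0 n) (hfin (δ n))
      have hW : MemW1 p (hf2.toLp f.1) := ⟨f, hfp, hf2.coeFn_toLp.symm⟩
      have h1 := (Submodule.mem_orthogonal _ _).1 hh _ hW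
      rw [L2.inner_def] at h1
      rw [← h1]
      refine integral_congr_ae ?_
      filter_upwards [hf2.coeFn_toLp] with x hx
      rw [hx, hf]
      simp
    have hlim : Tendsto (fun n => ∫ x, h x * (thickenedIndicator (hδ0 n) K x : ℝ) ∂ν) atTop
        (𝓝 (∫ x, h x * ((K.indicator (fun _ => (1 : ℝ≥0)) x : ℝ≥0) : ℝ) ∂ν)) := by
      have hB : MeasurableSet (Metric.thickening 1 K) := Metric.isOpen_thickening.measurableSet
      refine tendsto_integral_of_dominated_convergence
        ((Metric.thickening 1 K).indicator fun x => ‖h x‖) (fun n => ?_) ?_ (fun n => ?_) ?_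
      · exact (Lp.aestronglyMeasurable h).mul
          ((lipschitzWith_thickenedIndicator (hδ0 n) K).continuous.measurable.coe_nnreal_real
            |>.aestronglyMeasurable)
      · exact (integrable_indicator_iff hB).2 (hIon _ hB (hfin 1)).norm
      · refine Eventually.of_forall fun x => ?_
        by_cases hx : x ∈ Metric.thickening 1 K
        · rw [indicator_of_mem hx, norm_mul, Real.norm_of_nonneg (NNReal.coe_nonneg _)]
          have h1 : ((thickenedIndicator (hδ0 n) K x : ℝ≥0) : ℝ) ≤ 1 := by
            exact_mod_cast thickenedIndicator_le_one (hδ0 n) K x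
          nlinarith [norm_nonneg (h x)]
        · have hx' : x ∉ Metric.thickening (δ n) K := fun hc =>
            hx (Metric.thickening_mono (hδ1 n) K hc)
          simp [thickenedIndicator_zero (hδ0 n) K hx', hx]
      · refine Eventually.of_forall fun x => ?_
        have h1 := (tendsto_pi_nhds.1 (thickenedIndicator_tendsto_indicator_closure hδ0 hδlim K)) x
        rw [hKc.closure_eq] at h1
        exact ((NNReal.continuous_coe.tendsto _).comp h1).const_mul (h x)
    simp only [hzero] at hlim
    have h2 := tendsto_nhds_unique hlim tendsto_const_nhds
    rw [← integral_indicator hKc.measurableSet, ← h2]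
    refine integral_congr_ae (Eventually.of_forall fun x => ?_)
    by_cases hx : x ∈ K <;> simp [hx]
  rw [Lp.eq_zero_iff_ae_eq_zero]
  rcases isEmpty_or_nonempty X with hX | ⟨⟨x₀⟩⟩
  · exact Eventually.of_forall fun x => hX.elim x
  -- As `h` need not be integrable on all of `X`, the criterion by closed sets is used on one ball
  -- at a time.
  have hball : ∀ n : ℕ, ∀ᵐ x ∂(ν.restrict (Metric.closedBall x₀ n)), h x = 0 := by
    intro n
    refine ae_eq_zero_of_forall_setIntegral_isClosed_eq_zero
      (hIon _ Metric.isClosed_closedBall.measurableSet (hν _ Metric.isBounded_closedBall))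
      fun s hs => ?_
    rw [Measure.restrict_restrict hs.measurableSet]
    exact hclosed _ (hs.inter Metric.isClosed_closedBall)
      (Metric.isBounded_closedBall.subset inter_subset_right)
  have h3 : ∀ᵐ x ∂(ν.restrict (⋃ n : ℕ, Metric.closedBall x₀ (n : ℝ))), h x = 0 :=
    (ae_restrict_iUnion_iff _ _).2 hball
  rwa [Metric.iUnion_closedBall_nat, Measure.restrict_univ] at h3

end SobolevClasses

/-! ### Bounded functionals on the cotangent module are represented by vector fields -/

section Representation

variable {X : Type*} [MetricSpace X] [MeasurableSpace X] {ν : Measure X} {p : ℝ} [hp : Fact (1 < p)]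

theorem abs_indicator_one_le (A : Set X) (x : X) : |A.indicator (1 : X → ℝ) x| ≤ 1 := by
  by_cases hx : x ∈ A <;> simp [hx]

theorem countable_range_indicator_one (A : Set X) : (range (A.indicator (1 : X → ℝ))).Countable :=
  ((countable_singleton (1 : ℝ)).insert 0).mono (by
    rintro _ ⟨x, rfl⟩
    by_cases hx : x ∈ A <;> simp [hx])

/-- Multiplication by the indicator function of `A` on the pre-cotangent module. -/
noncomputable def PreCotangent.indMul {A : Set X} (hA : MeasurableSet A) :
    PreCotangent ν p →L[ℝ] PreCotangent ν p :=
  PreCotangent.mulL (measurable_one.indicator hA) (countable_range_indicator_one A)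
    (Eventually.of_forall (abs_indicator_one_le A))

theorem PreCotangent.fn_indMul {A : Set X} (hA : MeasurableSet A) (s : PreCotangent ν p) :
    (PreCotangent.indMul hA s).fn = fun x => A.indicator (1 : X → ℝ) x • s.fn x := rfl

theorem PreCotangent.grad_indMul_le {A : Set X} (hA : MeasurableSet A) (s : PreCotangent ν p) :
    ∀ᵐ x ∂ν, (PreCotangent.indMul hA s).grad x ≤ A.indicator s.grad x := by
  filter_upwards [(PreCotangent.mul_mem (measurable_one.indicator hA)
    (countable_range_indicator_one A) (Eventually.of_forall (abs_indicator_one_le A)) s).2]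
    with x hx
  refine hx.trans (le_of_eq ?_)
  by_cases h : x ∈ A <;> simp [h]

/-- Multiplication by the indicator function of `A` on the cotangent module. -/
noncomputable def indMul {A : Set X} (hA : MeasurableSet A) : Cotangent ν p →L[ℝ] Cotangent ν p :=
  (PreCotangent.indMul hA).completion

theorem indMul_coe {A : Set X} (hA : MeasurableSet A) (s : PreCotangent ν p) :
    indMul hA (s : Cotangent ν p) = (PreCotangent.indMul hA s : PreCotangent ν p) :=
  ContinuousLinearMap.completion_apply_coe _ _

theorem norm_indMul_le {A : Set X} (hA : MeasurableSet A) (v : Cotangent ν p) :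
    ‖indMul hA v‖ ≤ ‖v‖ := by
  induction v using UniformSpace.Completion.induction_on with
  | hp => exact isClosed_le (by fun_prop) (by fun_prop)
  | ih s =>
    rw [indMul_coe, UniformSpace.Completion.norm_coe, UniformSpace.Completion.norm_coe]
    have := PreCotangent.toReal_enorm_le_of_grad_le (s := s) (t := PreCotangent.indMul hA s)
      zero_le_one (by
        filter_upwards [PreCotangent.grad_indMul_le hA s] with x hx
        refine hx.trans ?_
        rw [ENNReal.ofReal_one, one_mul]
        exact indicator_le_self _ _ _)
    rwa [one_mul] at this

theorem indMul_eq_zero {A : Set X} (hA : MeasurableSet A) (h0 : ν A = 0) (v : Cotangent ν p) :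
    indMul hA v = 0 := by
  induction v using UniformSpace.Completion.induction_on with
  | hp => exact isClosed_eq (by fun_prop) (by fun_prop)
  | ih s =>
    rw [indMul_coe, ← norm_eq_zero, UniformSpace.Completion.norm_coe]
    have := PreCotangent.toReal_enorm_le_of_grad_le (s := s) (t := PreCotangent.indMul hA s)
      le_rfl (by
        filter_upwards [PreCotangent.grad_indMul_le hA s, measure_eq_zero_iff_ae_notMem.1 h0]
          with x hx hxA
        refine hx.trans ?_
        rw [indicator_of_notMem hxA]
        exact zero_le)
    rw [zero_mul] at this
    exact le_antisymm this (norm_nonneg _)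

/-- Locality of the multiplication, checked on the dense pre-cotangent module. It reduces a
multiplier with countably many values to scalars on its level sets. -/
theorem indMul_mulL_of_eqOn {A : Set X} (hA : MeasurableSet A) {c : X → ℝ} (hc : Measurable c)
    (hr : (range c).Countable) {K : ℝ} (hK : ∀ᵐ x ∂ν, |c x| ≤ K) {k : ℝ} (hk : ∀ x ∈ A, c x = k)
    (v : Cotangent ν p) :
    indMul hA ((PreCotangent.mulL hc hr hK).completion v) = k • indMul hA v := by
  have hT : ∀ s : PreCotangent ν p, (PreCotangent.mulL hc hr hK).completion (s : Cotangent ν p) =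
      (PreCotangent.mulL hc hr hK s : PreCotangent ν p) :=
    ContinuousLinearMap.completion_apply_coe _
  generalize (PreCotangent.mulL (p := p) hc hr hK).completion = T at hT ⊢
  induction v using UniformSpace.Completion.induction_on with
  | hp =>
    exact isClosed_eq ((indMul hA).continuous.comp T.continuous)
      (k • indMul (ν := ν) (p := p) hA).continuous
  | ih s =>
    rw [hT, indMul_coe, indMul_coe,
      ← UniformSpace.Completion.coe_smul]
    congr 1
    refine PreCotangent.fn_ext (funext fun x => ?_)
    change A.indicator (1 : X → ℝ) x • (c x • s.fn x) = k • (A.indicator (1 : X → ℝ) x • s.fn x)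
    by_cases hx : x ∈ A
    · rw [hk x hx, smul_comm]
    · simp [hx]

theorem indMul_union {A B : Set X} (hA : MeasurableSet A) (hB : MeasurableSet B)
    (hd : Disjoint A B) (v : Cotangent ν p) :
    indMul (hA.union hB) v = indMul hA v + indMul hB v := by
  induction v using UniformSpace.Completion.induction_on with
  | hp => exact isClosed_eq (by fun_prop) (by fun_prop)
  | ih s =>
    rw [indMul_coe, indMul_coe, indMul_coe, ← UniformSpace.Completion.coe_add]
    congr 1
    refine PreCotangent.fn_ext (funext fun x => ?_)
    rw [PreCotangent.fn_add, Pi.add_apply, PreCotangent.fn_indMul, PreCotangent.fn_indMul,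
      PreCotangent.fn_indMul, indicator_union_of_disjoint hd, ← add_smul]

theorem indMul_univ (v : Cotangent ν p) : indMul MeasurableSet.univ v = v := by
  induction v using UniformSpace.Completion.induction_on with
  | hp => exact isClosed_eq (by fun_prop) (by fun_prop)
  | ih s =>
    rw [indMul_coe]
    congr 1
    refine PreCotangent.fn_ext (funext fun x => ?_)
    simp [PreCotangent.fn_indMul]

theorem indMul_congr {A B : Set X} (hA : MeasurableSet A) (hB : MeasurableSet B) (h : A = B)
    (v : Cotangent ν p) : indMul hA v = indMul hB v := by
  subst h
  rfl

theorem indMul_biUnion {A : ℕ → Set X} (hA : ∀ i, MeasurableSet (A i))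
    (hd : Pairwise (Function.onFun Disjoint A)) (F : Finset ℕ) (v : Cotangent ν p) :
    indMul (F.measurableSet_biUnion fun i _ => hA i) v = ∑ i ∈ F, indMul (hA i) v := by
  classical
  induction F using Finset.induction_on with
  | empty =>
    rw [Finset.sum_empty]
    exact indMul_eq_zero _ (by simp) v
  | insert j F hj ih =>
    rw [Finset.sum_insert hj, ← ih, ← indMul_union (hA j) (F.measurableSet_biUnion fun i _ => hA i)]
    · exact indMul_congr _ _ (by simp) v
    · rw [disjoint_iUnion₂_right]
      intro i hi
      exact hd fun h => hj (h ▸ hi)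

/-- On the pre-cotangent module this is dominated convergence with majorant `|s|_*^p`. The bound
`norm_indMul_le`, uniform in the set, carries it to the completion. -/
theorem tendsto_indMul_zero {ι : Type*} {l : Filter ι} [l.IsCountablyGenerated] {A : ι → Set X}
    (hA : ∀ i, MeasurableSet (A i)) (h : ∀ x, ∀ᶠ i in l, x ∉ A i) (v : Cotangent ν p) :
    Tendsto (fun i => indMul (hA i) v) l (𝓝 0) := by
  have hp0 : 0 < p := zero_lt_one.trans hp.out
  have hpre : ∀ s : PreCotangent ν p,
      Tendsto (fun i => indMul (hA i) (s : Cotangent ν p)) l (𝓝 0) := by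
    intro s
    rw [tendsto_zero_iff_norm_tendsto_zero]
    have h1 : Tendsto (fun i => ∫⁻ x, (A i).indicator s.grad x ^ p ∂ν) l (𝓝 (∫⁻ _, 0 ∂ν)) := by
      refine tendsto_lintegral_filter_of_dominated_convergence (fun x => s.grad x ^ p)
        (Eventually.of_forall fun i => (s.measurable_grad.indicator (hA i)).pow_const p)
        (Eventually.of_forall fun i => Eventually.of_forall fun x =>
          ENNReal.rpow_le_rpow (indicator_le_self _ _ _) hp0.le)
        s.lintegral_grad_lt_top.ne (Eventually.of_forall fun x => ?_)
      refine tendsto_const_nhds.congr' ?_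
      filter_upwards [h x] with i hi
      rw [indicator_of_notMem hi, ENNReal.zero_rpow_of_pos hp0]
    rw [lintegral_zero] at h1
    have h2 := ((ENNReal.continuous_rpow_const (y := 1 / p)).tendsto 0).comp h1
    rw [ENNReal.zero_rpow_of_pos (by positivity)] at h2
    have h3 : Tendsto (fun i => (PreCotangent.indMul (hA i) s).enorm) l (𝓝 0) := by
      refine tendsto_of_tendsto_of_tendsto_of_le_of_le tendsto_const_nhds h2 (fun _ => zero_le)
        fun i => ?_
      refine ENNReal.rpow_le_rpow (lintegral_mono_ae ?_) (by positivity)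
      filter_upwards [PreCotangent.grad_indMul_le (hA i) s] with x hx
      exact ENNReal.rpow_le_rpow hx hp0.le
    have h4 := (ENNReal.tendsto_toReal ENNReal.zero_ne_top).comp h3
    rw [ENNReal.toReal_zero] at h4
    refine h4.congr fun i => ?_
    rw [indMul_coe, UniformSpace.Completion.norm_coe, PreCotangent.norm_def]
    rfl
  rw [Metric.tendsto_nhds]
  intro ε hε
  obtain ⟨s, hs⟩ := UniformSpace.Completion.denseRange_coe.exists_dist_lt v (half_pos hε)
  filter_upwards [Metric.tendsto_nhds.1 (hpre s) _ (half_pos hε)] with i hi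
  rw [dist_zero_right] at hi ⊢
  have e : indMul (hA i) v = indMul (hA i) (v - (s : Cotangent ν p)) + indMul (hA i) (s : Cotangent ν p) := by
    rw [← map_add, sub_add_cancel]
  have h1 := norm_indMul_le (hA i) (v - (s : Cotangent ν p))
  rw [dist_eq_norm] at hs
  rw [e]
  exact (norm_add_le _ _).trans_lt (by linarith)

/-- After a finite partial sum the remainder is `v` cut to the sets left over, and these eventually
leave every point. This is the σ-additivity of `A ↦ L(1_A v)`. -/
theorem hasSum_indMul {A : ℕ → Set X} (hA : ∀ i, MeasurableSet (A i))
    (hd : Pairwise (Function.onFun Disjoint A)) (v : Cotangent ν p) :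
    HasSum (fun i => indMul (hA i) v) (indMul (MeasurableSet.iUnion hA) v) := by
  have hm : ∀ F : Finset ℕ, MeasurableSet (⋃ i ∈ F, A i) := fun F =>
    F.measurableSet_biUnion fun i _ => hA i
  have hm' : ∀ F : Finset ℕ, MeasurableSet ((⋃ i, A i) \ ⋃ i ∈ F, A i) := fun F =>
    (MeasurableSet.iUnion hA).diff (hm F)
  have h1 := tendsto_indMul_zero (l := (atTop : Filter (Finset ℕ))) hm' (fun x => by
    by_cases hx : x ∈ ⋃ i, A i
    · obtain ⟨j, hj⟩ := mem_iUnion.1 hx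
      filter_upwards [eventually_ge_atTop {j}] with F hF hc
      exact hc.2 (mem_biUnion (hF (Finset.mem_singleton_self j)) hj)
    · exact Eventually.of_forall fun F hc => hx hc.1) v
  have h2 : ∀ F : Finset ℕ, ∑ i ∈ F, indMul (hA i) v =
      indMul (MeasurableSet.iUnion hA) v - indMul (hm' F) v := fun F => by
    rw [← indMul_biUnion hA hd F v, eq_sub_iff_add_eq, ← indMul_union (hm F) (hm' F)
      disjoint_sdiff_right]
    refine indMul_congr _ _ ?_ v
    rw [union_sdiff_cancel]
    exact iUnion₂_subset fun i _ => subset_iUnion A i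
  have h3 := h1.const_sub (indMul (MeasurableSet.iUnion hA) v)
  rw [sub_zero] at h3
  exact h3.congr fun F => (h2 F).symm

/-! ### Densities of functionals. -/

open Classical in
/-- The signed measure `A ↦ L(1_A v)`. -/
noncomputable def functionalMeasure (L : Cotangent ν p →L[ℝ] ℝ) (v : Cotangent ν p) :
    SignedMeasure X where
  measureOf' A := if hA : MeasurableSet A then L (indMul hA v) else 0
  empty' := by
    rw [dif_pos MeasurableSet.empty, indMul_eq_zero _ measure_empty, map_zero]
  not_measurable' A hA := dif_neg hA
  m_iUnion' A hA hd := by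
    rw [dif_pos (MeasurableSet.iUnion hA)]
    simp only [dif_pos (hA _)]
    exact (hasSum_indMul hA hd v).mapL L

theorem functionalMeasure_apply (L : Cotangent ν p →L[ℝ] ℝ) (v : Cotangent ν p) {A : Set X}
    (hA : MeasurableSet A) : functionalMeasure L v A = L (indMul hA v) := dif_pos hA

/-- Radon–Nikodym: cutting `v` to a `ν`-null set gives zero, so the signed measure is absolutely
continuous. -/
theorem exists_density [SigmaFinite ν] (L : Cotangent ν p →L[ℝ] ℝ) (v : Cotangent ν p) :
    ∃ g : Lp ℝ 1 ν, ∀ (A : Set X) (hA : MeasurableSet A), ∫ x in A, g x ∂ν = L (indMul hA v) := by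
  have hac : functionalMeasure L v ≪ᵥ ν.toENNRealVectorMeasure :=
    VectorMeasure.AbsolutelyContinuous.mk fun A hA h0 => by
      rw [Measure.toENNRealVectorMeasure_apply_measurable hA] at h0
      rw [functionalMeasure_apply L v hA, indMul_eq_zero hA h0, map_zero]
  have h1 := (SignedMeasure.absolutelyContinuous_iff_withDensityᵥ_rnDeriv_eq _ _).1 hac
  have hi := SignedMeasure.integrable_rnDeriv (functionalMeasure L v) ν
  refine ⟨hi.toL1 _, fun A hA => ?_⟩
  have h2 := withDensityᵥ_apply hi hA
  rw [h1, functionalMeasure_apply L v hA] at h2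
  rw [h2]
  exact integral_congr_ae (ae_restrict_of_ae hi.coeFn_toL1)

/-- The density of the signed measure `A ↦ L(1_A v)`. -/
noncomputable def density [SigmaFinite ν] (L : Cotangent ν p →L[ℝ] ℝ) (v : Cotangent ν p) :
    Lp ℝ 1 ν := (exists_density L v).choose

theorem setIntegral_density [SigmaFinite ν] (L : Cotangent ν p →L[ℝ] ℝ) (v : Cotangent ν p)
    {A : Set X} (hA : MeasurableSet A) : ∫ x in A, density L v x ∂ν = L (indMul hA v) :=
  (exists_density L v).choose_spec A hA

theorem eq_density [SigmaFinite ν] {L : Cotangent ν p →L[ℝ] ℝ} {v : Cotangent ν p} {g : Lp ℝ 1 ν}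
    (h : ∀ (A : Set X) (hA : MeasurableSet A), ∫ x in A, g x ∂ν = L (indMul hA v)) :
    density L v = g := by
  refine Lp.ext (Integrable.ae_eq_of_forall_setIntegral_eq _ _ (L1.integrable_coeFn _)
    (L1.integrable_coeFn _) fun A hA _ => ?_)
  rw [setIntegral_density L v hA, h A hA]

/-- Split the space by the sign of the density. Each half contributes `± L(1_A v)`, at most `‖L‖ *
‖v‖`, hence the factor `2`. -/
theorem norm_density_le [SigmaFinite ν] (L : Cotangent ν p →L[ℝ] ℝ) (v : Cotangent ν p) :
    ‖density L v‖ ≤ 2 * ‖L‖ * ‖v‖ := by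
  have hi := L1.integrable_coeFn (density L v)
  have hm : MeasurableSet {x | 0 ≤ density L v x} :=
    measurableSet_le measurable_const (Lp.stronglyMeasurable _).measurable
  have hb : ∀ {A : Set X} (hA : MeasurableSet A), |L (indMul hA v)| ≤ ‖L‖ * ‖v‖ := fun hA =>
    (L.le_opNorm _).trans (mul_le_mul_of_nonneg_left (norm_indMul_le hA v) (norm_nonneg L))
  rw [L1.norm_eq_integral_norm, ← integral_add_compl hm hi.norm]
  have e1 : ∫ x in {x | 0 ≤ density L v x}, ‖density L v x‖ ∂ν = L (indMul hm v) := by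
    rw [← setIntegral_density L v hm]
    exact setIntegral_congr_fun hm fun x hx => Real.norm_of_nonneg hx
  have e2 : ∫ x in {x | 0 ≤ density L v x}ᶜ, ‖density L v x‖ ∂ν = -L (indMul hm.compl v) := by
    rw [← setIntegral_density L v hm.compl, ← integral_neg]
    refine setIntegral_congr_fun hm.compl fun x hx => ?_
    have hx' : ¬ 0 ≤ density L v x := hx
    exact Real.norm_of_nonpos (not_le.1 hx').le
  rw [e1, e2]
  have h1 := (abs_le.1 (hb hm)).2
  have h2 := (abs_le.1 (hb hm.compl)).1
  linarith

/-- The linear map `v ↦ density L v`. -/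
noncomputable def densityL [SigmaFinite ν] (L : Cotangent ν p →L[ℝ] ℝ) :
    Cotangent ν p →L[ℝ] Lp ℝ 1 ν :=
  LinearMap.mkContinuous
    { toFun := density L
      map_add' := fun v w => eq_density fun A hA => by
        rw [map_add, map_add, ← setIntegral_density L v hA, ← setIntegral_density L w hA,
          ← integral_add (L1.integrable_coeFn _).integrableOn (L1.integrable_coeFn _).integrableOn]
        exact integral_congr_ae (ae_restrict_of_ae (Lp.coeFn_add _ _))
      map_smul' := fun c v => eq_density fun A hA => by
        rw [map_smul, map_smul, ← setIntegral_density L v hA, smul_eq_mul, ← integral_const_mul]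
        exact integral_congr_ae (ae_restrict_of_ae (Lp.coeFn_smul _ _)) }
    (2 * ‖L‖) (norm_density_le L)

theorem densityL_apply [SigmaFinite ν] (L : Cotangent ν p →L[ℝ] ℝ) (v : Cotangent ν p) :
    densityL L v = density L v := rfl

/-- On each of the countably many level sets of `c` both sides have the same integral over every
measurable subset. -/
theorem density_mul_ae_eq [SigmaFinite ν] (L : Cotangent ν p →L[ℝ] ℝ) {c : X → ℝ}
    (hc : Measurable c) (hr : (range c).Countable) {K : ℝ} (hK : ∀ᵐ x ∂ν, |c x| ≤ K)
    (v : Cotangent ν p) :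
    ∀ᵐ x ∂ν, density L ((PreCotangent.mulL hc hr hK).completion v) x = c x * density L v x := by
  have : Countable (range c) := hr.to_subtype
  have h : ∀ᵐ x ∂ν, ∀ k : range c, x ∈ c ⁻¹' {k.1} →
      density L ((PreCotangent.mulL hc hr hK).completion v) x = k.1 * density L v x := by
    refine ae_all_iff.2 fun k => ?_
    have hA : MeasurableSet (c ⁻¹' {k.1}) := hc (measurableSet_singleton _)
    rw [← ae_restrict_iff' hA]
    refine Integrable.ae_eq_of_forall_setIntegral_eq _ _ (L1.integrable_coeFn _).restrict
      ((L1.integrable_coeFn _).restrict.const_mul _) fun B hB _ => ?_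
    rw [Measure.restrict_restrict hB, integral_const_mul, setIntegral_density L _ (hB.inter hA),
      setIntegral_density L _ (hB.inter hA),
      indMul_mulL_of_eqOn (hB.inter hA) hc hr hK (fun x hx => hx.2), map_smul, smul_eq_mul]
  filter_upwards [h] with x hx
  exact hx ⟨c x, mem_range_self x⟩ rfl

/-- Countably valued multipliers are settled by `density_mul_ae_eq`. For general `f`, the
approximations converge in operator norm on the left and uniformly on the right. -/
theorem densityL_linftyMul [SigmaFinite ν] (L : Cotangent ν p →L[ℝ] ℝ) (f : Lp ℝ ∞ ν)
    (v : Cotangent ν p) : densityL L (linftyMul f v) = f • densityL L v := by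
  have h1 : Tendsto (fun n => densityL L (floorMulL f n v)) atTop
      (𝓝 (densityL L (linftyMul f v))) := by
    have h2 : Tendsto (fun n => floorMulL (p := p) f n v) atTop (𝓝 (linftyMul f v)) :=
      ((ContinuousLinearMap.apply ℝ (Cotangent ν p) v).continuous.tendsto _).comp
        (tendsto_floorMulL f)
    exact ((densityL L).continuous.tendsto _).comp h2
  refine tendsto_nhds_unique h1 ?_
  rw [tendsto_iff_norm_sub_tendsto_zero]
  have hlim : Tendsto (fun n : ℕ => 1 / ((n : ℝ) + 1) * ‖densityL L v‖) atTop (𝓝 0) := by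
    simpa using (tendsto_one_div_add_atTop_nhds_zero_nat (𝕜 := ℝ)).mul_const ‖densityL L v‖
  refine squeeze_zero (fun _ => norm_nonneg _) (fun n => ?_) hlim
  refine Lp.norm_le_mul_norm_of_ae_le_mul ?_
  filter_upwards [Lp.coeFn_sub (densityL L (floorMulL f n v)) (f • densityL L v),
    Lp.coeFn_lpSMul (r := 1) f (densityL L v),
    density_mul_ae_eq L (measurable_floorApprox f n) (countable_range_floorApprox f n)
      (ae_abs_floorApprox_le f n) v] with x h2 h3 h4
  have h5 : densityL L (floorMulL f n v) x = floorApprox f n x * density L v x := h4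
  rw [h2, Pi.sub_apply, h3, h5, Pi.smul_apply', smul_eq_mul, densityL_apply, ← sub_mul, norm_mul]
  exact mul_le_mul_of_nonneg_right (abs_floorApprox_sub_le f n x) (norm_nonneg _)

/-- Every bounded linear functional on `L^p(T^*X)` is the pairing with a vector field. -/
theorem exists_vectorField_pairing_eq [SigmaFinite ν] (L : Cotangent ν p →L[ℝ] ℝ) :
    ∃ Y : VectorField ν p, ∀ v, Y.pairing v = L v := by
  refine ⟨⟨densityL L, densityL_linftyMul L⟩, fun v => ?_⟩
  have := setIntegral_density L v MeasurableSet.univ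
  rwa [indMul_univ, setIntegral_univ] at this

end Representation

/-! ### Extension of linear functionals dominated by a convex function -/

section HahnBanach

/-- A linear functional on a subspace which is dominated by a continuous convex function extends to
a continuous linear functional dominated by it.  The subspace is given as the range of `d`. -/
theorem exists_clm_extension_of_le_convex {V W : Type*} [NormedAddCommGroup V] [NormedSpace ℝ V]
    [AddCommGroup W] [Module ℝ W] {φ : V → ℝ} (hφ : Continuous φ) (hconv : ConvexOn ℝ univ φ)
    (h0 : φ 0 = 0) (d : W →ₗ[ℝ] V) (ℓ : W →ₗ[ℝ] ℝ) (hle : ∀ w, ℓ w ≤ φ (d w)) :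
    ∃ L : V →L[ℝ] ℝ, (∀ w, L (d w) = ℓ w) ∧ ∀ v, L v ≤ φ v := by
  set s : Set (V × ℝ) := {q | q.1 ∈ univ ∧ φ q.1 < q.2} with hs
  have hs1 : Convex ℝ s := hconv.convex_strict_epigraph
  have hs2 : IsOpen s := by
    have : s = {q : V × ℝ | φ q.1 < q.2} := by ext; simp [hs]
    rw [this]
    exact isOpen_lt (hφ.comp continuous_fst) continuous_snd
  have hdisj : Disjoint s ((d.prod ℓ).range : Set (V × ℝ)) := by
    rw [Set.disjoint_left]
    rintro _ hq ⟨w, rfl⟩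
    exact (hle w).not_gt hq.2
  -- Separating the strict epigraph from the subspace of pairs `(d w, ℓ w)` avoids having to know
  -- beforehand that `ℓ w` depends only on `d w`.
  obtain ⟨F, r, hFs, hFt⟩ := geometric_hahn_banach_open hs1 hs2
    (Submodule.convex (LinearMap.range (d.prod ℓ))) hdisj
  set F₁ : V →L[ℝ] ℝ := F.comp (ContinuousLinearMap.inl ℝ V ℝ) with hF₁
  set c : ℝ := F (0, 1) with hc
  have hF : ∀ (v : V) (a : ℝ), F (v, a) = F₁ v + a * c := fun v a => by
    have e : (v, a) = ContinuousLinearMap.inl ℝ V ℝ v + a • ((0 : V), (1 : ℝ)) := by simp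
    rw [e, map_add, map_smul, smul_eq_mul]
    rfl
  have hr0 : r ≤ 0 := by
    have := hFt 0 (Submodule.zero_mem _)
    rwa [map_zero] at this
  have hFd : ∀ w, F₁ (d w) + ℓ w * c = 0 := by
    intro w
    -- A linear function of `a` that is bounded below has zero slope.
    have key : ∀ a : ℝ, r ≤ a * (F₁ (d w) + ℓ w * c) := fun a => by
      have h1 := hFt (d.prod ℓ (a • w)) ⟨a • w, rfl⟩
      have h2 : d.prod ℓ (a • w) = (a • d w, a * ℓ w) := by simp
      rw [h2, hF, map_smul, smul_eq_mul] at h1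
      linarith
    by_contra hne
    have := key ((r - 1) / (F₁ (d w) + ℓ w * c))
    rw [div_mul_cancel₀ _ hne] at this
    linarith
  have hFs' : ∀ v a, φ v < a → F₁ v + a * c < 0 := fun v a hva => by
    have := hFs (v, a) ⟨mem_univ _, hva⟩
    rw [hF] at this
    linarith
  -- The point `(0, 1)` lies in the strict epigraph, so the separating hyperplane is not vertical
  -- and `F₁` can be normalised by `-c`.
  have hc0 : c < 0 := by
    have := hFs' 0 1 (by rw [h0]; exact one_pos)
    rw [map_zero] at this
    linarith
  refine ⟨(-c)⁻¹ • F₁, fun w => ?_, fun v => le_of_forall_gt_imp_ge_of_dense fun a ha => ?_⟩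
  · have := hFd w
    rw [smul_apply, smul_eq_mul, inv_mul_eq_iff_eq_mul₀ (by linarith)]
    linarith
  · have := hFs' v a ha
    rw [smul_apply, smul_eq_mul, inv_mul_le_iff₀ (by linarith)]
    linarith

/-- A linear functional on a subspace which is a subgradient at `ω` of a continuous convex function
restricted to the translated subspace extends to a continuous subgradient at `ω`. -/
theorem exists_clm_extension_of_le_sub {V W : Type*} [NormedAddCommGroup V] [NormedSpace ℝ V]
    [AddCommGroup W] [Module ℝ W] {E : V → ℝ} (hE : Continuous E) (hconv : ConvexOn ℝ univ E)
    (ω : V) (d : W →ₗ[ℝ] V) (ℓ : W →ₗ[ℝ] ℝ) (hle : ∀ w, ℓ w ≤ E (ω + d w) - E ω) :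
    ∃ L : V →L[ℝ] ℝ, (∀ w, L (d w) = ℓ w) ∧ ∀ v, L v ≤ E (ω + v) - E ω := by
  refine exists_clm_extension_of_le_convex (φ := fun v => E (ω + v) - E ω) (by fun_prop) ?_
    (by simp) d ℓ hle
  refine ⟨convex_univ, fun x _ y _ a b ha hb hab => ?_⟩
  have h1 := hconv.2 (mem_univ (ω + x)) (mem_univ (ω + y)) ha hb hab
  have e : a • (ω + x) + b • (ω + y) = ω + (a • x + b • y) := by
    rw [smul_add, smul_add, add_add_add_comm, ← add_smul, hab, one_smul]
  rw [e] at h1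
  simp only [smul_eq_mul] at h1 ⊢
  have h2 : E ω = a * E ω + b * E ω := by rw [← add_mul, hab, one_mul]
  linarith

end HahnBanach

/-! ### The energy functional -/

section Energy

variable {X : Type*} [MetricSpace X] [MeasurableSpace X] [BorelSpace X] {ν : Measure X} {p : ℝ}
  [hp : Fact (1 < p)]

theorem sigmaFinite_of_finite_on_bounded [TopologicalSpace.SeparableSpace X]
    (hν : ∀ s : Set X, Bornology.IsBounded s → ν s < ∞) : SigmaFinite ν := by
  have : SecondCountableTopology X := UniformSpace.secondCountable_of_separable X
  have : IsLocallyFiniteMeasure ν :=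
    ⟨fun x => ⟨Metric.ball x 1, Metric.ball_mem_nhds x one_pos, hν _ Metric.isBounded_ball⟩⟩
  infer_instance

theorem pointwiseNorm_nonneg (v : Cotangent ν p) : 0 ≤ pointwiseNorm v := by
  induction v using UniformSpace.Completion.induction_on with
  | hp =>
    exact isClosed_le continuous_const UniformSpace.Completion.continuous_extension
  | ih s =>
    rw [pointwiseNorm_coe, ← Lp.coeFn_nonneg]
    filter_upwards [s.memLp_grad.coeFn_toLp] with x hx
    rw [PreCotangent.pnorm, hx]
    exact ENNReal.toReal_nonneg

/-- Coercivity enters the flow argument through this sign: the envelope estimates need a functional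
bounded below by zero. -/
theorem nonneg_of_coercive {E : Cotangent ν p → ℝ} {C : ℝ} (hC : 0 < C)
    (hE : ∀ v : Cotangent ν p, C * ∫ x, (pointwiseNorm v x) ^ p ∂ν ≤ E v) (v : Cotangent ν p) :
    0 ≤ E v := by
  refine le_trans (mul_nonneg hC.le (integral_nonneg_of_ae ?_)) (hE v)
  filter_upwards [(Lp.coeFn_nonneg _).2 (pointwiseNorm_nonneg v)] with x hx
  exact Real.rpow_nonneg hx p

theorem energy_of_memW1 (E : Cotangent ν p → ℝ) {u : Lp ℝ 2 ν} (h : MemW1 p u) :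
    energy E u = (E h.d : EReal) := dif_pos h

theorem energy_of_not_memW1 (E : Cotangent ν p → ℝ) {u : Lp ℝ 2 ν} (h : ¬ MemW1 p u) :
    energy E u = ⊤ := dif_neg h

theorem toReal_energy (E : Cotangent ν p → ℝ) {u : Lp ℝ 2 ν} (h : MemW1 p u) :
    (energy E u).toReal = E h.d := by rw [energy_of_memW1 E h, EReal.toReal_coe]

/-- `toReal` sends `⊤` to `0`, so finiteness has to be recorded by membership in the domain. With
it, the real sublevel sets are the sublevel sets of the extended functional, closed by lower
semicontinuity. -/
theorem lscConvex_energy {E : Cotangent ν p → ℝ} (hconv : ConvexOn ℝ univ E) (hE : ∀ v, 0 ≤ E v)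
    (hlsc : LowerSemicontinuous (energy E)) :
    LscConvex (sobolevSubmodule ν p : Set (Lp ℝ 2 ν)) fun u => (energy E u).toReal where
  nonempty := ⟨0, memW1_zero⟩
  convexOn := by
    refine ⟨(sobolevSubmodule ν p).convex, fun u hu v hv a b ha hb hab => ?_⟩
    have hu' : MemW1 p u := hu
    have hv' : MemW1 p v := hv
    have hw : MemW1 p (a • u + b • v) := (hu'.smul a).add (hv'.smul b)
    simp only [toReal_energy E hu', toReal_energy E hv', toReal_energy E hw]
    rw [(hu'.smul a).d_add (hv'.smul b), hu'.d_smul, hv'.d_smul]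
    exact hconv.2 (mem_univ _) (mem_univ _) ha hb hab
  nonneg u hu := by
    have hu' : MemW1 p u := hu
    rw [toReal_energy E hu']
    exact hE _
  isClosed c := by
    have : {u | u ∈ (sobolevSubmodule ν p : Set (Lp ℝ 2 ν)) ∧ (energy E u).toReal ≤ c} =
        energy E ⁻¹' Iic (c : EReal) := by
      ext u
      rw [mem_preimage, mem_Iic]
      constructor
      · rintro ⟨hu, hle⟩
        have hu' : MemW1 p u := hu
        rw [toReal_energy E hu'] at hle
        rw [energy_of_memW1 E hu']
        exact_mod_cast hle
      · intro hle
        by_cases hu : MemW1 p u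
        · refine ⟨hu, ?_⟩
          rw [energy_of_memW1 E hu] at hle
          rw [toReal_energy E hu]
          exact_mod_cast hle
        · rw [energy_of_not_memW1 E hu] at hle
          exact absurd hle (not_le.2 (EReal.coe_lt_top c))
    rw [this]
    exact hlsc.isClosed_preimage _

/-- The subdifferential of the energy in terms of its finite values. -/
theorem mem_subdifferential_energy_iff {E : Cotangent ν p → ℝ} {u v : Lp ℝ 2 ν} :
    v ∈ subdifferential (energy E) u ↔ MemW1 p u ∧
      ∀ z, MemW1 p z → (energy E u).toReal + inner ℝ v (z - u) ≤ (energy E z).toReal := by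
  constructor
  · intro h
    have hu : MemW1 p u := by
      by_contra hc
      -- The increment `-u` leads to the zero class, whose energy is finite; this rules out infinite
      -- energy at `u`.
      have h1 := h (-u)
      rw [add_neg_cancel, energy_of_not_memW1 E hc, energy_of_memW1 E memW1_zero,
        EReal.top_add_coe] at h1
      exact absurd h1 (not_le.2 (EReal.coe_lt_top _))
    refine ⟨hu, fun z hz => ?_⟩
    have h1 := h (z - u)
    rw [add_sub_cancel, energy_of_memW1 E hu, energy_of_memW1 E hz] at h1
    rw [toReal_energy E hu, toReal_energy E hz, real_inner_comm]
    exact_mod_cast h1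
  · rintro ⟨hu, h⟩ w
    by_cases hz : MemW1 p (u + w)
    · have h1 := h _ hz
      rw [toReal_energy E hu, toReal_energy E hz, real_inner_comm, add_sub_cancel_left] at h1
      rw [energy_of_memW1 E hu, energy_of_memW1 E hz]
      exact_mod_cast h1
    · rw [energy_of_not_memW1 E hz]
      exact le_top

theorem integral_mul_eq_inner (f w : Lp ℝ 2 ν) {g : X → ℝ} (hg : g =ᵐ[ν] w) :
    ∫ x, f x * g x ∂ν = inner ℝ w f := by
  rw [L2.inner_def]
  refine integral_congr_ae ?_
  filter_upwards [hg] with x hx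
  simp [hx]

/-- The subdifferential of the energy is described by the divergence of vector fields. -/
theorem neg_mem_subdifferential_energy_iff [SigmaFinite ν] {E : Cotangent ν p → ℝ}
    (hcont : Continuous E) (hconv : ConvexOn ℝ univ E) {u u' : Lp ℝ 2 ν} :
    -u' ∈ subdifferential (energy E) u ↔
      ∃ h : MemW1 p u, ∃ Y : VectorField ν p, Y.HasDivergence u' ∧ Y ∈ subdifferentialE E h.d := by
  rw [mem_subdifferential_energy_iff]
  constructor
  · rintro ⟨hu, h⟩
    -- `w ↦ ⟪-u', w⟫` is a subgradient of `E` along differentials at `du`; nothing is yet known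
    -- about its continuity in `dw`, which the extension supplies.
    have hle : ∀ w : sobolevSubmodule ν p,
        ((innerₗ (Lp ℝ 2 ν) (-u')).comp (sobolevSubmodule ν p).subtype) w ≤
          E (hu.d + sobolevDifferential ν p w) - E hu.d := fun w => by
      have hw : MemW1 p w.1 := w.2
      have h1 := h _ (hu.add hw)
      rw [add_sub_cancel_left, toReal_energy E hu, toReal_energy E (hu.add hw)] at h1
      rw [hu.d_add hw] at h1
      exact le_sub_iff_add_le'.2 h1
    obtain ⟨L, hLd, hLle⟩ := exists_clm_extension_of_le_sub hcont hconv hu.d _ _ hle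
    obtain ⟨Y, hY⟩ := exists_vectorField_pairing_eq L
    refine ⟨hu, Y, fun g hgp hg2 => ?_, fun η => ?_⟩
    · have hw : MemW1 p (hg2.toLp g.1) := ⟨g, hgp, hg2.coeFn_toLp.symm⟩
      have h1 := hLd ⟨_, hw⟩
      rw [sobolevDifferential_apply, hw.d_eq hg2.coeFn_toLp.symm] at h1
      rw [hY, h1, integral_mul_eq_inner u' _ hg2.coeFn_toLp.symm]
      change _ = -inner ℝ (-u') (hg2.toLp g.1)
      rw [inner_neg_left, neg_neg, real_inner_comm]
    · rw [hY]
      exact hLle η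
  · rintro ⟨hu, Y, hdiv, hY⟩
    refine ⟨hu, fun z hz => ?_⟩
    obtain ⟨f, hfp, hfu, hfd⟩ := hu.exists_rep
    obtain ⟨g, hgp, hgz, hgd⟩ := hz.exists_rep
    -- `g - f` represents `z - u`, so it lies in both `L^p` and `L²` and is admissible in the
    -- definition of the divergence.
    have hk : ((g + (-1 : ℝ) • f : dirichletClass ν p) : X → ℝ) =ᵐ[ν] (z - u : Lp ℝ 2 ν) := by
      filter_upwards [hfu, hgz, Lp.coeFn_sub z u] with x h1 h2 h3
      rw [h3, Pi.sub_apply, ← h1, ← h2]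
      simp [sub_eq_add_neg]
    have h1 := hdiv (g + (-1 : ℝ) • f) (hgp.add (hfp.const_smul (-1)))
      ((memLp_congr_ae hk).2 (Lp.memLp _))
    rw [integral_mul_eq_inner u' _ hk, differential_add, differential_smul, neg_one_smul, ← hfd,
      ← hgd] at h1
    have h2 := hY (hz.d + -hu.d)
    have e : hu.d + (hz.d + -hu.d) = hz.d := by abel
    rw [e] at h2
    rw [toReal_energy E hu, toReal_energy E hz, inner_neg_left, real_inner_comm]
    linarith

end Energy

end MetricFlow

/-! ### Well-posedness and the divergence form of the flow. -/

theorem theorem3p3 {X : Type*} [MetricSpace X] [CompleteSpace X]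
    [TopologicalSpace.SeparableSpace X] [MeasurableSpace X] [BorelSpace X]
    (ν : MeasureTheory.Measure X) (hν : ∀ s : Set X, Bornology.IsBounded s → ν s < ⊤)
    (p : ℝ) [Fact (1 < p)]
    (E : MetricFlow.Cotangent ν p → ℝ)
    (hE_cont : Continuous E) (hE_conv : ConvexOn ℝ Set.univ E)
    (C : ℝ) (hC : 0 < C)
    (hE_coer : ∀ v : MetricFlow.Cotangent ν p,
      C * ∫ x, (MetricFlow.pointwiseNorm v x) ^ p ∂ν ≤ E v)
    (hF_lsc : LowerSemicontinuous (MetricFlow.energy E)) :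
    ∀ (u₀ : MeasureTheory.Lp ℝ 2 ν) (T : ℝ), 0 < T →
      (∃ u : ℝ → MeasureTheory.Lp ℝ 2 ν, MetricFlow.IsWeakSolution E u₀ T u ∧
        ∀ v : ℝ → MeasureTheory.Lp ℝ 2 ν, MetricFlow.IsWeakSolution E u₀ T v →
          Set.EqOn v u (Set.Icc 0 T)) ∧
      (∀ u : ℝ → MeasureTheory.Lp ℝ 2 ν,
        MetricFlow.IsWeakSolution E u₀ T u ↔ MetricFlow.IsDivergenceSolution E u₀ T u) := by
  intro u₀ T hT
  have hσ : SigmaFinite ν := MetricFlow.sigmaFinite_of_finite_on_bounded hν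
  have hf := MetricFlow.lscConvex_energy hE_conv (MetricFlow.nonneg_of_coercive hC hE_coer) hF_lsc
  refine ⟨?_, fun u => ?_⟩
  · obtain ⟨u, hreg, hu0, hevi⟩ :=
      hf.exists_evi (T := T) (MetricFlow.dense_sobolevSubmodule (p := p) hν u₀)
    have hu : MetricFlow.IsWeakSolution E u₀ T u := by
      refine ⟨hreg, hu0, ?_⟩
      filter_upwards [hreg.ae_hasDerivAt, ae_restrict_mem measurableSet_Ioo] with t ht htT
      obtain ⟨u', hu'⟩ := ht
      exact ⟨u', hu', MetricFlow.mem_subdifferential_energy_iff.2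
        ⟨(hevi 0 t le_rfl htT.1 htT.2.le).1, fun z hz => hevi.le_of_hasDerivAt htT hu' hz⟩⟩
    refine ⟨u, hu, fun v hv => hv.1.eqOn hT hu.1 (hv.2.1.trans hu.2.1.symm) ?_⟩
    filter_upwards [hv.2.2, hu.2.2] with t h1 h2
    obtain ⟨v', hv', hvs⟩ := h1
    obtain ⟨u', hu', hus⟩ := h2
    refine ⟨v', u', hv', hu', ?_⟩
    obtain ⟨hvW, hvle⟩ := MetricFlow.mem_subdifferential_energy_iff.1 hvs
    obtain ⟨huW, hule⟩ := MetricFlow.mem_subdifferential_energy_iff.1 hus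
    -- Monotonicity of `∂ℱ`: test each inclusion with the value of the other solution and add.
    have e1 := hvle _ huW
    have e2 := hule _ hvW
    have e3 : inner ℝ (-v') (u t - v t) = inner ℝ v' (v t - u t) := by
      rw [inner_neg_left, ← inner_neg_right, neg_sub]
    rw [e3] at e1
    rw [inner_neg_left] at e2
    rw [real_inner_comm, inner_sub_left]
    linarith
  · refine and_congr_right fun _ => and_congr_right fun _ => ?_
    refine eventually_congr (Eventually.of_forall fun t => exists_congr fun u' =>
      and_congr_right fun _ => ?_)
    exact MetricFlow.neg_mem_subdifferential_energy_iff hE_cont hE_conv
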